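/- Let $\mathfrak a$ be $\mathfrak o_{2n+1}$ ($n\ge 1$), $\mathfrak{sp}_{2n}$ ($n\ge 1$) or $\mathfrak o_{2n}$ ($n\ge 2$) over $\mathbb C$, and let $N=2n+1$ or $N=2n$ accordingly. Rows and columns of $N\times N$ matrices are labelled by $-n,\dots,n$, where $0$ is skipped if $N=2n$. Put $\theta_{ij}=1$ in the orthogonal case and $\theta_{ij}=\operatorname{sgn} i\cdot\operatorname{sgn} j$ in the symplectic case; $\kappa=N/2-1$ in the orthogonal case and $\kappa=N/2+1$ in the symplectic case. The Lie algebra $\mathfrak a\subset\mathfrak{gl}_N$ is spanned by the elements $F_{ij}=E_{ij}-\theta_{ij}E_{-j,-i}$. Let $$P=\sum_{i,j} e_{ij}\otimes e_{ji},\qquad Q=\sum_{i,j}\theta_{ij}\,e_{ij}\otimes e_{-i,-j},\qquad R(u)=1-\frac{P}{u}+\frac{Q}{u-\kappa}.$$ The extended Yangian $\mathrm X(\mathfrak a)$ is the unital associative $\mathbb C$-algebra with generators $t_{ij}^{(r)}$ ($-n\le i,j\le n$, $r\ge1$) and defining relations $R(u-v)\,T_1(u)\,T_2(v)=T_2(v)\,T_1(u)\,R(u-v)$,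 where $t_{ij}(u)=\delta_{ij}+\sum_{r\ge1}t_{ij}^{(r)}u^{-r}$, $T(u)=\sum_{i,j} e_{ij}\otimes t_{ij}(u)$, $T_1(u)=\sum_{i,j} e_{ij}\otimes1\otimes t_{ij}(u)$ and $T_2(u)=\sum_{i,j} 1\otimes e_{ij}\otimes t_{ij}(u)$. Let $t$ be the transposition $(e_{ij})^t=\theta_{ij}e_{-j,-i}$. There is a unique series $z(u)=1+z_1u^{-1}+z_2u^{-2}+\cdots$ with coefficients in $\mathrm X(\mathfrak a)$ such that $$T^t(u+\kappa)\,T(u)=T(u)\,T^t(u+\kappa)=z(u)\,1,$$ and all the $z_r$ are central in $\mathrm X(\mathfrak a)$. Moreover, the following hold. (a) Given any total ordering on the set of elements $t_{ij}^{(r)}$ and $z_r$, where $r\ge1$, and $i+j>0$ in the orthogonal case, $i+j\ge0$ in the symplectic case, the ordered monomials in these elements form a basis of $\mathrm X(\mathfrak a)$ over $\mathbb C$. (b) Let $\operatorname{gr}\mathrm X(\mathfrak a)$ be the graded algebra associated with the ascending filtration on $\mathrm X(\mathfrak a)$ defined by $\deg t_{ij}^{(r)}=r-1$. Then $z_r$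 has degree at most $r-1$. Let $\bar t_{ij}^{\,(r)}$ and $\bar z_r$ be the images of $t_{ij}^{(r)}$ and $z_r$ in the $(r-1)$-th component of $\operatorname{gr}\mathrm X(\mathfrak a)$. Then there is an isomorphism of $\mathbb C$-algebras $$\operatorname{gr}\mathrm X(\mathfrak a)\;\cong\;\mathrm U(\mathfrak a[x])\otimes\mathbb C[\zeta_1,\zeta_2,\dots],\qquad \bar t_{ij}^{\,(r)}\mapsto F_{ij}\,x^{r-1}\otimes 1+\tfrac12\,\delta_{ij}\,1\otimes\zeta_r,\qquad \bar z_r\mapsto 1\otimes\zeta_r,$$ for all $-n\le i,j\le n$ and $r\ge1$, where $\mathfrak a[x]=\mathfrak a\otimes\mathbb C[x]$. -/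

import Mathlib

open scoped TensorProduct Kronecker DirectSum Polynomial

/-! ### The associated graded algebra of an ascending filtration -/

/-- An ascending algebra filtration `F 0 ≤ F 1 ≤ ⋯` of an `R`-algebra `A`, with the
convention that the components of negative index vanish. -/
structure AscFiltration (R A : Type*) [CommRing R] [Ring A] [Algebra R A] where
  /-- The `p`-th component of the filtration. -/
  comp : ℕ → Submodule R A
  mono : Monotone comp
  one_mem : (1 : A) ∈ comp 0
  mul_mem : ∀ {p q : ℕ} {a b : A}, a ∈ comp p → b ∈ comp q → a * b ∈ comp (p + q)

namespace AscFiltration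

variable {R A : Type*} [CommRing R] [Ring A] [Algebra R A] (F : AscFiltration R A)

/-- The component just below index `p`: it is `0` for `p = 0` and `F (p - 1)` for `p > 0`. -/
def below : ℕ → Submodule R A
  | 0 => ⊥
  | p + 1 => F.comp p

/-- The `p`-th component `F p / F (p - 1)` of the associated graded algebra. -/
def Piece (p : ℕ) : Type _ := F.comp p ⧸ (F.below p).submoduleOf (F.comp p)

instance (p : ℕ) : AddCommGroup (F.Piece p) :=
  inferInstanceAs (AddCommGroup (F.comp p ⧸ (F.below p).submoduleOf (F.comp p)))

instance (p : ℕ) : Module R (F.Piece p) :=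
  inferInstanceAs (Module R (F.comp p ⧸ (F.below p).submoduleOf (F.comp p)))

/-- The image in the `p`-th graded component of an element of `F p`. -/
def cls {p : ℕ} {a : A} (h : a ∈ F.comp p) : F.Piece p :=
  Submodule.Quotient.mk ⟨a, h⟩

theorem cls_eq_cls {p : ℕ} {a b : A} (ha : a ∈ F.comp p) (hb : b ∈ F.comp p) :
    F.cls ha = F.cls hb ↔ a - b ∈ F.below p :=
  Submodule.Quotient.eq _

theorem exists_cls {p : ℕ} (x : F.Piece p) : ∃ (a : A) (h : a ∈ F.comp p), F.cls h = x := by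
  obtain ⟨⟨a, h⟩, rfl⟩ := Submodule.Quotient.mk_surjective _ x
  exact ⟨a, h, rfl⟩

theorem mul_below {p q : ℕ} {a b : A} (ha : a ∈ F.comp p) (hb : b ∈ F.below q) :
    a * b ∈ F.below (p + q) := by
  cases q with
  | zero =>
    have hb0 : b = 0 := hb
    rw [hb0, mul_zero]
    exact Submodule.zero_mem _
  | succ q => exact F.mul_mem ha hb

theorem below_mul {p q : ℕ} {a b : A} (ha : a ∈ F.below p) (hb : b ∈ F.comp q) :
    a * b ∈ F.below (p + q) := by
  cases p with
  | zero =>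
    have ha0 : a = 0 := ha
    rw [ha0, zero_mul]
    exact Submodule.zero_mem _
  | succ p =>
    have h := F.mul_mem (p := p) (q := q) ha hb
    rw [show p + 1 + q = (p + q) + 1 by omega]
    exact h

/-- Multiplication `gr_p × gr_q → gr_(p+q)` of graded components, induced by that of `A`. -/
def pieceMul (p q : ℕ) : F.Piece p →ₗ[R] F.Piece q →ₗ[R] F.Piece (p + q) :=
  Submodule.liftQ _
    { toFun := fun a => Submodule.mapQ _ _
        { toFun := fun b => ⟨a.1 * b.1, F.mul_mem a.2 b.2⟩
          map_add' := fun b c => Subtype.ext (mul_add a.1 b.1 c.1)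
          map_smul' := fun r b => Subtype.ext (mul_smul_comm r a.1 b.1) }
        (fun b hb => F.mul_below a.2 hb)
      map_add' := fun a b => by
        refine Submodule.linearMap_qext _ (LinearMap.ext fun c => ?_)
        exact congrArg Submodule.Quotient.mk (Subtype.ext (add_mul a.1 b.1 c.1))
      map_smul' := fun r a => by
        refine Submodule.linearMap_qext _ (LinearMap.ext fun c => ?_)
        exact congrArg Submodule.Quotient.mk (Subtype.ext (smul_mul_assoc r a.1 c.1)) }
    (fun a ha => by
      refine Submodule.linearMap_qext _ (LinearMap.ext fun c => ?_)
      exact (Submodule.Quotient.mk_eq_zero _).2 (F.below_mul ha c.2))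

theorem pieceMul_cls {p q : ℕ} {a b : A} (ha : a ∈ F.comp p) (hb : b ∈ F.comp q) :
    F.pieceMul p q (F.cls ha) (F.cls hb) = F.cls (F.mul_mem ha hb) := rfl

theorem mk_cls_eq {p q : ℕ} {a b : A} (ha : a ∈ F.comp p) (hb : b ∈ F.comp q)
    (hpq : p = q) (hab : a = b) :
    (GradedMonoid.mk p (F.cls ha) : GradedMonoid F.Piece) = GradedMonoid.mk q (F.cls hb) := by
  subst hpq hab
  rfl

instance : GradedMonoid.GOne F.Piece where
  one := F.cls F.one_mem

instance : GradedMonoid.GMul F.Piece where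
  mul {p q} x y := F.pieceMul p q x y

instance : GradedMonoid.GMonoid F.Piece where
  one_mul := by
    rintro ⟨p, x⟩
    obtain ⟨a, ha, rfl⟩ := F.exists_cls x
    exact F.mk_cls_eq (F.mul_mem F.one_mem ha) ha (zero_add p) (one_mul a)
  mul_one := by
    rintro ⟨p, x⟩
    obtain ⟨a, ha, rfl⟩ := F.exists_cls x
    exact F.mk_cls_eq (F.mul_mem ha F.one_mem) ha (add_zero p) (mul_one a)
  mul_assoc := by
    rintro ⟨p, x⟩ ⟨q, y⟩ ⟨r, z⟩
    obtain ⟨a, ha, rfl⟩ := F.exists_cls x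
    obtain ⟨b, hb, rfl⟩ := F.exists_cls y
    obtain ⟨c, hc, rfl⟩ := F.exists_cls z
    exact F.mk_cls_eq (F.mul_mem (F.mul_mem ha hb) hc) (F.mul_mem ha (F.mul_mem hb hc))
      (add_assoc p q r) (mul_assoc a b c)

instance : DirectSum.GRing F.Piece where
  mul_zero x := (F.pieceMul _ _ x).map_zero
  zero_mul y := by
    change F.pieceMul _ _ 0 y = 0
    rw [map_zero, LinearMap.zero_apply]
  mul_add x y z := (F.pieceMul _ _ x).map_add y z
  add_mul x y z := by
    change F.pieceMul _ _ (x + y) z = _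
    rw [map_add, LinearMap.add_apply]
    rfl
  natCast m := m • F.cls F.one_mem
  natCast_zero := zero_smul ℕ _
  natCast_succ m := succ_nsmul _ m
  intCast m := m • F.cls F.one_mem
  intCast_ofNat m := natCast_zsmul _ m
  intCast_negSucc_ofNat m := negSucc_zsmul _ m

instance : DirectSum.GAlgebra R F.Piece where
  toFun := (LinearMap.toSpanSingleton R (F.Piece 0) (F.cls F.one_mem)).toAddMonoidHom
  map_one := one_smul R (F.cls F.one_mem)
  map_mul r s := by
    refine F.mk_cls_eq (Submodule.smul_mem _ (r * s) F.one_mem)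
      (F.mul_mem (Submodule.smul_mem _ r F.one_mem) (Submodule.smul_mem _ s F.one_mem)) rfl ?_
    rw [smul_mul_smul_comm, one_mul]
  commutes r := by
    rintro ⟨p, x⟩
    obtain ⟨a, ha, rfl⟩ := F.exists_cls x
    refine F.mk_cls_eq (F.mul_mem (Submodule.smul_mem _ r F.one_mem) ha)
      (F.mul_mem ha (Submodule.smul_mem _ r F.one_mem)) (add_comm 0 p) ?_
    rw [smul_mul_assoc, mul_smul_comm, one_mul, mul_one]
  smul_def r := by
    rintro ⟨p, x⟩
    obtain ⟨a, ha, rfl⟩ := F.exists_cls x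
    refine F.mk_cls_eq (Submodule.smul_mem _ r ha)
      (F.mul_mem (Submodule.smul_mem _ r F.one_mem) ha) (zero_add p).symm ?_
    rw [smul_mul_assoc, one_mul]

/-- The associated graded algebra `gr A = ⨁ p, F p / F (p - 1)`. -/
abbrev Gr : Type _ := ⨁ p, F.Piece p

/-- The image of an element of `F p` in the `p`-th component of `gr A`, as an element of `gr A`. -/
noncomputable def symb {p : ℕ} {a : A} (h : a ∈ F.comp p) : F.Gr :=
  DirectSum.of F.Piece p (F.cls h)

end AscFiltration

/-! ### The orthogonal and symplectic Lie algebras -/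

/-- The three series of Lie algebras: `B` is `𝔬_(2n+1)`, `C` is `𝔰𝔭_(2n)` and `D` is `𝔬_(2n)`. -/
inductive OSType
  | B
  | C
  | D

namespace OSType

/-- The symplectic case is type `C`; types `B` and `D` are the orthogonal case. -/
def isSymplectic : OSType → Bool
  | B => false
  | C => true
  | D => false

/-- Whether `N` is odd, that is, whether the index `0` occurs. -/
def isOdd : OSType → Bool
  | B => true
  | C => false
  | D => false

/-- The size `N` of the matrices: `N = 2n + 1` for type `B` and `N = 2n` for types `C` and `D`. -/
def size (ty : OSType) (n : ℕ) : ℕ := if ty.isOdd then 2 * n + 1 else 2 * n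

/-- `κ = N / 2 - 1` in the orthogonal case and `κ = N / 2 + 1` in the symplectic case. -/
noncomputable def kappa (ty : OSType) (n : ℕ) : ℂ :=
  if ty.isSymplectic then (ty.size n : ℂ) / 2 + 1 else (ty.size n : ℂ) / 2 - 1

/-- The row and column indices `-n, …, n`, where `0` is skipped if `N` is even. -/
def Idx (ty : OSType) (n : ℕ) : Type :=
  {i : ℤ // i ∈ (Finset.Icc (-(n : ℤ)) n).filter fun i => ty.isOdd = true ∨ i ≠ 0}

instance (ty : OSType) (n : ℕ) : DecidableEq (ty.Idx n) :=
  inferInstanceAs (DecidableEq (Subtype _))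

noncomputable instance (ty : OSType) (n : ℕ) : Fintype (ty.Idx n) :=
  inferInstanceAs (Fintype {i : ℤ // i ∈ (Finset.Icc (-(n : ℤ)) n).filter fun i =>
    ty.isOdd = true ∨ i ≠ 0})

variable {ty : OSType} {n : ℕ}

/-- The index `-i`. -/
def neg (i : ty.Idx n) : ty.Idx n :=
  ⟨-i.1, by
    have h := i.2
    simp only [Finset.mem_filter, Finset.mem_Icc, ne_eq, neg_eq_zero] at h ⊢
    exact ⟨⟨by omega, by omega⟩, h.2⟩⟩

/-- `θ i j` is `1` in the orthogonal case and `sgn i * sgn j` in the symplectic case. -/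
noncomputable def theta (i j : ty.Idx n) : ℂ :=
  if ty.isSymplectic then ((i.1.sign * j.1.sign : ℤ) : ℂ) else 1

attribute [local instance] LieRing.ofAssociativeRing

/-- The Gram matrix of the bilinear form preserved by the Lie algebra: its `(i, j)` entry is zero
unless `j = -i`, and the `(i, -i)` entry is `1` in the orthogonal case (a symmetric form) and
`sgn i` in the symplectic case (an alternating form). -/
noncomputable def form (ty : OSType) (n : ℕ) : Matrix (ty.Idx n) (ty.Idx n) ℂ :=
  Matrix.of fun i j =>
    if j = neg i then (if ty.isSymplectic then ((i.1.sign : ℤ) : ℂ) else 1) else 0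

/-- The Lie algebra `𝔞`, that is `𝔬_(2n+1)`, `𝔰𝔭_(2n)` or `𝔬_(2n)`, as a subalgebra of `𝔤𝔩_N`. -/
noncomputable def lieAlg (ty : OSType) (n : ℕ) : LieSubalgebra ℂ (Matrix (ty.Idx n) (ty.Idx n) ℂ) :=
  skewAdjointMatricesLieSubalgebra (form ty n)

theorem neg_neg (i : ty.Idx n) : neg (neg i) = i := Subtype.ext (_root_.neg_neg i.1)

theorem neg_val (i : ty.Idx n) : (neg i).1 = -i.1 := rfl

theorem neg_eq_iff {i j : ty.Idx n} : neg i = j ↔ i = neg j :=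
  ⟨fun h => by rw [← h, neg_neg], fun h => by rw [h, neg_neg]⟩

theorem sign_mul_sign (h : ty.isSymplectic = true) (i : ty.Idx n) :
    i.1.sign * i.1.sign = 1 := by
  have h0 := (Finset.mem_filter.1 i.2).2
  have hodd : ty.isOdd = false := by cases ty <;> simp_all [isSymplectic, isOdd]
  have h1 : i.1 ≠ 0 := by simpa [hodd] using h0
  rcases lt_trichotomy i.1 0 with h | h | h
  · rw [Int.sign_eq_neg_one_of_neg h]; rfl
  · exact absurd h h1
  · rw [Int.sign_eq_one_of_pos h]; rfl

theorem theta_mul_sign (i j : ty.Idx n) (h : ty.isSymplectic = true) :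
    theta i j * ((j.1.sign : ℤ) : ℂ) = ((i.1.sign : ℤ) : ℂ) := by
  rw [theta, if_pos h, ← Int.cast_mul, mul_assoc, sign_mul_sign h, mul_one]

theorem theta_mul_theta (i j : ty.Idx n) : theta i j * theta i j = 1 := by
  by_cases h : ty.isSymplectic = true
  · rw [theta, if_pos h, ← Int.cast_mul, mul_mul_mul_comm, sign_mul_sign h, sign_mul_sign h]
    simp
  · rw [theta, if_neg h, one_mul]

theorem theta_neg_neg (i j : ty.Idx n) : theta (neg j) (neg i) = theta i j := by
  simp only [theta, neg, Int.sign_neg, neg_mul_neg, mul_comm]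

/-- A matrix `A` belongs to `𝔞` exactly when `A i j + θ i j * A (-j) (-i) = 0` for all `i`, `j`. -/
theorem mem_lieAlg (A : Matrix (ty.Idx n) (ty.Idx n) ℂ) :
    A ∈ lieAlg ty n ↔ ∀ i j, A i j + theta i j * A (neg j) (neg i) = 0 := by
  have key : A ∈ lieAlg ty n ↔ A.transpose * form ty n = form ty n * -A := by
    rw [lieAlg, mem_skewAdjointMatricesLieSubalgebra, mem_skewAdjointMatricesSubmodule]
    rfl
  rw [key, ← Matrix.ext_iff]
  have hL : ∀ i j, (A.transpose * form ty n) (neg j) i =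
      A (neg i) (neg j) * (if ty.isSymplectic then (((neg i).1.sign : ℤ) : ℂ) else 1) := by
    intro i j
    rw [Matrix.mul_apply, Finset.sum_eq_single (neg i)]
    · simp [form, neg_neg]
    · intro k _ hk
      have : ¬ i = neg k := fun h => hk (by rw [h, neg_neg])
      simp [form, this]
    · simp
  have hR : ∀ i j, (form ty n * -A) (neg j) i =
      -((if ty.isSymplectic then (((neg j).1.sign : ℤ) : ℂ) else 1) * A j i) := by
    intro i j
    rw [Matrix.mul_apply, Finset.sum_eq_single j]
    · simp [form, neg_neg]
    · intro k _ hk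
      simp [form, neg_neg, hk]
    · simp
  constructor
  · intro h i j
    have h1 := h (neg i) j
    rw [hL j i, hR j i] at h1
    by_cases hs : ty.isSymplectic = true
    · simp only [hs, if_true] at h1
      have e := sign_mul_sign hs i
      have e' : ((i.1.sign : ℤ) : ℂ) * ((i.1.sign : ℤ) : ℂ) = 1 := by exact_mod_cast e
      simp only [theta, hs, if_true, neg_val, Int.sign_neg, Int.cast_neg, Int.cast_mul] at h1 ⊢
      linear_combination (-((i.1.sign : ℤ) : ℂ)) * h1 - A i j * e'
    · simp only [hs, theta] at h1 ⊢
      simp at h1 ⊢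
      linear_combination h1
  · intro h a j
    obtain ⟨i, rfl⟩ : ∃ i, a = neg i := ⟨neg a, (neg_neg a).symm⟩
    rw [hL j i, hR j i]
    have h1 := h i j
    by_cases hs : ty.isSymplectic = true
    · have e := sign_mul_sign hs i
      have e' : ((i.1.sign : ℤ) : ℂ) * ((i.1.sign : ℤ) : ℂ) = 1 := by exact_mod_cast e
      simp only [theta, hs, if_true, neg_val, Int.sign_neg, Int.cast_neg, Int.cast_mul] at h1 ⊢
      linear_combination (-((i.1.sign : ℤ) : ℂ)) * h1 + ((j.1.sign : ℤ) : ℂ) * A (neg j) (neg i) * e'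
    · simp only [hs, theta] at h1 ⊢
      simp at h1 ⊢
      linear_combination h1

/-- The matrix `E i j - θ i j • E (-j) (-i)`. -/
noncomputable def Fmat (i j : ty.Idx n) : Matrix (ty.Idx n) (ty.Idx n) ℂ :=
  Matrix.single i j 1 - theta i j • Matrix.single (neg j) (neg i) 1

theorem Fmat_mem (i j : ty.Idx n) : Fmat i j ∈ lieAlg ty n := by
  rw [mem_lieAlg]
  intro k l
  have e1 : (neg j = k ∧ neg i = l) ↔ (i = neg l ∧ j = neg k) := by
    rw [neg_eq_iff, neg_eq_iff, and_comm]
  have e2 : (neg j = neg l ∧ neg i = neg k) ↔ (i = k ∧ j = l) := by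
    rw [neg_eq_iff, neg_eq_iff, neg_neg, neg_neg, and_comm]
  have ha : i = k ∧ j = l → theta i j * theta k l = 1 := by
    rintro ⟨rfl, rfl⟩
    exact theta_mul_theta i j
  have hb : i = neg l ∧ j = neg k → theta i j = theta k l := by
    rintro ⟨rfl, rfl⟩
    exact theta_neg_neg k l
  simp only [Fmat, Matrix.sub_apply, Matrix.smul_apply, Matrix.single_apply, smul_eq_mul, e1, e2]
  split_ifs with h1 h2 h2
  · linear_combination -(ha h1) - hb h2
  · linear_combination -(ha h1)
  · linear_combination -(hb h2)
  · ring

/-- The elements `F i j = E i j - θ i j • E (-j) (-i)` of `𝔞`. -/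
noncomputable def F (i j : ty.Idx n) : lieAlg ty n := ⟨Fmat i j, Fmat_mem i j⟩

/-- The polynomial current Lie algebra `𝔞[x] = 𝔞 ⊗ ℂ[x]`; the element `a x^s` is
`X ^ s ⊗ₜ a`, and `[a x^r, b x^s] = [a, b] x^(r+s)`. -/
abbrev Current (ty : OSType) (n : ℕ) : Type := ℂ[X] ⊗[ℂ] lieAlg ty n

/-- The universal enveloping algebra `U(𝔞[x])`. -/
abbrev UCurrent (ty : OSType) (n : ℕ) : Type := UniversalEnvelopingAlgebra ℂ (Current ty n)

/-- The element `F i j x^s` of `U(𝔞[x])`. -/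
noncomputable def Fx (i j : ty.Idx n) (s : ℕ) : UCurrent ty n :=
  UniversalEnvelopingAlgebra.ι ℂ ((Polynomial.X ^ s : ℂ[X]) ⊗ₜ[ℂ] F i j : Current ty n)

end OSType

/-! ### The extended Yangian -/

namespace ExtYangian

open OSType

variable {ty : OSType} {n : ℕ}

/-- The free algebra on the symbols `t_ij^(r)` with `r ≥ 1`; the triple `(i, j, r)` stands for
`t_ij^(r+1)`. -/
abbrev Free (ty : OSType) (n : ℕ) : Type := FreeAlgebra ℂ (ty.Idx n × ty.Idx n × ℕ)

/-- The elements `t_ij^(r)`, `r ≥ 0`, of the free algebra, with `t_ij^(0) = δ_ij`. -/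
noncomputable def freeT (i j : ty.Idx n) : ℕ → Free ty n
  | 0 => if i = j then 1 else 0
  | r + 1 => FreeAlgebra.ι ℂ (i, j, r)

section RTT

/-- Formal power series in two commuting variables, `x = u⁻¹` (variable `0`) and `y = v⁻¹`
(variable `1`), with coefficients in the free algebra. -/
abbrev Ser (ty : OSType) (n : ℕ) : Type := MvPowerSeries (Fin 2) (Free ty n)

/-- Matrices representing `End ℂ^N ⊗ End ℂ^N ⊗ Ser`: the entry in row `(i, k)` and column `(j, l)`
is the coefficient of `e_ij ⊗ e_kl`. -/
abbrev Mat2 (ty : OSType) (n : ℕ) : Type :=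
  Matrix (ty.Idx n × ty.Idx n) (ty.Idx n × ty.Idx n) (Ser ty n)

/-- The series `t_ij(u) = ∑ r, t_ij^(r) u^(-r)` in the variable `u = u_c`, where `u_0 = u` and
`u_1 = v`. -/
noncomputable def tSer (c : Fin 2) (i j : ty.Idx n) : Ser ty n := fun m =>
  if m = Finsupp.single c (m c) then freeT i j (m c) else 0

/-- `T_1(u) = ∑ e_ij ⊗ 1 ⊗ t_ij(u)`. -/
noncomputable def T1u (ty : OSType) (n : ℕ) : Mat2 ty n :=
  (Matrix.of fun i j => tSer 0 i j) ⊗ₖ (1 : Matrix (ty.Idx n) (ty.Idx n) (Ser ty n))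

/-- `T_2(v) = ∑ 1 ⊗ e_ij ⊗ t_ij(v)`. -/
noncomputable def T2v (ty : OSType) (n : ℕ) : Mat2 ty n :=
  (1 : Matrix (ty.Idx n) (ty.Idx n) (Ser ty n)) ⊗ₖ (Matrix.of fun i j => tSer 1 i j)

/-- The permutation operator `P = ∑ e_ij ⊗ e_ji`. -/
noncomputable def P (ty : OSType) (n : ℕ) : Matrix (ty.Idx n × ty.Idx n) (ty.Idx n × ty.Idx n) ℂ :=
  ∑ i : ty.Idx n, ∑ j : ty.Idx n, Matrix.single i j (1 : ℂ) ⊗ₖ Matrix.single j i (1 : ℂ)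

/-- The operator `Q = ∑ θ_ij e_ij ⊗ e_(-i,-j)`. -/
noncomputable def Q (ty : OSType) (n : ℕ) : Matrix (ty.Idx n × ty.Idx n) (ty.Idx n × ty.Idx n) ℂ :=
  ∑ i : ty.Idx n, ∑ j : ty.Idx n,
    theta i j • (Matrix.single i j (1 : ℂ) ⊗ₖ Matrix.single (neg i) (neg j) (1 : ℂ))

/-- `(u - v) / (u v) = y - x`. -/
noncomputable def dSer (ty : OSType) (n : ℕ) : Ser ty n := MvPowerSeries.X 1 - MvPowerSeries.X 0

/-- `(u - v - κ) / (u v) = y - x - κ x y`. -/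
noncomputable def dkSer (ty : OSType) (n : ℕ) : Ser ty n :=
  MvPowerSeries.X 1 - MvPowerSeries.X 0
    - ty.kappa n • (MvPowerSeries.X 0 * MvPowerSeries.X 1)

/-- The `R`-matrix `R(u - v) = 1 - P / (u - v) + Q / (u - v - κ)`, multiplied by the central
non-zero-divisor `(u - v) (u - v - κ) / (u v)^2` in order to clear the denominators. -/
noncomputable def Rmat (ty : OSType) (n : ℕ) : Mat2 ty n :=
  (dSer ty n * dkSer ty n) • (1 : Mat2 ty n)
    - (MvPowerSeries.X 0 * MvPowerSeries.X 1 * dkSer ty n) •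
        (P ty n).map (algebraMap ℂ (Ser ty n))
    + (MvPowerSeries.X 0 * MvPowerSeries.X 1 * dSer ty n) •
        (Q ty n).map (algebraMap ℂ (Ser ty n))

/-- The defining relations of the extended Yangian: all the coefficients of all the matrix entries
of the relation `R(u - v) T_1(u) T_2(v) = T_2(v) T_1(u) R(u - v)`. -/
inductive RTTRel (ty : OSType) (n : ℕ) : Free ty n → Free ty n → Prop
  | mk (a b : ty.Idx n × ty.Idx n) (m : Fin 2 →₀ ℕ) :
      RTTRel ty n (MvPowerSeries.coeff m ((Rmat ty n * T1u ty n * T2v ty n) a b))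
        (MvPowerSeries.coeff m ((T2v ty n * T1u ty n * Rmat ty n) a b))

end RTT

/-- The extended Yangian `X(𝔞)`. -/
abbrev XAlg (ty : OSType) (n : ℕ) : Type := RingQuot (RTTRel ty n)

/-- The elements `t_ij^(r)`, `r ≥ 0`, of the extended Yangian. -/
noncomputable def t (i j : ty.Idx n) (r : ℕ) : XAlg ty n :=
  RingQuot.mkAlgHom ℂ (RTTRel ty n) (freeT i j r)

/-- The substitution `f(u) ↦ f(u + c)` on power series in `u⁻¹`, which sends `u^(-r)` to
`(u + c)^(-r) = ∑ m, (-r choose m) c^m u^(-r-m)`. -/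
noncomputable def shift {A : Type*} [Ring A] [Algebra ℂ A] (c : ℂ) (f : PowerSeries A) :
    PowerSeries A :=
  PowerSeries.mk fun s => ∑ r ∈ Finset.range (s + 1),
    (((Ring.choose (-(r : ℤ)) (s - r) : ℤ) : ℂ) * c ^ (s - r)) • PowerSeries.coeff r f

/-- The matrix `T(u)`, whose entries `t_ij(u)` are power series in `u⁻¹` over `X(𝔞)`. -/
noncomputable def T (ty : OSType) (n : ℕ) :
    Matrix (ty.Idx n) (ty.Idx n) (PowerSeries (XAlg ty n)) :=
  Matrix.of fun i j => PowerSeries.mk fun r => t i j r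

/-- The matrix `T^t(u + κ)`, where `(e_ij)^t = θ_ij e_(-j,-i)`; its `(k, l)` entry is
`θ_kl t_(-l,-k)(u + κ)`. -/
noncomputable def Tt (ty : OSType) (n : ℕ) :
    Matrix (ty.Idx n) (ty.Idx n) (PowerSeries (XAlg ty n)) :=
  Matrix.of fun k l => theta k l • shift (ty.kappa n) (T ty n (neg l) (neg k))

/-- The series `z(u)`, determined by `T^t(u + κ) T(u) = z(u) 1`; it is extracted from this
scalar matrix as the normalized trace. -/
noncomputable def zSer (ty : OSType) (n : ℕ) : PowerSeries (XAlg ty n) :=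
  ((ty.size n : ℂ)⁻¹) • Matrix.trace (Tt ty n * T ty n)

/-- The coefficient `z_r` of `u^(-r)` in `z(u)`. -/
noncomputable def z (ty : OSType) (n : ℕ) (r : ℕ) : XAlg ty n := PowerSeries.coeff r (zSer ty n)

/-- Labels of the elements of the Poincaré-Birkhoff-Witt basis: `t i j h r` stands for
`t_ij^(r+1)` with `i + j > 0` in the orthogonal and `i + j ≥ 0` in the symplectic case, and `z r`
stands for `z_(r+1)`, where `r = 0, 1, 2, …`. -/
inductive PBWIndex (ty : OSType) (n : ℕ) : Type
  | t (i j : ty.Idx n) (h : if ty.isSymplectic then 0 ≤ i.1 + j.1 else 0 < i.1 + j.1) (r : ℕ)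
  | z (r : ℕ)

/-- The element of the extended Yangian with a given label. -/
noncomputable def pbwElem : PBWIndex ty n → XAlg ty n
  | .t i j _ r => t i j (r + 1)
  | .z r => z ty n (r + 1)

/-- The ordered monomial attached to a finite multiset of labels: the product of the elements, with
multiplicities, in increasing order from left to right. -/
noncomputable def orderedMonomial (o : LinearOrder (PBWIndex ty n))
    (m : Multiset (PBWIndex ty n)) : XAlg ty n :=
  ((m.sort o.le).map pbwElem).prod

/-- The ascending filtration with `deg t_ij^(r) = r - 1`: the `p`-th component is spanned by the
products of generators whose degrees add up to at most `p`. A label `(i, j, r)` stands for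
`t_ij^(r+1)` and so has degree `r`. -/
noncomputable def filtration (ty : OSType) (n : ℕ) : AscFiltration ℂ (XAlg ty n) where
  comp p := Submodule.span ℂ
    {x | ∃ l : List (ty.Idx n × ty.Idx n × ℕ), (l.map fun g => g.2.2).sum ≤ p ∧
      x = (l.map fun g => t g.1 g.2.1 (g.2.2 + 1)).prod}
  mono p q hpq := by
    refine Submodule.span_mono ?_
    rintro x ⟨l, hl, rfl⟩
    exact ⟨l, hl.trans hpq, rfl⟩
  one_mem := Submodule.subset_span ⟨[], le_rfl, rfl⟩
  mul_mem {p q a b} ha hb := by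
    have h := Submodule.mul_mem_mul ha hb
    rw [Submodule.span_mul_span] at h
    refine Submodule.span_mono ?_ h
    rintro _ ⟨_, ⟨l, hl, rfl⟩, _, ⟨l', hl', rfl⟩, rfl⟩
    refine ⟨l ++ l', ?_, ?_⟩
    · rw [List.map_append, List.sum_append]
      exact add_le_add hl hl'
    · rw [List.map_append, List.prod_append]

theorem t_mem (i j : ty.Idx n) (r : ℕ) : t i j (r + 1) ∈ (filtration ty n).comp r :=
  Submodule.subset_span ⟨[(i, j, r)], by simp, by simp⟩

/-- The associated graded algebra `gr X(𝔞)`. -/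
abbrev GrX (ty : OSType) (n : ℕ) : Type := (filtration ty n).Gr

end ExtYangian

/-! The leading terms of the defining relations bound the algebra from above, sufficiently many
representations bound it from below, and the two bounds meet.

Upper bound. Discarding terms of lower filtration degree in the RTT relation gives two facts. The
commutator of t_ij^(r+1) and t_kl^(s+1) is, up to lower terms, a linear expression in the generators
of degree r+s, modelled on the bracket of F_ij x^r and F_kl x^s (`commutator_sub_mem`). Moreover
t_ij^(r) + θ_ij t_(-j,-i)^(r) is δ_ij z_r up to lower terms (`t_add_t_sub_mem`). The second fact
also follows from RTT, by evaluating commutators with t_kl^(0) = δ_kl; at that stage z(u) is only a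
normalized trace. Straightening then shows that ordered monomials span each filtration component
(`comp_eq_span`).

Lower bound. The R-matrix, with one tensor factor read as the representation space, satisfies RTT by
the Yang-Baxter equation (`isRTT_vecL`) and is crossing symmetric (`isCross_vecL`). Both properties
pass to products of matrices with commuting entries and to central scalar multiples, so tensor
products of evaluation modules twisted by a scalar series are representations (`rho`). The spectral
parameter of each factor carries an auxiliary polynomial variable measuring filtration degree. In
top degree t_ij^(r+1) acts as a sum over the factors of evaluations of F_ij x^r in the dual of the
vector representation, plus δ_ij f(r), and z_(r+1) acts by the free scalar 2 f(r). For a linear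
combination of ordered monomials, take a monomial of maximal weight and, among those, with the
largest number k of t-letters. On k factors, functionals dual to these letters isolate the t-part,
and varying f separates the z-parts (`eq_zero_of_rho_eq_zero`).

Hence the ordered monomials form a basis and the representations are jointly faithful. The
identities T^t(u+κ) T(u) = T(u) T^t(u+κ) = z(u) and the centrality of z(u) then hold in the extended
Yangian because they hold in each representation (`Tt_mul_T`, `T_mul_Tt`, `z_commute`).

The leading-term relations define a homomorphism `grHom` from U(𝔞[x]) ⊗ ℂ[ζ_1, ζ_2, …] onto the
graded algebra. Its source is spanned by ordered monomials, by the easy half of the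
Poincaré-Birkhoff-Witt theorem, and their images are the symbols of a basis adapted to the
filtration. These are linearly independent, so `grHom` is bijective. -/

/-! ### Matrices satisfying the RTT relation over an arbitrary algebra -/

namespace ExtYangian

open OSType

section Slots

variable {I R : Type*} [Fintype I] [DecidableEq I] [Ring R]

/-- The embedding `M ↦ M ⊗ 1` of matrices over a possibly noncommutative ring. -/
def slotOne : Matrix I I R →+* Matrix (I × I) (I × I) R where
  toFun M := Matrix.of fun a b => if a.2 = b.2 then M a.1 b.1 else 0
  map_one' := by
    ext a b
    by_cases h1 : a.1 = b.1 <;> by_cases h2 : a.2 = b.2 <;>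
      simp [Matrix.one_apply, Prod.ext_iff, h1, h2]
  map_mul' M N := by
    ext a b
    by_cases h : a.2 = b.2 <;>
      simp [Matrix.mul_apply, Fintype.sum_prod_type, h]
  map_zero' := by ext a b; simp
  map_add' M N := by
    ext a b
    by_cases h : a.2 = b.2 <;> simp [h]

/-- The embedding `M ↦ 1 ⊗ M` of matrices over a possibly noncommutative ring. -/
def slotTwo : Matrix I I R →+* Matrix (I × I) (I × I) R where
  toFun M := Matrix.of fun a b => if a.1 = b.1 then M a.2 b.2 else 0
  map_one' := by
    ext a b
    by_cases h1 : a.1 = b.1 <;> by_cases h2 : a.2 = b.2 <;>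
      simp [Matrix.one_apply, Prod.ext_iff, h1, h2]
  map_mul' M N := by
    ext a b
    by_cases h : a.1 = b.1 <;>
      simp [Matrix.mul_apply, Fintype.sum_prod_type, h]
  map_zero' := by ext a b; simp
  map_add' M N := by
    ext a b
    by_cases h : a.1 = b.1 <;> simp [h]

theorem slotOne_apply (M : Matrix I I R) (a b : I × I) :
    slotOne M a b = if a.2 = b.2 then M a.1 b.1 else 0 := rfl

theorem slotTwo_apply (M : Matrix I I R) (a b : I × I) :
    slotTwo M a b = if a.1 = b.1 then M a.2 b.2 else 0 := rfl

/-- Over a noncommutative ring the two orders of multiplication differ exactly in the order of the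
entries; this is the information carried by the two sides of RTT. -/
theorem slotOne_mul_slotTwo_apply (M N : Matrix I I R) (a b : I × I) :
    (slotOne M * slotTwo N) a b = M a.1 b.1 * N a.2 b.2 := by
  simp [Matrix.mul_apply, Fintype.sum_prod_type, slotOne_apply, slotTwo_apply]

theorem slotTwo_mul_slotOne_apply (M N : Matrix I I R) (a b : I × I) :
    (slotTwo N * slotOne M) a b = N a.2 b.2 * M a.1 b.1 := by
  simp [Matrix.mul_apply, Fintype.sum_prod_type, slotOne_apply, slotTwo_apply]

end Slots

/-! ### One-variable series inside two-variable series -/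

section Embed

variable {B : Type*} [Ring B]

/-- A power series in one variable as a series in the variable with number `c`. -/
noncomputable def embedFun (c : Fin 2) (f : PowerSeries B) : MvPowerSeries (Fin 2) B :=
  fun m => if m = Finsupp.single c (m c) then PowerSeries.coeff (m c) f else 0

theorem coeff_embedFun (c : Fin 2) (f : PowerSeries B) (m : Fin 2 →₀ ℕ) :
    MvPowerSeries.coeff m (embedFun c f) =
      if m = Finsupp.single c (m c) then PowerSeries.coeff (m c) f else 0 := rfl

variable (B) in
/-- The embedding of power series in one variable into power series in two variables, as series
in the variable with number `c`. -/
noncomputable def embed (c : Fin 2) : PowerSeries B →+* MvPowerSeries (Fin 2) B where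
  toFun := embedFun c
  map_one' := by
    ext m
    rw [coeff_embedFun, MvPowerSeries.coeff_one]
    simp only [PowerSeries.coeff_one]
    by_cases h : m = 0
    · subst h; simp
    · rw [if_neg h]
      split_ifs with h1 h2
      · rw [h2, Finsupp.single_zero] at h1; exact absurd h1 h
      · rfl
      · rfl
  map_mul' f g := by
    ext m
    classical
    rw [MvPowerSeries.coeff_mul, coeff_embedFun]
    by_cases h : m = Finsupp.single c (m c)
    · rw [if_pos h, PowerSeries.coeff_mul]
      generalize m c = k at h
      subst h
      rw [Finsupp.antidiagonal_single, Finset.sum_map]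
      refine Finset.sum_congr rfl fun p _ => ?_
      simp [coeff_embedFun]
    · rw [if_neg h]
      refine (Finset.sum_eq_zero fun p hp => ?_).symm
      rw [Finset.HasAntidiagonal.mem_antidiagonal] at hp
      simp only [coeff_embedFun]
      split_ifs with h1 h2
      · exfalso
        apply h
        rw [← hp, h1, h2, ← Finsupp.single_add]
        simp
      all_goals simp
  map_zero' := by
    ext m
    simp [coeff_embedFun]
  map_add' f g := by
    ext m
    rw [map_add, coeff_embedFun, coeff_embedFun, coeff_embedFun]
    split_ifs <;> simp

theorem coeff_embed (c : Fin 2) (f : PowerSeries B) (m : Fin 2 →₀ ℕ) :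
    MvPowerSeries.coeff m (embed B c f) =
      if m = Finsupp.single c (m c) then PowerSeries.coeff (m c) f else 0 := rfl

theorem map_embed {B' : Type*} [Ring B'] (φ : B →+* B') (c : Fin 2) (f : PowerSeries B) :
    MvPowerSeries.map φ (embed B c f) = embed B' c (PowerSeries.map φ f) := by
  ext m
  rw [MvPowerSeries.coeff_map, coeff_embed, coeff_embed]
  split_ifs <;> simp

theorem commute_of_coeff {σ : Type*} {f g : MvPowerSeries σ B}
    (h : ∀ m k, Commute (MvPowerSeries.coeff m f) (MvPowerSeries.coeff k g)) : Commute f g := by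
  classical
  ext m
  rw [MvPowerSeries.coeff_mul, MvPowerSeries.coeff_mul]
  exact Finset.sum_equiv (Equiv.prodComm _ _) (fun p => by simp [add_comm]) fun p _ => h _ _

theorem commute_embed {f g : PowerSeries B}
    (h : ∀ r s, Commute (PowerSeries.coeff r f) (PowerSeries.coeff s g)) (c d : Fin 2) :
    Commute (embed B c f) (embed B d g) := by
  refine commute_of_coeff fun m k => ?_
  rw [coeff_embed, coeff_embed]
  split_ifs
  · exact h _ _
  all_goals simp

end Embed

set_option linter.unusedSectionVars false

variable {ty : OSType} {n : ℕ} {B : Type*} [Ring B] [Algebra ℂ B]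

/-- `T_1(u)` for a matrix of power series. -/
noncomputable def leftMat (ty : OSType) (n : ℕ) (B : Type*) [Ring B] :
    Matrix (ty.Idx n) (ty.Idx n) (PowerSeries B) →+*
      Matrix (ty.Idx n × ty.Idx n) (ty.Idx n × ty.Idx n) (MvPowerSeries (Fin 2) B) :=
  slotOne.comp (embed B 0).mapMatrix

/-- `T_2(v)` for a matrix of power series. -/
noncomputable def rightMat (ty : OSType) (n : ℕ) (B : Type*) [Ring B] :
    Matrix (ty.Idx n) (ty.Idx n) (PowerSeries B) →+*
      Matrix (ty.Idx n × ty.Idx n) (ty.Idx n × ty.Idx n) (MvPowerSeries (Fin 2) B) :=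
  slotTwo.comp (embed B 1).mapMatrix

theorem leftMat_apply (M : Matrix (ty.Idx n) (ty.Idx n) (PowerSeries B))
    (a b : ty.Idx n × ty.Idx n) :
    leftMat ty n B M a b = if a.2 = b.2 then embed B 0 (M a.1 b.1) else 0 := rfl

theorem rightMat_apply (M : Matrix (ty.Idx n) (ty.Idx n) (PowerSeries B))
    (a b : ty.Idx n × ty.Idx n) :
    rightMat ty n B M a b = if a.1 = b.1 then embed B 1 (M a.2 b.2) else 0 := rfl

/-- `(u - v) / (u v)`. -/
noncomputable def dB (B : Type*) [Ring B] : MvPowerSeries (Fin 2) B :=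
  MvPowerSeries.X 1 - MvPowerSeries.X 0

/-- `(u - v - κ) / (u v)`. -/
noncomputable def dkB (ty : OSType) (n : ℕ) (B : Type*) [Ring B] [Algebra ℂ B] :
    MvPowerSeries (Fin 2) B :=
  MvPowerSeries.X 1 - MvPowerSeries.X 0
    - ty.kappa n • (MvPowerSeries.X 0 * MvPowerSeries.X 1)

/-- The `R`-matrix with its denominators cleared, over an arbitrary algebra. -/
noncomputable def rMat (ty : OSType) (n : ℕ) (B : Type*) [Ring B] [Algebra ℂ B] :
    Matrix (ty.Idx n × ty.Idx n) (ty.Idx n × ty.Idx n) (MvPowerSeries (Fin 2) B) :=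
  (dB B * dkB ty n B) • 1
    - (MvPowerSeries.X 0 * MvPowerSeries.X 1 * dkB ty n B) •
        (P ty n).map (algebraMap ℂ (MvPowerSeries (Fin 2) B))
    + (MvPowerSeries.X 0 * MvPowerSeries.X 1 * dB B) •
        (Q ty n).map (algebraMap ℂ (MvPowerSeries (Fin 2) B))

/-- The RTT relation for a matrix of power series. -/
def IsRTT (M : Matrix (ty.Idx n) (ty.Idx n) (PowerSeries B)) : Prop :=
  rMat ty n B * leftMat ty n B M * rightMat ty n B M =
    rightMat ty n B M * leftMat ty n B M * rMat ty n B

theorem map_algebraMap_series {B' : Type*} [Ring B'] [Algebra ℂ B'] (φ : B →ₐ[ℂ] B') (a : ℂ) :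
    MvPowerSeries.map (σ := Fin 2) φ.toRingHom (algebraMap ℂ _ a) = algebraMap ℂ _ a := by
  classical
  ext m
  simp [MvPowerSeries.algebraMap_apply, MvPowerSeries.coeff_C]

theorem map_smul_series {B' : Type*} [Ring B'] [Algebra ℂ B'] (φ : B →ₐ[ℂ] B') (a : ℂ)
    (f : MvPowerSeries (Fin 2) B) :
    MvPowerSeries.map φ.toRingHom (a • f) = a • MvPowerSeries.map φ.toRingHom f := by
  ext m
  rw [MvPowerSeries.coeff_map]
  exact map_smul φ a _

theorem map_dB {B' : Type*} [Ring B'] [Algebra ℂ B'] (φ : B →ₐ[ℂ] B') :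
    MvPowerSeries.map φ.toRingHom (dB B) = dB B' := by
  simp [dB]

theorem map_dkB {B' : Type*} [Ring B'] [Algebra ℂ B'] (φ : B →ₐ[ℂ] B') :
    MvPowerSeries.map φ.toRingHom (dkB ty n B) = dkB ty n B' := by
  rw [dkB, map_sub, map_smul_series]
  simp [dkB]

theorem rMat_map {B' : Type*} [Ring B'] [Algebra ℂ B'] (φ : B →ₐ[ℂ] B') :
    (MvPowerSeries.map φ.toRingHom).mapMatrix (rMat ty n B) = rMat ty n B' := by
  ext1 a b
  simp only [rMat, RingHom.mapMatrix_apply, Matrix.map_apply, Matrix.add_apply, Matrix.sub_apply,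
    Matrix.smul_apply, smul_eq_mul, map_add, map_sub, map_mul, map_dB, map_dkB,
    map_algebraMap_series, MvPowerSeries.map_X]
  congr 3
  rw [Matrix.one_apply, Matrix.one_apply]
  split_ifs <;> simp

theorem leftMat_map {B' : Type*} [Ring B'] (φ : B →+* B')
    (M : Matrix (ty.Idx n) (ty.Idx n) (PowerSeries B)) :
    (MvPowerSeries.map φ).mapMatrix (leftMat ty n B M) =
      leftMat ty n B' ((PowerSeries.map φ).mapMatrix M) := by
  ext1 a b
  simp only [RingHom.mapMatrix_apply, Matrix.map_apply, leftMat_apply]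
  split_ifs
  · exact map_embed φ 0 _
  · exact map_zero _

theorem rightMat_map {B' : Type*} [Ring B'] (φ : B →+* B')
    (M : Matrix (ty.Idx n) (ty.Idx n) (PowerSeries B)) :
    (MvPowerSeries.map φ).mapMatrix (rightMat ty n B M) =
      rightMat ty n B' ((PowerSeries.map φ).mapMatrix M) := by
  ext1 a b
  simp only [RingHom.mapMatrix_apply, Matrix.map_apply, rightMat_apply]
  split_ifs
  · exact map_embed φ 1 _
  · exact map_zero _

/-- The R-matrix has scalar coefficients, so it is preserved by every homomorphism of ℂ-algebras. -/
theorem IsRTT.map {B' : Type*} [Ring B'] [Algebra ℂ B'] (φ : B →ₐ[ℂ] B')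
    {M : Matrix (ty.Idx n) (ty.Idx n) (PowerSeries B)} (h : IsRTT M) :
    IsRTT ((PowerSeries.map φ.toRingHom).mapMatrix M) := by
  have := congrArg (MvPowerSeries.map φ.toRingHom).mapMatrix h
  simp only [map_mul, rMat_map, leftMat_map, rightMat_map] at this
  exact this

/-- The entries of two matrices of power series commute. -/
def EntriesCommute (M N : Matrix (ty.Idx n) (ty.Idx n) (PowerSeries B)) : Prop :=
  ∀ i j k l r s, Commute (PowerSeries.coeff r (M i j)) (PowerSeries.coeff s (N k l))

theorem EntriesCommute.symm {M N : Matrix (ty.Idx n) (ty.Idx n) (PowerSeries B)}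
    (h : EntriesCommute M N) : EntriesCommute N M :=
  fun i j k l r s => (h k l i j s r).symm

theorem EntriesCommute.series {M N : Matrix (ty.Idx n) (ty.Idx n) (PowerSeries B)}
    (h : EntriesCommute M N) (i j k l : ty.Idx n) : Commute (M i j) (N k l) := by
  ext r
  rw [PowerSeries.coeff_mul, PowerSeries.coeff_mul]
  exact Finset.sum_equiv (Equiv.prodComm _ _) (fun p => by simp [add_comm])
    fun p _ => h _ _ _ _ _ _

theorem EntriesCommute.commute {M N : Matrix (ty.Idx n) (ty.Idx n) (PowerSeries B)}
    (h : EntriesCommute M N) : leftMat ty n B M * rightMat ty n B N =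
      rightMat ty n B N * leftMat ty n B M := by
  ext1 a b
  simp only [leftMat, rightMat, RingHom.comp_apply]
  rw [slotOne_mul_slotTwo_apply, slotTwo_mul_slotOne_apply]
  exact commute_embed (h _ _ _ _) _ _

/-- This is the coproduct of the Yangian. Since entries of M and N commute, N_1 can be moved past
M_2 and M_1 past N_2, and the R-matrix is carried first through M_1 M_2 and then through N_1 N_2. -/
theorem IsRTT.mul {M N : Matrix (ty.Idx n) (ty.Idx n) (PowerSeries B)} (hM : IsRTT M)
    (hN : IsRTT N) (h : EntriesCommute M N) : IsRTT (M * N) := by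
  unfold IsRTT at *
  have h1 := h.commute
  have h2 := h.symm.commute
  simp only [map_mul]
  calc rMat ty n B * (leftMat ty n B M * leftMat ty n B N) *
        (rightMat ty n B M * rightMat ty n B N)
      = rMat ty n B * leftMat ty n B M * (leftMat ty n B N * rightMat ty n B M) *
          rightMat ty n B N := by noncomm_ring
    _ = (rMat ty n B * leftMat ty n B M * rightMat ty n B M) * leftMat ty n B N *
          rightMat ty n B N := by rw [h2]; noncomm_ring
    _ = rightMat ty n B M * leftMat ty n B M * (rMat ty n B * leftMat ty n B N *
          rightMat ty n B N) := by rw [hM]; noncomm_ring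
    _ = rightMat ty n B M * (leftMat ty n B M * rightMat ty n B N) * leftMat ty n B N *
          rMat ty n B := by rw [hN]; noncomm_ring
    _ = _ := by rw [h1]; noncomm_ring

/-- Together with `IsRTT.mul` this permits multiplying T(u) by an arbitrary central series, which is
what separates the elements z_r later. -/
theorem isRTT_diagonal {f : PowerSeries B} (hf : ∀ r b, Commute (PowerSeries.coeff r f) b) :
    IsRTT (Matrix.diagonal fun _ => f : Matrix (ty.Idx n) (ty.Idx n) (PowerSeries B)) := by
  have hc : ∀ c (g : MvPowerSeries (Fin 2) B), Commute (embed B c f) g := fun c g =>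
    commute_of_coeff fun m k => by
      rw [coeff_embed]
      split_ifs
      · exact hf _ _
      · simp
  have hl : leftMat ty n B (Matrix.diagonal fun _ => f) = Matrix.scalar _ (embed B 0 f) := by
    ext1 a b
    rw [leftMat_apply]
    by_cases h1 : a.1 = b.1 <;> by_cases h2 : a.2 = b.2 <;>
      simp [Matrix.diagonal_apply, Prod.ext_iff, h1, h2]
  have hr : rightMat ty n B (Matrix.diagonal fun _ => f) = Matrix.scalar _ (embed B 1 f) := by
    ext1 a b
    rw [rightMat_apply]
    by_cases h1 : a.1 = b.1 <;> by_cases h2 : a.2 = b.2 <;>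
      simp [Matrix.diagonal_apply, Prod.ext_iff, h1, h2]
  have h0 := Matrix.scalar_commute (n := ty.Idx n × ty.Idx n) _ (hc 0) (rMat ty n B)
  have h1 := Matrix.scalar_commute (n := ty.Idx n × ty.Idx n) _ (hc 1) (rMat ty n B)
  have h01 := Matrix.scalar_commute (n := ty.Idx n × ty.Idx n) _ (hc 0)
    (Matrix.scalar _ (embed B 1 f))
  unfold IsRTT
  rw [hl, hr, ← h0.eq, mul_assoc, ← h1.eq, ← mul_assoc, h01.eq]

/-! ### Homomorphisms out of the extended Yangian -/

section Lift

variable (M : Matrix (ty.Idx n) (ty.Idx n) (PowerSeries B))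

/-- The homomorphism from the free algebra sending `t_ij^(r)` to the coefficients of `M`. -/
noncomputable def freeHom : Free ty n →ₐ[ℂ] B :=
  FreeAlgebra.lift ℂ fun g => PowerSeries.coeff (g.2.2 + 1) (M g.1 g.2.1)

variable {M}

theorem freeHom_freeT
    (h0 : ∀ i j, PowerSeries.coeff 0 (M i j) = if i = j then 1 else 0)
    (i j : ty.Idx n) (r : ℕ) :
    freeHom M (freeT i j r) = PowerSeries.coeff r (M i j) := by
  cases r with
  | zero => rw [h0, freeT]; split_ifs <;> simp
  | succ r => rw [freeT, freeHom, FreeAlgebra.lift_ι_apply]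

theorem map_tSer
    (h0 : ∀ i j, PowerSeries.coeff 0 (M i j) = if i = j then 1 else 0)
    (c : Fin 2) (i j : ty.Idx n) :
    MvPowerSeries.map (freeHom M).toRingHom (tSer c i j) = embed B c (M i j) := by
  ext m
  rw [MvPowerSeries.coeff_map, coeff_embed, MvPowerSeries.coeff_apply, tSer]
  split_ifs with h
  · exact freeHom_freeT h0 i j _
  · exact map_zero _

theorem map_T1u
    (h0 : ∀ i j, PowerSeries.coeff 0 (M i j) = if i = j then 1 else 0) :
    (MvPowerSeries.map (freeHom M).toRingHom).mapMatrix (T1u ty n) =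
    leftMat ty n B M := by
  ext1 a b
  rw [RingHom.mapMatrix_apply, Matrix.map_apply, T1u, leftMat_apply, Matrix.kroneckerMap_apply,
    Matrix.one_apply, map_mul, Matrix.of_apply, map_tSer h0]
  split_ifs <;> simp

theorem map_T2v
    (h0 : ∀ i j, PowerSeries.coeff 0 (M i j) = if i = j then 1 else 0) :
    (MvPowerSeries.map (freeHom M).toRingHom).mapMatrix (T2v ty n) =
    rightMat ty n B M := by
  ext1 a b
  rw [RingHom.mapMatrix_apply, Matrix.map_apply, T2v, rightMat_apply, Matrix.kroneckerMap_apply,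
    Matrix.one_apply, map_mul, Matrix.of_apply, map_tSer h0]
  split_ifs <;> simp

theorem freeHom_rel
    (h0 : ∀ i j, PowerSeries.coeff 0 (M i j) = if i = j then 1 else 0)
    (hM : IsRTT M) {x y : Free ty n} (hxy : RTTRel ty n x y) :
    freeHom M x = freeHom M y := by
  obtain ⟨a, b, m⟩ := hxy
  have key := hM
  unfold IsRTT at key
  rw [← map_T1u h0, ← map_T2v h0, ← rMat_map (freeHom M), ← map_mul, ← map_mul, ← map_mul,
    ← map_mul] at key
  have := congrArg (MvPowerSeries.coeff m) (congrFun (congrFun key a) b)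
  simp only [RingHom.mapMatrix_apply, Matrix.map_apply, MvPowerSeries.coeff_map] at this
  exact this

/-- The homomorphism from the extended Yangian defined by a solution of the RTT relation. -/
noncomputable def liftRTT (M : Matrix (ty.Idx n) (ty.Idx n) (PowerSeries B))
    (h0 : ∀ i j, PowerSeries.coeff 0 (M i j) = if i = j then 1 else 0) (hM : IsRTT M) :
    XAlg ty n →ₐ[ℂ] B :=
  RingQuot.liftAlgHom ℂ ⟨freeHom M, fun _ _ h => freeHom_rel h0 hM h⟩

theorem liftRTT_t
    (h0 : ∀ i j, PowerSeries.coeff 0 (M i j) = if i = j then 1 else 0)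
    (hM : IsRTT M) (i j : ty.Idx n) (r : ℕ) :
    liftRTT M h0 hM (t i j r) = PowerSeries.coeff r (M i j) := by
  rw [t, liftRTT, RingQuot.liftAlgHom_mkAlgHom_apply, freeHom_freeT h0]

theorem liftRTT_T
    (h0 : ∀ i j, PowerSeries.coeff 0 (M i j) = if i = j then 1 else 0)
    (hM : IsRTT M) :
    (PowerSeries.map (liftRTT M h0 hM).toRingHom).mapMatrix (T ty n) = M := by
  ext i j r
  rw [RingHom.mapMatrix_apply, Matrix.map_apply, PowerSeries.coeff_map, T, Matrix.of_apply,
    PowerSeries.coeff_mk]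
  exact liftRTT_t h0 hM i j r

end Lift

theorem t_zero (i j : ty.Idx n) : t i j 0 = if i = j then 1 else 0 := by
  rw [t, freeT]
  split_ifs <;> simp

theorem coeff_T (i j : ty.Idx n) (r : ℕ) : PowerSeries.coeff r (T ty n i j) = t i j r := by
  rw [T, Matrix.of_apply, PowerSeries.coeff_mk]

/-- For M = T the homomorphism from the free algebra is the quotient map, so each coefficient of the
identity is one of the defining relations. -/
theorem isRTT_T : IsRTT (T ty n) := by
  have h0 : ∀ i j, PowerSeries.coeff 0 (T ty n i j) = if i = j then 1 else 0 := fun i j => by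
    rw [coeff_T, t_zero]
  have hfree : freeHom (T ty n) = RingQuot.mkAlgHom ℂ (RTTRel ty n) := by
    refine FreeAlgebra.hom_ext (funext fun g => ?_)
    simp only [Function.comp_apply, freeHom, FreeAlgebra.lift_ι_apply, coeff_T, t]
    rfl
  unfold IsRTT
  rw [← map_T1u h0, ← map_T2v h0, ← rMat_map (freeHom (T ty n)), ← map_mul, ← map_mul, ← map_mul,
    ← map_mul]
  ext a b m
  simp only [RingHom.mapMatrix_apply, Matrix.map_apply, MvPowerSeries.coeff_map, hfree]
  exact RingQuot.mkAlgHom_rel ℂ (RTTRel.mk a b m)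

end ExtYangian

/-! ### Filtrations indexed by the integers -/

namespace AscFiltration

variable {R A : Type*} [CommRing R] [Ring A] [Algebra R A] (F : AscFiltration R A)

/-- The filtration extended by zero to negative indices. -/
def intComp (q : ℤ) : Submodule R A := if q < 0 then ⊥ else F.comp q.toNat

theorem intComp_natCast (p : ℕ) : F.intComp p = F.comp p := by
  simp [intComp]

theorem intComp_of_neg {q : ℤ} (h : q < 0) : F.intComp q = ⊥ := if_pos h

theorem intComp_natCast_sub_one (p : ℕ) : F.intComp ((p : ℤ) - 1) = F.below p := by
  cases p with
  | zero => exact F.intComp_of_neg (by simp)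
  | succ p => rw [Nat.cast_succ, add_sub_cancel_right, intComp_natCast]; rfl

theorem intComp_mono {p q : ℤ} (h : p ≤ q) : F.intComp p ≤ F.intComp q := by
  by_cases hp : p < 0
  · rw [intComp_of_neg _ hp]; exact bot_le
  · lift p to ℕ using by omega
    lift q to ℕ using by omega
    rw [intComp_natCast, intComp_natCast]
    exact F.mono (by exact_mod_cast h)

theorem mul_mem_intComp {p q : ℤ} {a b : A} (ha : a ∈ F.intComp p) (hb : b ∈ F.intComp q) :
    a * b ∈ F.intComp (p + q) := by
  by_cases hp : p < 0
  · rw [intComp_of_neg _ hp, Submodule.mem_bot] at ha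
    rw [ha, zero_mul]; exact Submodule.zero_mem _
  by_cases hq : q < 0
  · rw [intComp_of_neg _ hq, Submodule.mem_bot] at hb
    rw [hb, mul_zero]; exact Submodule.zero_mem _
  lift p to ℕ using by omega
  lift q to ℕ using by omega
  rw [intComp_natCast] at ha hb
  rw [← Nat.cast_add, intComp_natCast]
  exact F.mul_mem ha hb

theorem one_mem_intComp {p : ℤ} (hp : 0 ≤ p) : (1 : A) ∈ F.intComp p :=
  F.intComp_mono hp (by rw [← Nat.cast_zero, intComp_natCast]; exact F.one_mem)

/-- The series in two variables whose coefficient of total degree `d` lies in the component of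
index `d - q`. -/
def lowSeries (q : ℤ) : Submodule R (MvPowerSeries (Fin 2) A) where
  carrier := {f | ∀ m, MvPowerSeries.coeff m f ∈ F.intComp ((m 0 : ℤ) + m 1 - q)}
  add_mem' hf hg m := by
    rw [map_add]
    exact Submodule.add_mem _ (hf m) (hg m)
  zero_mem' m := by
    change MvPowerSeries.coeff m (0 : MvPowerSeries (Fin 2) A) ∈ _
    rw [map_zero (MvPowerSeries.coeff m)]
    exact Submodule.zero_mem _
  smul_mem' c f hf m := Submodule.smul_mem _ c (hf m)

theorem lowSeries_anti {p q : ℤ} (h : p ≤ q) : F.lowSeries q ≤ F.lowSeries p := fun _ hf m =>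
  F.intComp_mono (by omega) (hf m)

/-- The index measures by how much the filtration degree of a coefficient falls short of the total
degree in x and y. It is additive under products; both x and t_ij(u) - δ_ij have index 1. -/
theorem mul_mem_lowSeries {p q : ℤ} {f g : MvPowerSeries (Fin 2) A} (hf : f ∈ F.lowSeries p)
    (hg : g ∈ F.lowSeries q) : f * g ∈ F.lowSeries (p + q) := fun m => by
  classical
  rw [MvPowerSeries.coeff_mul]
  refine Submodule.sum_mem _ fun a ha => ?_
  rw [Finset.HasAntidiagonal.mem_antidiagonal] at ha
  have := F.mul_mem_intComp (hf a.1) (hg a.2)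
  refine F.intComp_mono (le_of_eq ?_) this
  rw [← ha, Finsupp.add_apply, Finsupp.add_apply]
  push_cast
  ring

theorem X_mem_lowSeries (c : Fin 2) : (MvPowerSeries.X c : MvPowerSeries (Fin 2) A) ∈
    F.lowSeries 1 := fun m => by
  rw [MvPowerSeries.coeff_X]
  split_ifs with h
  · refine F.one_mem_intComp ?_
    subst h
    fin_cases c <;> simp
  · exact Submodule.zero_mem _

end AscFiltration

/-! ### Coefficients of two-variable series and the entries of the RTT relation -/

namespace ExtYangian

set_option linter.unusedSectionVars false

open OSType

section Coefficients

variable {B : Type*} [Ring B]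

/-- The coefficient of `x ^ r * y ^ s`. -/
noncomputable def coeffTwo (r s : ℕ) (f : MvPowerSeries (Fin 2) B) : B :=
  MvPowerSeries.coeff (Finsupp.single 0 r + Finsupp.single 1 s) f

theorem coeffTwo_add (r s : ℕ) (f g : MvPowerSeries (Fin 2) B) :
    coeffTwo r s (f + g) = coeffTwo r s f + coeffTwo r s g := rfl

theorem coeffTwo_sub (r s : ℕ) (f g : MvPowerSeries (Fin 2) B) :
    coeffTwo r s (f - g) = coeffTwo r s f - coeffTwo r s g := map_sub _ _ _

theorem eq_single_add_single (m : Fin 2 →₀ ℕ) :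
    m = Finsupp.single 0 (m 0) + Finsupp.single 1 (m 1) := by
  ext c
  fin_cases c <;> simp

theorem coeffTwo_apply (m : Fin 2 →₀ ℕ) (f : MvPowerSeries (Fin 2) B) :
    coeffTwo (m 0) (m 1) f = MvPowerSeries.coeff m f := by
  rw [coeffTwo, ← eq_single_add_single]

theorem coeffTwo_X_zero_mul_succ (r s : ℕ) (f : MvPowerSeries (Fin 2) B) :
    coeffTwo (r + 1) s (MvPowerSeries.X 0 * f) = coeffTwo r s f := by
  rw [coeffTwo, show (Finsupp.single 0 (r + 1) + Finsupp.single 1 s : Fin 2 →₀ ℕ) =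
    Finsupp.single 0 1 + (Finsupp.single 0 r + Finsupp.single 1 s) by
      rw [← add_assoc, ← Finsupp.single_add, add_comm 1 r], MvPowerSeries.X,
    MvPowerSeries.coeff_add_monomial_mul, one_mul]
  rfl

theorem coeffTwo_X_one_mul_succ (r s : ℕ) (f : MvPowerSeries (Fin 2) B) :
    coeffTwo r (s + 1) (MvPowerSeries.X 1 * f) = coeffTwo r s f := by
  rw [coeffTwo, show (Finsupp.single 0 r + Finsupp.single 1 (s + 1) : Fin 2 →₀ ℕ) =
    Finsupp.single 1 1 + (Finsupp.single 0 r + Finsupp.single 1 s) by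
      rw [add_left_comm, ← Finsupp.single_add, add_comm 1 s], MvPowerSeries.X,
    MvPowerSeries.coeff_add_monomial_mul, one_mul]
  rfl

theorem coeffTwo_X_zero_mul_zero (s : ℕ) (f : MvPowerSeries (Fin 2) B) :
    coeffTwo 0 s (MvPowerSeries.X 0 * f) = 0 := by
  classical
  rw [coeffTwo, MvPowerSeries.X, MvPowerSeries.coeff_monomial_mul, if_neg]
  intro h
  have := h 0
  simp at this

theorem coeffTwo_embed_zero (r s : ℕ) (f : PowerSeries B) :
    coeffTwo r s (embed B 0 f) = if s = 0 then PowerSeries.coeff r f else 0 := by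
  rw [coeffTwo, coeff_embed]
  have h0 : (Finsupp.single 0 r + Finsupp.single 1 s : Fin 2 →₀ ℕ) 0 = r := by simp
  rw [h0]
  refine if_congr ?_ rfl rfl
  simp

theorem coeffTwo_embed_one (r s : ℕ) (f : PowerSeries B) :
    coeffTwo r s (embed B 1 f) = if r = 0 then PowerSeries.coeff s f else 0 := by
  rw [coeffTwo, coeff_embed]
  have h0 : (Finsupp.single 0 r + Finsupp.single 1 s : Fin 2 →₀ ℕ) 1 = s := by simp
  rw [h0]
  refine if_congr ?_ rfl rfl
  simp

theorem coeffTwo_embed_mul_embed (r s : ℕ) (f g : PowerSeries B) :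
    coeffTwo r s (embed B 0 f * embed B 1 g) = PowerSeries.coeff r f * PowerSeries.coeff s g := by
  classical
  rw [coeffTwo, MvPowerSeries.coeff_mul,
    Finset.sum_eq_single (Finsupp.single 0 r, Finsupp.single 1 s)]
  · simp [coeff_embed]
  · rintro ⟨a, b⟩ hab hne
    rw [Finset.HasAntidiagonal.mem_antidiagonal] at hab
    simp only [coeff_embed]
    split_ifs with h1 h2
    · exfalso
      apply hne
      simp only at hab h1 h2
      have e0 := DFunLike.congr_fun hab 0
      have e1 := DFunLike.congr_fun hab 1
      rw [h1, h2] at e0 e1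
      simp at e0 e1
      rw [h1, h2, e0, e1]
    all_goals simp
  · intro h
    simp at h

theorem coeffTwo_embed_mul_embed' (r s : ℕ) (f g : PowerSeries B) :
    coeffTwo r s (embed B 1 g * embed B 0 f) = PowerSeries.coeff s g * PowerSeries.coeff r f := by
  classical
  rw [coeffTwo, MvPowerSeries.coeff_mul,
    Finset.sum_eq_single (Finsupp.single 1 s, Finsupp.single 0 r)]
  · simp [coeff_embed]
  · rintro ⟨a, b⟩ hab hne
    rw [Finset.HasAntidiagonal.mem_antidiagonal] at hab
    simp only [coeff_embed]
    split_ifs with h1 h2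
    · exfalso
      apply hne
      simp only at hab h1 h2
      have e0 := DFunLike.congr_fun hab 0
      have e1 := DFunLike.congr_fun hab 1
      rw [h1, h2] at e0 e1
      simp at e0 e1
      rw [h1, h2, e0, e1]
    all_goals simp
  · intro h
    simp [add_comm] at h

end Coefficients

/-- Series divisible by `y - x`: the coefficients of the quotient are as low as those of the
product. -/
theorem mem_lowSeries_of_dB_mul {R A : Type*} [CommRing R] [Ring A] [Algebra R A]
    (F : AscFiltration R A) {q : ℤ} {f : MvPowerSeries (Fin 2) A}
    (h : dB A * f ∈ F.lowSeries (q + 1)) : f ∈ F.lowSeries q := by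
  -- The coefficient of f at x^r y^s is that of (y - x) f at x^r y^(s+1) plus that of f at x^(r-1)
  -- y^(s+1). Induction on the exponent of x therefore recovers f, at the cost of one unit of index.
  have key : ∀ r s : ℕ, coeffTwo r s f ∈ F.intComp ((r : ℤ) + s - q) := by
    intro r
    induction r with
    | zero =>
      intro s
      have h1 := h (Finsupp.single 0 0 + Finsupp.single 1 (s + 1))
      change coeffTwo 0 (s + 1) _ ∈ _ at h1
      rw [dB, sub_mul, coeffTwo_sub, coeffTwo_X_one_mul_succ, coeffTwo_X_zero_mul_zero,
        sub_zero] at h1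
      refine F.intComp_mono (le_of_eq ?_) h1
      simp
    | succ r ih =>
      intro s
      have h1 := h (Finsupp.single 0 (r + 1) + Finsupp.single 1 (s + 1))
      change coeffTwo (r + 1) (s + 1) _ ∈ _ at h1
      rw [dB, sub_mul, coeffTwo_sub, coeffTwo_X_one_mul_succ, coeffTwo_X_zero_mul_succ] at h1
      have h2 : coeffTwo (r + 1) s f - coeffTwo r (s + 1) f ∈
          F.intComp (((r + 1 : ℕ) : ℤ) + s - q) := by
        refine F.intComp_mono (le_of_eq ?_) h1
        simp; ring
      have h3 : coeffTwo r (s + 1) f ∈ F.intComp (((r + 1 : ℕ) : ℤ) + s - q) := by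
        refine F.intComp_mono (le_of_eq ?_) (ih (s + 1))
        push_cast; ring
      simpa using Submodule.add_mem _ h2 h3
  intro m
  rw [← coeffTwo_apply]
  exact key _ _

variable {ty : OSType} {n : ℕ}

theorem P_apply (a b : ty.Idx n × ty.Idx n) :
    P ty n a b = if a.1 = b.2 ∧ a.2 = b.1 then 1 else 0 := by
  simp only [P, Matrix.sum_apply, Matrix.kroneckerMap_apply, Matrix.single_apply]
  rw [Finset.sum_eq_single a.1, Finset.sum_eq_single b.1]
  · by_cases h1 : a.1 = b.2 <;> by_cases h2 : a.2 = b.1 <;> simp [h1, h2, eq_comm (a := b.1)]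
  · intro j _ hj; simp [hj]
  · simp
  · intro i _ hi; simp [hi]
  · simp

theorem Q_apply (a b : ty.Idx n × ty.Idx n) :
    Q ty n a b = if a.2 = neg a.1 ∧ b.2 = neg b.1 then theta a.1 b.1 else 0 := by
  simp only [Q, Matrix.sum_apply, Matrix.smul_apply, Matrix.kroneckerMap_apply,
    Matrix.single_apply]
  rw [Finset.sum_eq_single a.1, Finset.sum_eq_single b.1]
  · by_cases h1 : a.2 = neg a.1 <;> by_cases h2 : b.2 = neg b.1 <;> simp [h1, h2, eq_comm]
  · intro j _ hj; simp [hj]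
  · simp
  · intro i _ hi; simp [hi]
  · simp

theorem neg_inj {i j : ty.Idx n} : neg i = neg j ↔ i = j :=
  ⟨fun h => by rw [← OSType.neg_neg i, h, OSType.neg_neg], fun h => by rw [h]⟩

section Components

variable {B : Type*} [Ring B] [Algebra ℂ B]

theorem commute_X_series (f : MvPowerSeries (Fin 2) B) (c : Fin 2) :
    Commute (MvPowerSeries.X c) f := (MvPowerSeries.commute_X f c).symm

theorem commute_dB (f : MvPowerSeries (Fin 2) B) : Commute (dB B) f :=
  (commute_X_series f 1).sub_left (commute_X_series f 0)

theorem commute_dkB (f : MvPowerSeries (Fin 2) B) : Commute (dkB ty n B) f :=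
  (commute_dB f).sub_left
    (((commute_X_series f 0).mul_left (commute_X_series f 1)).smul_left _)

theorem rMat_mul_apply (N : Matrix (ty.Idx n × ty.Idx n) (ty.Idx n × ty.Idx n)
    (MvPowerSeries (Fin 2) B)) (a b : ty.Idx n × ty.Idx n) :
    (rMat ty n B * N) a b = dB B * dkB ty n B * N a b
      - MvPowerSeries.X 0 * MvPowerSeries.X 1 * dkB ty n B * N (a.2, a.1) b
      + MvPowerSeries.X 0 * MvPowerSeries.X 1 * dB B *
        (if a.2 = neg a.1 then ∑ p, theta a.1 p • N (p, neg p) b else 0) := by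
  have hP : ((P ty n).map (algebraMap ℂ (MvPowerSeries (Fin 2) B)) * N) a b = N (a.2, a.1) b := by
    rw [Matrix.mul_apply, Finset.sum_eq_single (a.2, a.1)]
    · simp [P_apply]
    · intro c _ hc
      have : ¬ (a.1 = c.2 ∧ a.2 = c.1) := fun h => hc (Prod.ext h.2.symm h.1.symm)
      simp [P_apply, this]
    · simp
  have hQ : ((Q ty n).map (algebraMap ℂ (MvPowerSeries (Fin 2) B)) * N) a b =
      if a.2 = neg a.1 then ∑ p, theta a.1 p • N (p, neg p) b else 0 := by
    rw [Matrix.mul_apply, Fintype.sum_prod_type]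
    by_cases h : a.2 = neg a.1
    · rw [if_pos h]
      refine Finset.sum_congr rfl fun p _ => ?_
      rw [Finset.sum_eq_single (neg p)]
      · simp [Q_apply, h, Algebra.smul_def]
      · intro q _ hq; simp [Q_apply, hq]
      · simp
    · simp [Q_apply, h]
  rw [rMat, Matrix.add_mul, Matrix.sub_mul, Matrix.smul_mul, Matrix.smul_mul, Matrix.smul_mul,
    Matrix.add_apply, Matrix.sub_apply, Matrix.smul_apply, Matrix.smul_apply, Matrix.smul_apply,
    hP, hQ, Matrix.one_mul, smul_eq_mul, smul_eq_mul, smul_eq_mul]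

theorem commute_smul_matrix (c : MvPowerSeries (Fin 2) B) (hc : ∀ f, Commute c f)
    (N K : Matrix (ty.Idx n × ty.Idx n) (ty.Idx n × ty.Idx n) (MvPowerSeries (Fin 2) B)) :
    N * (c • K) = c • (N * K) := by
  ext1 a b
  simp only [Matrix.mul_apply, Matrix.smul_apply, smul_eq_mul, Finset.mul_sum]
  refine Finset.sum_congr rfl fun p _ => ?_
  rw [← mul_assoc, ← mul_assoc, (hc _).eq]

theorem mul_rMat_apply (N : Matrix (ty.Idx n × ty.Idx n) (ty.Idx n × ty.Idx n)
    (MvPowerSeries (Fin 2) B)) (a b : ty.Idx n × ty.Idx n) :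
    (N * rMat ty n B) a b = dB B * dkB ty n B * N a b
      - MvPowerSeries.X 0 * MvPowerSeries.X 1 * dkB ty n B * N a (b.2, b.1)
      + MvPowerSeries.X 0 * MvPowerSeries.X 1 * dB B *
        (if b.2 = neg b.1 then ∑ p, theta p b.1 • N a (p, neg p) else 0) := by
  have hP : (N * (P ty n).map (algebraMap ℂ (MvPowerSeries (Fin 2) B))) a b = N a (b.2, b.1) := by
    rw [Matrix.mul_apply, Finset.sum_eq_single (b.2, b.1)]
    · simp [P_apply]
    · intro c _ hc
      have : ¬ (c.1 = b.2 ∧ c.2 = b.1) := fun h => hc (Prod.ext h.1 h.2)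
      simp [P_apply, this]
    · simp
  have hQ : (N * (Q ty n).map (algebraMap ℂ (MvPowerSeries (Fin 2) B))) a b =
      if b.2 = neg b.1 then ∑ p, theta p b.1 • N a (p, neg p) else 0 := by
    rw [Matrix.mul_apply, Fintype.sum_prod_type]
    by_cases h : b.2 = neg b.1
    · rw [if_pos h]
      refine Finset.sum_congr rfl fun p _ => ?_
      rw [Finset.sum_eq_single (neg p)]
      · simp [Q_apply, h, Algebra.smul_def, Algebra.commutes]
      · intro q _ hq; simp [Q_apply, hq]
      · simp
    · simp [Q_apply, h]
  have hx : ∀ f : MvPowerSeries (Fin 2) B,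
      Commute (MvPowerSeries.X 0 * MvPowerSeries.X 1) f := fun f =>
    (commute_X_series f 0).mul_left (commute_X_series f 1)
  rw [rMat, Matrix.mul_add, Matrix.mul_sub,
    commute_smul_matrix _ fun f => (commute_dB f).mul_left (commute_dkB f),
    commute_smul_matrix _ fun f => (hx f).mul_left (commute_dkB f),
    commute_smul_matrix _ fun f => (hx f).mul_left (commute_dB f),
    Matrix.add_apply, Matrix.sub_apply, Matrix.smul_apply, Matrix.smul_apply, Matrix.smul_apply,
    hP, hQ, Matrix.mul_one, smul_eq_mul, smul_eq_mul, smul_eq_mul]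

/-- The RTT relation in terms of matrix entries. -/
theorem IsRTT.apply {M : Matrix (ty.Idx n) (ty.Idx n) (PowerSeries B)} (h : IsRTT M)
    (i j k l : ty.Idx n) :
    dB B * dkB ty n B *
        (embed B 0 (M i j) * embed B 1 (M k l) - embed B 1 (M k l) * embed B 0 (M i j)) =
      MvPowerSeries.X 0 * MvPowerSeries.X 1 * dkB ty n B *
        (embed B 0 (M k j) * embed B 1 (M i l) - embed B 1 (M k j) * embed B 0 (M i l))
      - MvPowerSeries.X 0 * MvPowerSeries.X 1 * dB B *
        ((if k = neg i then ∑ p, theta i p • (embed B 0 (M p j) * embed B 1 (M (neg p) l)) else 0)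
          - if l = neg j then
              ∑ p, theta p j • (embed B 1 (M k (neg p)) * embed B 0 (M i p)) else 0) := by
  have h1 := congrFun (congrFun h (i, k)) (j, l)
  rw [mul_assoc, rMat_mul_apply, mul_rMat_apply] at h1
  have e1 : ∀ a b : ty.Idx n × ty.Idx n, (leftMat ty n B M * rightMat ty n B M) a b =
      embed B 0 (M a.1 b.1) * embed B 1 (M a.2 b.2) := fun a b =>
    slotOne_mul_slotTwo_apply _ _ a b
  have e2 : ∀ a b : ty.Idx n × ty.Idx n, (rightMat ty n B M * leftMat ty n B M) a b =
      embed B 1 (M a.2 b.2) * embed B 0 (M a.1 b.1) := fun a b =>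
    slotTwo_mul_slotOne_apply _ _ a b
  simp only [e1, e2] at h1
  rw [mul_sub, mul_sub, mul_sub]
  refine sub_eq_zero.1 (Eq.trans ?_ (sub_eq_zero.2 h1))
  abel

end Components

end ExtYangian

/-! ### The leading terms of the defining relations -/

namespace ExtYangian

open OSType

variable {ty : OSType} {n : ℕ}

/-- The series `t_ij(u) - δ_ij`. -/
noncomputable def tauSer (i j : ty.Idx n) : PowerSeries (XAlg ty n) :=
  T ty n i j - if i = j then 1 else 0

theorem T_eq (i j : ty.Idx n) : T ty n i j = (if i = j then 1 else 0) + tauSer i j := by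
  rw [tauSer, add_sub_cancel]

theorem coeff_zero_tauSer (i j : ty.Idx n) : PowerSeries.coeff 0 (tauSer i j) = 0 := by
  rw [tauSer, map_sub, coeff_T, t_zero]
  split_ifs <;> simp

theorem coeff_succ_tauSer (i j : ty.Idx n) (r : ℕ) :
    PowerSeries.coeff (r + 1) (tauSer i j) = t i j (r + 1) := by
  rw [tauSer, map_sub, coeff_T]
  split_ifs <;> simp [PowerSeries.coeff_one]

theorem coeff_tauSer_mem (i j : ty.Idx n) (r : ℕ) :
    PowerSeries.coeff r (tauSer i j) ∈ (filtration ty n).intComp ((r : ℤ) - 1) := by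
  cases r with
  | zero => rw [coeff_zero_tauSer]; exact Submodule.zero_mem _
  | succ r =>
    rw [coeff_succ_tauSer, Nat.cast_succ, add_sub_cancel_right, AscFiltration.intComp_natCast]
    exact t_mem i j r

theorem embed_tauSer_mem (c : Fin 2) (i j : ty.Idx n) :
    embed (XAlg ty n) c (tauSer i j) ∈ (filtration ty n).lowSeries 1 := fun m => by
  rw [coeff_embed]
  split_ifs with h
  · have e : (m 0 : ℤ) + m 1 = m c := by
      rw [h]
      fin_cases c <;> simp
    rw [e]
    exact coeff_tauSer_mem i j _
  · exact Submodule.zero_mem _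

theorem embed_T (c : Fin 2) (i j : ty.Idx n) : embed (XAlg ty n) c (T ty n i j) =
    (if i = j then 1 else 0) + embed (XAlg ty n) c (tauSer i j) := by
  rw [T_eq, map_add]
  split_ifs <;> simp

/-- The leading terms of the commutator `[t_ij(u), t_kl(v)]`, as series in `u`. -/
noncomputable def leadU (i j k l : ty.Idx n) : PowerSeries (XAlg ty n) :=
  (if i = l then tauSer k j else 0) - (if k = j then tauSer i l else 0)
    - ((if k = neg i then theta i (neg l) • tauSer (neg l) j else 0)
      - if l = neg j then theta (neg k) j • tauSer i (neg k) else 0)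

/-- The leading terms of the commutator `[t_ij(u), t_kl(v)]`, as series in `v`. -/
noncomputable def leadV (i j k l : ty.Idx n) : PowerSeries (XAlg ty n) :=
  (if k = j then tauSer i l else 0) - (if i = l then tauSer k j else 0)
    - ((if k = neg i then theta i j • tauSer (neg j) l else 0)
      - if l = neg j then theta i j • tauSer k (neg i) else 0)

theorem embed_smul {B : Type*} [Ring B] [Algebra ℂ B] (c : Fin 2) (a : ℂ) (f : PowerSeries B) :
    embed B c (a • f) = a • embed B c f := by
  ext m
  change _ = a • MvPowerSeries.coeff m (embed B c f)
  rw [coeff_embed, coeff_embed]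
  split_ifs <;> simp

theorem embed_tauSer_mul_mem (c d : Fin 2) (i j k l : ty.Idx n) :
    embed (XAlg ty n) c (tauSer i j) * embed (XAlg ty n) d (tauSer k l) ∈
      (filtration ty n).lowSeries 2 :=
  (filtration ty n).lowSeries_anti (p := 2) (q := 1 + 1) (by norm_num)
    ((filtration ty n).mul_mem_lowSeries (embed_tauSer_mem _ _ _) (embed_tauSer_mem _ _ _))

/-- Write t = δ + τ. The constant terms cancel, the terms linear in τ are those subtracted, and the
products of two τ have index 2. -/
theorem permutation_part_mem (i j k l : ty.Idx n) :
    (embed (XAlg ty n) 0 (T ty n k j) * embed (XAlg ty n) 1 (T ty n i l)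
        - embed (XAlg ty n) 1 (T ty n k j) * embed (XAlg ty n) 0 (T ty n i l))
      - (embed (XAlg ty n) 0
            ((if i = l then tauSer k j else 0) - (if k = j then tauSer i l else 0))
          + embed (XAlg ty n) 1
            ((if k = j then tauSer i l else 0) - (if i = l then tauSer k j else 0)))
      ∈ (filtration ty n).lowSeries 2 := by
  have h : (embed (XAlg ty n) 0 (T ty n k j) * embed (XAlg ty n) 1 (T ty n i l)
        - embed (XAlg ty n) 1 (T ty n k j) * embed (XAlg ty n) 0 (T ty n i l))
      - (embed (XAlg ty n) 0
            ((if i = l then tauSer k j else 0) - (if k = j then tauSer i l else 0))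
          + embed (XAlg ty n) 1
            ((if k = j then tauSer i l else 0) - (if i = l then tauSer k j else 0))) =
      embed (XAlg ty n) 0 (tauSer k j) * embed (XAlg ty n) 1 (tauSer i l)
        - embed (XAlg ty n) 1 (tauSer k j) * embed (XAlg ty n) 0 (tauSer i l) := by
    simp only [embed_T]
    by_cases h1 : i = l <;> by_cases h2 : k = j <;>
      simp only [h1, h2, if_true, if_false, map_sub, map_zero] <;> noncomm_ring
  rw [h]
  exact Submodule.sub_mem _
    (embed_tauSer_mul_mem _ _ _ _ _ _)
    (embed_tauSer_mul_mem _ _ _ _ _ _)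

/-- Write t = δ + τ. The linear terms come from p = j and p = -l. A constant θ_ij survives when l =
-j; it cancels only against the one in `contraction_right_mem`. -/
theorem contraction_left_mem (i j l : ty.Idx n) :
    (∑ p, theta i p • (embed (XAlg ty n) 0 (T ty n p j) * embed (XAlg ty n) 1 (T ty n (neg p) l)))
      - (if l = neg j then theta i j • 1 else 0)
      - (embed (XAlg ty n) 0 (theta i (neg l) • tauSer (neg l) j)
          + embed (XAlg ty n) 1 (theta i j • tauSer (neg j) l))
      ∈ (filtration ty n).lowSeries 2 := by
  have h : (∑ p, theta i p •
        (embed (XAlg ty n) 0 (T ty n p j) * embed (XAlg ty n) 1 (T ty n (neg p) l)))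
      - (if l = neg j then theta i j • 1 else 0)
      - (embed (XAlg ty n) 0 (theta i (neg l) • tauSer (neg l) j)
          + embed (XAlg ty n) 1 (theta i j • tauSer (neg j) l)) =
      ∑ p, theta i p •
        (embed (XAlg ty n) 0 (tauSer p j) * embed (XAlg ty n) 1 (tauSer (neg p) l)) := by
    have e : ∀ p : ty.Idx n, theta i p •
        (embed (XAlg ty n) 0 (T ty n p j) * embed (XAlg ty n) 1 (T ty n (neg p) l)) =
        (if p = j then (if l = neg j then theta i j • 1 else 0)
          + embed (XAlg ty n) 1 (theta i j • tauSer (neg j) l) else 0)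
        + (if p = neg l then embed (XAlg ty n) 0 (theta i (neg l) • tauSer (neg l) j) else 0)
        + theta i p •
          (embed (XAlg ty n) 0 (tauSer p j) * embed (XAlg ty n) 1 (tauSer (neg p) l)) := by
      intro p
      have e1 : (neg p = l) ↔ (p = neg l) := neg_eq_iff
      have e2 : (l = neg j) ↔ (neg l = j) := neg_eq_iff.symm
      simp only [embed_T, e1, e2, embed_smul]
      by_cases h1 : p = j
      · subst h1
        by_cases h2 : p = neg l
        · subst h2
          simp only [if_true, add_mul, mul_add, one_mul, mul_one, smul_add]
          abel
        · have h3 : ¬ (neg l = p) := fun h => h2 h.symm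
          simp only [h2, h3, if_true, if_false, add_mul, one_mul, zero_add, add_zero,
            smul_add]
      · by_cases h2 : p = neg l
        · subst h2
          simp only [h1, if_true, if_false, mul_add, mul_one, zero_add, smul_add]
        · simp only [h1, h2, if_false, zero_add]
    rw [Finset.sum_congr rfl fun p _ => e p, Finset.sum_add_distrib, Finset.sum_add_distrib,
      Finset.sum_ite_eq' Finset.univ j, Finset.sum_ite_eq' Finset.univ (neg l)]
    simp only [Finset.mem_univ, if_true]
    abel
  rw [h]
  exact Submodule.sum_mem _ fun p _ => Submodule.smul_mem _ _
    (embed_tauSer_mul_mem _ _ _ _ _ _)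

theorem contraction_right_mem (i j k : ty.Idx n) :
    (∑ p, theta p j • (embed (XAlg ty n) 1 (T ty n k (neg p)) * embed (XAlg ty n) 0 (T ty n i p)))
      - (if k = neg i then theta i j • 1 else 0)
      - (embed (XAlg ty n) 0 (theta (neg k) j • tauSer i (neg k))
          + embed (XAlg ty n) 1 (theta i j • tauSer k (neg i)))
      ∈ (filtration ty n).lowSeries 2 := by
  have h : (∑ p, theta p j •
        (embed (XAlg ty n) 1 (T ty n k (neg p)) * embed (XAlg ty n) 0 (T ty n i p)))
      - (if k = neg i then theta i j • 1 else 0)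
      - (embed (XAlg ty n) 0 (theta (neg k) j • tauSer i (neg k))
          + embed (XAlg ty n) 1 (theta i j • tauSer k (neg i))) =
      ∑ p, theta p j •
        (embed (XAlg ty n) 1 (tauSer k (neg p)) * embed (XAlg ty n) 0 (tauSer i p)) := by
    have e : ∀ p : ty.Idx n, theta p j •
        (embed (XAlg ty n) 1 (T ty n k (neg p)) * embed (XAlg ty n) 0 (T ty n i p)) =
        (if p = i then (if k = neg i then theta i j • 1 else 0)
          + embed (XAlg ty n) 1 (theta i j • tauSer k (neg i)) else 0)
        + (if p = neg k then embed (XAlg ty n) 0 (theta (neg k) j • tauSer i (neg k)) else 0)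
        + theta p j •
          (embed (XAlg ty n) 1 (tauSer k (neg p)) * embed (XAlg ty n) 0 (tauSer i p)) := by
      intro p
      have e1 : (k = neg p) ↔ (p = neg k) := ⟨fun h => by rw [h, OSType.neg_neg],
        fun h => by rw [h, OSType.neg_neg]⟩
      have e2 : (k = neg i) ↔ (neg k = i) := neg_eq_iff.symm
      have e3 : i = p ↔ p = i := eq_comm
      simp only [embed_T, e1, e2, e3, embed_smul]
      by_cases h1 : p = i
      · subst h1
        by_cases h2 : p = neg k
        · subst h2
          simp only [if_true, add_mul, mul_add, one_mul, mul_one, smul_add]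
          abel
        · have h3 : ¬ (neg k = p) := fun h => h2 h.symm
          simp only [h2, h3, if_true, if_false, mul_add, mul_one, zero_add, add_zero,
            smul_add]
      · by_cases h2 : p = neg k
        · subst h2
          simp only [h1, if_true, if_false, add_mul, one_mul, zero_add, smul_add]
        · simp only [h1, h2, if_false, zero_add]
    rw [Finset.sum_congr rfl fun p _ => e p, Finset.sum_add_distrib, Finset.sum_add_distrib,
      Finset.sum_ite_eq' Finset.univ i, Finset.sum_ite_eq' Finset.univ (neg k)]
    simp only [Finset.mem_univ, if_true]
    abel
  rw [h]
  exact Submodule.sum_mem _ fun p _ => Submodule.smul_mem _ _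
    (embed_tauSer_mul_mem _ _ _ _ _ _)

/-- The constant terms are scalars and drop out of the commutator. This a priori bound is what makes
the κ-corrections negligible below. -/
theorem commutator_mem (i j k l : ty.Idx n) :
    embed (XAlg ty n) 0 (T ty n i j) * embed (XAlg ty n) 1 (T ty n k l)
      - embed (XAlg ty n) 1 (T ty n k l) * embed (XAlg ty n) 0 (T ty n i j)
      ∈ (filtration ty n).lowSeries 2 := by
  have h : embed (XAlg ty n) 0 (T ty n i j) * embed (XAlg ty n) 1 (T ty n k l)
      - embed (XAlg ty n) 1 (T ty n k l) * embed (XAlg ty n) 0 (T ty n i j) =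
      embed (XAlg ty n) 0 (tauSer i j) * embed (XAlg ty n) 1 (tauSer k l)
      - embed (XAlg ty n) 1 (tauSer k l) * embed (XAlg ty n) 0 (tauSer i j) := by
    simp only [embed_T]
    split_ifs <;> noncomm_ring
  rw [h]
  exact Submodule.sub_mem _
    (embed_tauSer_mul_mem _ _ _ _ _ _)
    (embed_tauSer_mul_mem _ _ _ _ _ _)

theorem lead_mem (i j k l : ty.Idx n) :
    embed (XAlg ty n) 0 (leadU i j k l) + embed (XAlg ty n) 1 (leadV i j k l) ∈
      (filtration ty n).lowSeries 1 := by
  have hz : ∀ (q : Prop) [Decidable q] (c : Fin 2) (a b : ty.Idx n),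
      embed (XAlg ty n) c (if q then tauSer a b else 0) ∈ (filtration ty n).lowSeries 1 := by
    intro q _ c a b
    split_ifs
    · exact embed_tauSer_mem c a b
    · rw [map_zero]; exact Submodule.zero_mem _
  have hz' : ∀ (q : Prop) [Decidable q] (c : Fin 2) (a b : ty.Idx n) (x : ℂ),
      embed (XAlg ty n) c (if q then x • tauSer a b else 0) ∈
        (filtration ty n).lowSeries 1 := by
    intro q _ c a b x
    split_ifs
    · rw [embed_smul]; exact Submodule.smul_mem _ _ (embed_tauSer_mem c a b)
    · rw [map_zero]; exact Submodule.zero_mem _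
  simp only [leadU, leadV, map_sub]
  exact Submodule.add_mem _
    (Submodule.sub_mem _ (Submodule.sub_mem _ (hz _ _ _ _) (hz _ _ _ _))
      (Submodule.sub_mem _ (hz' _ _ _ _ _) (hz' _ _ _ _ _)))
    (Submodule.sub_mem _ (Submodule.sub_mem _ (hz _ _ _ _) (hz _ _ _ _))
      (Submodule.sub_mem _ (hz' _ _ _ _ _) (hz' _ _ _ _ _)))

/-- Here d is y - x and p is xy. Collecting the κ-terms on one side leaves d as a factor of the
rest, so that d can afterwards be cancelled. -/
theorem dB_relation_rearranged {S : Type*} [Ring S] [Algebra ℂ S] {d p C G H : S} {c : ℂ}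
    (hdp : d * p = p * d)
    (h : d * (d - c • p) * C = p * (d - c • p) * G - p * d * H) :
    d * (d * C - p * (G - H)) = c • (d * p * C) - c • (p * p * G) := by
  have e : d * (d * C - p * (G - H)) = d * (d - c • p) * C - (p * (d - c • p) * G - p * d * H)
      + (c • (d * p * C) - c • (p * p * G)) := by
    simp only [mul_sub, sub_mul, mul_smul_comm, smul_mul_assoc, ← mul_assoc, hdp]
    abel
  rw [e, h, sub_self, zero_add]

/-- The commutator relation modulo lower terms. -/
theorem dB_mul_commutator_sub_mem (i j k l : ty.Idx n) :
    dB (XAlg ty n) * (embed (XAlg ty n) 0 (T ty n i j) * embed (XAlg ty n) 1 (T ty n k l)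
        - embed (XAlg ty n) 1 (T ty n k l) * embed (XAlg ty n) 0 (T ty n i j))
      - MvPowerSeries.X 0 * (MvPowerSeries.X 1 *
        (embed (XAlg ty n) 0 (leadU i j k l) + embed (XAlg ty n) 1 (leadV i j k l)))
      ∈ (filtration ty n).lowSeries 4 := by
  have hrel := (isRTT_T (ty := ty) (n := n)).apply i j k l
  have hC := commutator_mem i j k l
  have hG := permutation_part_mem i j k l
  have hL := contraction_left_mem i j l
  have hR := contraction_right_mem i j k
  have hlead := lead_mem i j k l
  set C := embed (XAlg ty n) 0 (T ty n i j) * embed (XAlg ty n) 1 (T ty n k l)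
      - embed (XAlg ty n) 1 (T ty n k l) * embed (XAlg ty n) 0 (T ty n i j) with hCdef
  set G := embed (XAlg ty n) 0 (T ty n k j) * embed (XAlg ty n) 1 (T ty n i l)
        - embed (XAlg ty n) 1 (T ty n k j) * embed (XAlg ty n) 0 (T ty n i l) with hGdef
  set HL := ∑ p, theta i p •
    (embed (XAlg ty n) 0 (T ty n p j) * embed (XAlg ty n) 1 (T ty n (neg p) l)) with hHLdef
  set HR := ∑ p, theta p j •
    (embed (XAlg ty n) 1 (T ty n k (neg p)) * embed (XAlg ty n) 0 (T ty n i p)) with hHRdef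
  set Ld := embed (XAlg ty n) 0 (leadU i j k l) + embed (XAlg ty n) 1 (leadV i j k l) with hLd
  set H := (if k = neg i then HL else 0) - (if l = neg j then HR else 0) with hHdef
  have hGH : (G - H) - Ld ∈ (filtration ty n).lowSeries 2 := by
    have hH : H - ((if k = neg i then
          embed (XAlg ty n) 0 (theta i (neg l) • tauSer (neg l) j)
          + embed (XAlg ty n) 1 (theta i j • tauSer (neg j) l) else 0)
        - (if l = neg j then embed (XAlg ty n) 0 (theta (neg k) j • tauSer i (neg k))
          + embed (XAlg ty n) 1 (theta i j • tauSer k (neg i)) else 0)) ∈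
        (filtration ty n).lowSeries 2 := by
      rw [hHdef]
      -- When both contractions are present their constants θ_ij cancel; when only one is present
      -- its constant is absent.
      by_cases h1 : k = neg i <;> by_cases h2 : l = neg j
      · rw [if_pos h1, if_pos h2, if_pos h1, if_pos h2]
        rw [if_pos h2] at hL
        rw [if_pos h1] at hR
        have := Submodule.sub_mem _ hL hR
        convert this using 1
        abel
      · rw [if_pos h1, if_neg h2, if_pos h1, if_neg h2]
        rw [if_neg h2] at hL
        simpa using hL
      · rw [if_neg h1, if_pos h2, if_neg h1, if_pos h2]
        rw [if_neg h1] at hR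
        have := Submodule.neg_mem _ hR
        convert this using 1
        abel
      · simp [h1, h2]
    have := Submodule.sub_mem _ hG hH
    convert this using 1
    rw [hLd, leadU, leadV]
    simp only [map_sub]
    by_cases h1 : k = neg i <;> by_cases h2 : l = neg j <;>
      simp only [h1, h2, if_true, if_false, map_zero] <;> abel
  have hX0 := (filtration ty n).X_mem_lowSeries 0
  have hX1 := (filtration ty n).X_mem_lowSeries 1
  have hd : dB (XAlg ty n) ∈ (filtration ty n).lowSeries 1 := Submodule.sub_mem _ hX1 hX0
  have hxy := (filtration ty n).mul_mem_lowSeries hX0 hX1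
  have hGlow : G ∈ (filtration ty n).lowSeries 1 := by
    have hp : embed (XAlg ty n) 0
            ((if i = l then tauSer k j else 0) - (if k = j then tauSer i l else 0))
          + embed (XAlg ty n) 1
            ((if k = j then tauSer i l else 0) - (if i = l then tauSer k j else 0)) ∈
        (filtration ty n).lowSeries 1 := by
      have hz : ∀ (q : Prop) [Decidable q] (c : Fin 2) (a b : ty.Idx n),
          embed (XAlg ty n) c (if q then tauSer a b else 0) ∈
            (filtration ty n).lowSeries 1 := by
        intro q _ c a b
        split_ifs
        · exact embed_tauSer_mem c a b
        · rw [map_zero]; exact Submodule.zero_mem _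
      simp only [map_sub]
      exact Submodule.add_mem _ (Submodule.sub_mem _ (hz _ _ _ _) (hz _ _ _ _))
        (Submodule.sub_mem _ (hz _ _ _ _) (hz _ _ _ _))
    have := Submodule.add_mem _ ((filtration ty n).lowSeries_anti (by norm_num) hG) hp
    simpa using this
  -- Indices add up: y - x has 1, xy has 2, the commutator C has 2 and G has 1. Both κ-terms thus
  -- have index 5, and cancelling y - x leaves 4.
  have hdiv : dB (XAlg ty n) * (dB (XAlg ty n) * C
      - MvPowerSeries.X 0 * (MvPowerSeries.X 1 * (G - H))) ∈
      (filtration ty n).lowSeries (4 + 1) := by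
    have e : dB (XAlg ty n) * (dB (XAlg ty n) * C
        - MvPowerSeries.X 0 * (MvPowerSeries.X 1 * (G - H))) =
        ty.kappa n • (dB (XAlg ty n) * (MvPowerSeries.X 0 * MvPowerSeries.X 1) * C)
          - ty.kappa n • ((MvPowerSeries.X 0 * MvPowerSeries.X 1) *
            (MvPowerSeries.X 0 * MvPowerSeries.X 1) * G) := by
      have hx0 := commute_dB (MvPowerSeries.X 0 : MvPowerSeries (Fin 2) (XAlg ty n))
      have hx1 := commute_dB (MvPowerSeries.X 1 : MvPowerSeries (Fin 2) (XAlg ty n))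
      rw [← mul_assoc (MvPowerSeries.X 0)]
      exact dB_relation_rearranged (hx0.mul_right hx1).eq hrel
    rw [e]
    refine Submodule.sub_mem _ (Submodule.smul_mem _ _ ?_) (Submodule.smul_mem _ _ ?_)
    · have := (filtration ty n).mul_mem_lowSeries
        ((filtration ty n).mul_mem_lowSeries hd hxy) hC
      exact (filtration ty n).lowSeries_anti (by norm_num) this
    · have := (filtration ty n).mul_mem_lowSeries
        ((filtration ty n).mul_mem_lowSeries hxy hxy) hGlow
      exact (filtration ty n).lowSeries_anti (by norm_num) this
  have h1 := mem_lowSeries_of_dB_mul _ hdiv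
  have h2 := (filtration ty n).mul_mem_lowSeries hxy hGH
  have h3 := Submodule.add_mem _ h1 ((filtration ty n).lowSeries_anti (by norm_num) h2)
  convert h3 using 1
  rw [← mul_assoc (MvPowerSeries.X 0), ← mul_assoc (MvPowerSeries.X 0), mul_sub _ (G - H)]
  abel

theorem coeff_lead_zero (i j k l : ty.Idx n) : PowerSeries.coeff 0 (leadU i j k l) = 0 ∧
    PowerSeries.coeff 0 (leadV i j k l) = 0 := by
  have hz : ∀ (q : Prop) [Decidable q] (a b : ty.Idx n),
      PowerSeries.coeff 0 (if q then tauSer a b else 0) = 0 := by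
    intro q _ a b
    split_ifs <;> simp [coeff_zero_tauSer, -PowerSeries.coeff_zero_eq_constantCoeff]
  have hz' : ∀ (q : Prop) [Decidable q] (a b : ty.Idx n) (x : ℂ),
      PowerSeries.coeff 0 (if q then x • tauSer a b else 0) = 0 := by
    intro q _ a b x
    split_ifs
    · change x • PowerSeries.coeff 0 (tauSer a b) = 0
      rw [coeff_zero_tauSer, smul_zero]
    · exact map_zero _
  simp only [leadU, leadV, map_sub, hz, hz', sub_zero, and_self]

/-- The relation between neighbouring commutator coefficients modulo lower terms. -/
theorem commutator_step (i j k l : ty.Idx n) (r s : ℕ) :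
    (t i j (r + 1) * t k l s - t k l s * t i j (r + 1))
      - (t i j r * t k l (s + 1) - t k l (s + 1) * t i j r)
      - ((if s = 0 then PowerSeries.coeff r (leadU i j k l) else 0)
        + if r = 0 then PowerSeries.coeff s (leadV i j k l) else 0)
      ∈ (filtration ty n).intComp ((r : ℤ) + s - 2) := by
  -- The total degree of x^(r+1) y^(s+1) is r + s + 2, so index 4 leaves filtration degree r + s -
  -- 2.
  have h := dB_mul_commutator_sub_mem i j k l
    (Finsupp.single 0 (r + 1) + Finsupp.single 1 (s + 1))
  change coeffTwo (r + 1) (s + 1) _ ∈ _ at h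
  rw [coeffTwo_sub, coeffTwo_X_zero_mul_succ, coeffTwo_X_one_mul_succ, dB, sub_mul, coeffTwo_sub,
    coeffTwo_X_one_mul_succ, coeffTwo_X_zero_mul_succ, coeffTwo_sub, coeffTwo_sub, coeffTwo_add,
    coeffTwo_embed_zero, coeffTwo_embed_one, coeffTwo_embed_mul_embed,
    coeffTwo_embed_mul_embed, coeffTwo_embed_mul_embed', coeffTwo_embed_mul_embed'] at h
  simp only [coeff_T] at h
  refine (filtration ty n).intComp_mono (le_of_eq ?_) h
  simp
  ring

theorem commutator_t_zero (i j k l : ty.Idx n) (s : ℕ) :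
    t i j 0 * t k l s - t k l s * t i j 0 = 0 := by
  rw [t_zero]
  split_ifs <;> simp

theorem commutator_one (i j k l : ty.Idx n) (s : ℕ) :
    (t i j 1 * t k l s - t k l s * t i j 1) - PowerSeries.coeff s (leadV i j k l)
      ∈ (filtration ty n).intComp ((s : ℤ) - 2) := by
  have h := commutator_step i j k l 0 s
  rw [commutator_t_zero, (coeff_lead_zero i j k l).1, ite_self, if_pos rfl, sub_zero, zero_add,
    zero_add] at h
  simpa using h

/-- The commutator of two generators modulo lower terms. -/
theorem commutator_sub_mem (i j k l : ty.Idx n) (r s : ℕ) :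
    (t i j (r + 1) * t k l (s + 1) - t k l (s + 1) * t i j (r + 1))
      - PowerSeries.coeff (r + s + 1) (leadV i j k l)
      ∈ (filtration ty n).intComp ((r : ℤ) + s - 1) := by
  induction r generalizing s with
  | zero =>
    have h := commutator_one i j k l (s + 1)
    rw [zero_add, zero_add]
    refine (filtration ty n).intComp_mono (le_of_eq ?_) h
    push_cast; ring
  | succ r ih =>
    -- Both leading terms are absent here, because neither index is 0. Up to lower terms the
    -- commutator depends only on r + s, and the induction ends at r = 0, where `leadV` enters.
    have h := commutator_step i j k l (r + 1) (s + 1)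
    rw [if_neg (Nat.succ_ne_zero _), if_neg (Nat.succ_ne_zero _), add_zero, sub_zero] at h
    have h' := ih (s + 1)
    have e : r + 1 + s + 1 = r + (s + 1) + 1 := by ring
    rw [e]
    have h1 := (filtration ty n).intComp_mono (q := ((r + 1 : ℕ) : ℤ) + s - 1)
      (by push_cast; linarith) h
    have h2 := (filtration ty n).intComp_mono (q := ((r + 1 : ℕ) : ℤ) + s - 1)
      (by push_cast; linarith) h'
    have := Submodule.add_mem _ h1 h2
    convert this using 1
    abel

/-- The two leading terms cancel each other modulo lower terms. -/
theorem lead_add_mem (i j k l : ty.Idx n) (r : ℕ) :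
    PowerSeries.coeff (r + 1) (leadU i j k l) + PowerSeries.coeff (r + 1) (leadV i j k l)
      ∈ (filtration ty n).intComp ((r : ℤ) - 1) := by
  -- With t_kl^(0) = δ_kl one commutator vanishes, and the other is known from `commutator_sub_mem`.
  -- What remains is a linear relation between the generators.
  have h := commutator_step i j k l (r + 1) 0
  have h0 : t i j (r + 1 + 1) * t k l 0 - t k l 0 * t i j (r + 1 + 1) = 0 := by
    rw [← neg_eq_zero, neg_sub]; exact commutator_t_zero _ _ _ _ _
  rw [h0, if_pos rfl, if_neg (Nat.succ_ne_zero _)] at h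
  have h' := commutator_sub_mem i j k l r 0
  have h1 := (filtration ty n).intComp_mono (q := (r : ℤ) - 1) (by push_cast; linarith) h
  have h2 := (filtration ty n).intComp_mono (q := (r : ℤ) - 1) (by push_cast; linarith) h'
  have := Submodule.neg_mem _ (Submodule.add_mem _ h1 h2)
  convert this using 1
  simp only [add_zero]
  abel

end ExtYangian

/-! ### The shift of the spectral parameter -/

namespace ExtYangian

open OSType

set_option linter.unusedSectionVars false

section Shift

/-- The expansion of `(u + c)⁻¹` in powers of `u⁻¹`. -/
noncomputable def shiftVar (c : ℂ) : PowerSeries ℂ :=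
  PowerSeries.X * (1 + PowerSeries.C c * PowerSeries.X)⁻¹

theorem shiftVar_mul (c : ℂ) :
    shiftVar c * (1 + PowerSeries.C c * PowerSeries.X) = PowerSeries.X := by
  rw [shiftVar, mul_assoc, PowerSeries.inv_mul_cancel, mul_one]
  simp

theorem coeff_shiftVar_pow_of_lt (c : ℂ) {r s : ℕ} (h : s < r) :
    PowerSeries.coeff s (shiftVar c ^ r) = 0 := by
  rw [shiftVar, mul_pow, PowerSeries.coeff_X_pow_mul', if_neg (by omega)]

/-- With w = (u + c)⁻¹ and X = u⁻¹, the identity (1 + c X) w^(r+1) = X w^r becomes Pascal's rule for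
binomial coefficients with upper entry -(r+1). -/
theorem coeff_shiftVar_pow (c : ℂ) (r k : ℕ) :
    PowerSeries.coeff (r + k) (shiftVar c ^ r) =
      ((Ring.choose (-(r : ℤ)) k : ℤ) : ℂ) * c ^ k := by
  induction r generalizing k with
  | zero =>
    cases k with
    | zero => simp
    | succ k => simp [PowerSeries.coeff_one, Ring.choose_zero_succ]
  | succ r ih =>
    have h : shiftVar c ^ (r + 1) + PowerSeries.C c * (PowerSeries.X * shiftVar c ^ (r + 1)) =
        PowerSeries.X * shiftVar c ^ r := by
      rw [pow_succ]
      linear_combination shiftVar c ^ r * shiftVar_mul c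
    induction k with
    | zero =>
      have h1 := congrArg (PowerSeries.coeff (r + 1)) h
      have h2 := ih 0
      simp only [map_add, PowerSeries.coeff_C_mul, PowerSeries.coeff_succ_X_mul,
        coeff_shiftVar_pow_of_lt c (Nat.lt_succ_self r), mul_zero, add_zero] at h1 h2
      simp only [add_zero]
      rw [h1, h2]
      simp
    | succ k ihk =>
      have h1 := congrArg (PowerSeries.coeff (r + 1 + k + 1)) h
      simp only [map_add, PowerSeries.coeff_C_mul, PowerSeries.coeff_succ_X_mul] at h1
      have h2 := ih (k + 1)
      rw [show r + (k + 1) = r + 1 + k by ring] at h2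
      rw [ihk, h2] at h1
      have h3 := Ring.choose_succ_succ (-((r + 1 : ℕ) : ℤ)) k
      rw [show -((r + 1 : ℕ) : ℤ) + 1 = -(r : ℤ) by push_cast; ring] at h3
      rw [h3] at h1
      rw [← add_assoc]
      push_cast at h1 ⊢
      linear_combination h1

variable {A : Type*} [Ring A] [Algebra ℂ A]

/-- Any bound m > s may be used because w^r starts in degree r. This gives sums for different s a
common range. -/
theorem coeff_shift (c : ℂ) (f : PowerSeries A) {s m : ℕ} (h : s < m) :
    PowerSeries.coeff s (shift c f) =
      ∑ r ∈ Finset.range m, PowerSeries.coeff s (shiftVar c ^ r) • PowerSeries.coeff r f := by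
  have h1 : Finset.range (s + 1) ⊆ Finset.range m := Finset.range_mono h
  rw [← Finset.sum_subset h1, shift, PowerSeries.coeff_mk]
  · refine Finset.sum_congr rfl fun r hr => ?_
    rw [← coeff_shiftVar_pow, Nat.add_sub_cancel' (by rw [Finset.mem_range] at hr; omega)]
  · intro r _ hr
    rw [coeff_shiftVar_pow_of_lt c (by rw [Finset.mem_range] at hr; omega), zero_smul]

theorem sum_range_antidiagonal {M : Type*} [AddCommMonoid M] (f : ℕ → ℕ → M) (s : ℕ)
    (h : ∀ p q, s < p + q → f p q = 0) :
    ∑ r ∈ Finset.range (s + 1), ∑ p ∈ Finset.HasAntidiagonal.antidiagonal r, f p.1 p.2 =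
      ∑ p ∈ Finset.range (s + 1), ∑ q ∈ Finset.range (s + 1), f p q := by
  rw [← Finset.sum_product', Finset.sum_sigma']
  refine Finset.sum_bij_ne_zero (fun x _ _ => x.2) ?_ ?_ ?_ ?_
  · rintro ⟨r, p⟩ hx _
    simp only [Finset.mem_sigma, Finset.mem_range, Finset.HasAntidiagonal.mem_antidiagonal] at hx
    simp only [Finset.mem_product, Finset.mem_range]
    omega
  · rintro ⟨r, p⟩ hx _ ⟨r', p'⟩ hx' _ hp
    simp only [Finset.mem_sigma, Finset.mem_range, Finset.HasAntidiagonal.mem_antidiagonal]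
      at hx hx' hp
    subst hp
    have : r = r' := hx.2.symm.trans hx'.2
    subst this
    rfl
  · rintro ⟨p, q⟩ _ hne
    have hle : p + q ≤ s := by
      by_contra hlt
      exact hne (h p q (by omega))
    exact ⟨⟨p + q, (p, q)⟩, by simp; omega, hne, rfl⟩
  · intros; rfl

/-- The substitution replaces u⁻¹ by a series w with scalar coefficients, which commute with A;
multiplicativity reduces to w^(p+q) = w^p w^q. -/
theorem shift_mul (c : ℂ) (f g : PowerSeries A) : shift c (f * g) = shift c f * shift c g := by
  ext s
  rw [coeff_shift c _ (Nat.lt_succ_self s), PowerSeries.coeff_mul]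
  have hR : ∀ p ∈ Finset.HasAntidiagonal.antidiagonal s,
      PowerSeries.coeff p.1 (shift c f) * PowerSeries.coeff p.2 (shift c g) =
      ∑ a ∈ Finset.range (s + 1), ∑ b ∈ Finset.range (s + 1),
        (PowerSeries.coeff p.1 (shiftVar c ^ a) * PowerSeries.coeff p.2 (shiftVar c ^ b)) •
          (PowerSeries.coeff a f * PowerSeries.coeff b g) := by
    intro p hp
    rw [Finset.HasAntidiagonal.mem_antidiagonal] at hp
    rw [coeff_shift c f (show p.1 < s + 1 by omega), coeff_shift c g (show p.2 < s + 1 by omega),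
      Finset.sum_mul_sum]
    refine Finset.sum_congr rfl fun a _ => Finset.sum_congr rfl fun b _ => ?_
    rw [smul_mul_smul_comm]
  rw [Finset.sum_congr rfl hR, Finset.sum_comm]
  have hL : ∀ r ∈ Finset.range (s + 1), PowerSeries.coeff s (shiftVar c ^ r) •
      PowerSeries.coeff r (f * g) = ∑ p ∈ Finset.HasAntidiagonal.antidiagonal r,
        PowerSeries.coeff s (shiftVar c ^ (p.1 + p.2)) •
          (PowerSeries.coeff p.1 f * PowerSeries.coeff p.2 g) := by
    intro r _
    rw [PowerSeries.coeff_mul, Finset.smul_sum]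
    refine Finset.sum_congr rfl fun p hp => ?_
    rw [Finset.HasAntidiagonal.mem_antidiagonal] at hp
    rw [hp]
  rw [Finset.sum_congr rfl hL, sum_range_antidiagonal (fun p q =>
    PowerSeries.coeff s (shiftVar c ^ (p + q)) • (PowerSeries.coeff p f * PowerSeries.coeff q g))]
  · refine Finset.sum_congr rfl fun a _ => ?_
    rw [Finset.sum_comm]
    refine Finset.sum_congr rfl fun b _ => ?_
    rw [pow_add, PowerSeries.coeff_mul, Finset.sum_smul]
  · intro p q hpq
    rw [coeff_shiftVar_pow_of_lt c hpq, zero_smul]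

/-- The substitution `f(u) ↦ f(u + c)` as a ring homomorphism. -/
noncomputable def shiftHom (A : Type*) [Ring A] [Algebra ℂ A] (c : ℂ) :
    PowerSeries A →+* PowerSeries A where
  toFun := shift c
  map_one' := by
    ext s
    rw [coeff_shift c _ (Nat.lt_succ_self s), Finset.sum_eq_single 0]
    · simp [PowerSeries.coeff_one]
    · intro r _ hr
      rw [PowerSeries.coeff_one, if_neg hr, smul_zero]
    · simp
  map_mul' := shift_mul c
  map_zero' := by
    ext s
    rw [coeff_shift c _ (Nat.lt_succ_self s)]
    simp
  map_add' f g := by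
    ext s
    simp only [map_add, coeff_shift c _ (Nat.lt_succ_self s), smul_add, Finset.sum_add_distrib]

theorem shiftHom_apply (c : ℂ) (f : PowerSeries A) : shiftHom A c f = shift c f := rfl

theorem map_shift {A' : Type*} [Ring A'] [Algebra ℂ A'] (φ : A →ₐ[ℂ] A') (c : ℂ)
    (f : PowerSeries A) :
    PowerSeries.map φ.toRingHom (shift c f) = shift c (PowerSeries.map φ.toRingHom f) := by
  ext s
  rw [PowerSeries.coeff_map, coeff_shift c _ (Nat.lt_succ_self s),
    coeff_shift c _ (Nat.lt_succ_self s), map_sum]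
  refine Finset.sum_congr rfl fun r _ => ?_
  rw [PowerSeries.coeff_map]
  exact map_smul φ _ _

theorem map_smul_powerSeries {A' : Type*} [Ring A'] [Algebra ℂ A'] (φ : A →ₐ[ℂ] A') (a : ℂ)
    (f : PowerSeries A) :
    PowerSeries.map φ.toRingHom (a • f) = a • PowerSeries.map φ.toRingHom f := by
  ext s
  rw [PowerSeries.coeff_map]
  exact map_smul φ _ _

theorem commute_coeff_shift (c : ℂ) {f : PowerSeries A} {b : A}
    (h : ∀ r, Commute (PowerSeries.coeff r f) b) (s : ℕ) :
    Commute (PowerSeries.coeff s (shift c f)) b := by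
  rw [coeff_shift c _ (Nat.lt_succ_self s)]
  exact Commute.sum_left _ _ _ fun r _ => (h r).smul_left _

theorem powerSeries_commute_of_coeff {f g : PowerSeries A}
    (h : ∀ r s, Commute (PowerSeries.coeff r f) (PowerSeries.coeff s g)) : Commute f g := by
  ext r
  rw [PowerSeries.coeff_mul, PowerSeries.coeff_mul]
  exact Finset.sum_equiv (Equiv.prodComm _ _) (fun p => by simp [add_comm]) fun p _ => h _ _

end Shift

/-! ### Crossing symmetry -/

variable {ty : OSType} {n : ℕ} {B : Type*} [Ring B] [Algebra ℂ B]

theorem theta_self (i : ty.Idx n) : theta i i = 1 := by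
  by_cases h : ty.isSymplectic = true
  · rw [theta, if_pos h, sign_mul_sign h, Int.cast_one]
  · rw [theta, if_neg h]

theorem theta_mul (i j k : ty.Idx n) : theta i j * theta j k = theta i k := by
  by_cases h : ty.isSymplectic = true
  · simp only [theta, if_pos h]
    rw [← Int.cast_mul, show i.1.sign * j.1.sign * (j.1.sign * k.1.sign) =
      i.1.sign * (j.1.sign * j.1.sign) * k.1.sign by ring, sign_mul_sign h, mul_one]
  · simp only [theta, if_neg h, mul_one]

theorem theta_comm (i j : ty.Idx n) : theta i j = theta j i := by
  simp only [theta, mul_comm]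

/-- The permutation of the indices given by `i ↦ -i`. -/
def negEquiv (ty : OSType) (n : ℕ) : ty.Idx n ≃ ty.Idx n where
  toFun := neg
  invFun := neg
  left_inv := OSType.neg_neg
  right_inv := OSType.neg_neg

theorem sum_neg {M : Type*} [AddCommMonoid M] (f : ty.Idx n → M) : ∑ p, f (neg p) = ∑ p, f p :=
  (negEquiv ty n).sum_comp f

/-- The matrix `M^t(u + κ)`. -/
noncomputable def crossTr (M : Matrix (ty.Idx n) (ty.Idx n) (PowerSeries B)) :
    Matrix (ty.Idx n) (ty.Idx n) (PowerSeries B) :=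
  Matrix.of fun k l => theta k l • shift (ty.kappa n) (M (neg l) (neg k))

theorem crossTr_apply (M : Matrix (ty.Idx n) (ty.Idx n) (PowerSeries B)) (k l : ty.Idx n) :
    crossTr M k l = theta k l • shift (ty.kappa n) (M (neg l) (neg k)) := rfl

theorem crossTr_T : crossTr (T ty n) = Tt ty n := rfl

theorem crossTr_map {B' : Type*} [Ring B'] [Algebra ℂ B'] (φ : B →ₐ[ℂ] B')
    (M : Matrix (ty.Idx n) (ty.Idx n) (PowerSeries B)) :
    crossTr ((PowerSeries.map φ.toRingHom).mapMatrix M) =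
      (PowerSeries.map φ.toRingHom).mapMatrix (crossTr M) := by
  ext1 k l
  rw [crossTr_apply, RingHom.mapMatrix_apply, RingHom.mapMatrix_apply, Matrix.map_apply,
    Matrix.map_apply, crossTr_apply, map_smul_powerSeries, map_shift]

theorem EntriesCommute.crossTr {M N : Matrix (ty.Idx n) (ty.Idx n) (PowerSeries B)}
    (h : EntriesCommute M N) : EntriesCommute (crossTr M) N := fun i j k l r s => by
  refine Commute.smul_left ?_ (theta i j)
  exact commute_coeff_shift _ (fun r => h _ _ _ _ _ _) _

/-- Transposition reverses the matrix product but not the product of entries; commuting entries,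
also after the shift, repair this. Reindexing by p ↦ -p and θ_kp θ_pl = θ_kl do the rest. -/
theorem crossTr_mul {M N : Matrix (ty.Idx n) (ty.Idx n) (PowerSeries B)}
    (h : EntriesCommute M N) : crossTr (M * N) = crossTr N * crossTr M := by
  have hcomm := h.crossTr.symm.crossTr
  ext1 k l
  rw [crossTr_apply, Matrix.mul_apply, Matrix.mul_apply, ← sum_neg, ← shiftHom_apply, map_sum,
    Finset.smul_sum]
  refine Finset.sum_congr rfl fun p _ => ?_
  rw [(hcomm.series _ _ _ _).eq, crossTr_apply, crossTr_apply, map_mul, shiftHom_apply,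
    shiftHom_apply, smul_mul_smul_comm, mul_comm (theta p l), theta_mul]

/-- The matrices `M(u)` for which `M^t(u + κ) M(u)` is a central scalar matrix. -/
def IsCross (M : Matrix (ty.Idx n) (ty.Idx n) (PowerSeries B)) : Prop :=
  ∃ ζ : PowerSeries B, (∀ r b, Commute (PowerSeries.coeff r ζ) b) ∧
    crossTr M * M = Matrix.diagonal (fun _ => ζ) ∧ M * crossTr M = Matrix.diagonal fun _ => ζ

/-- In (M N)^t M N = N^t (M^t M) N the inner factor is the central scalar ζ, which moves out,
leaving ζ ξ; similarly for the other order. -/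
theorem IsCross.mul {M N : Matrix (ty.Idx n) (ty.Idx n) (PowerSeries B)} (hM : IsCross M)
    (hN : IsCross N) (h : EntriesCommute M N) : IsCross (M * N) := by
  obtain ⟨ζ, hζ, h1, h2⟩ := hM
  obtain ⟨ξ, hξ, h3, h4⟩ := hN
  have cζ : ∀ K : Matrix (ty.Idx n) (ty.Idx n) (PowerSeries B),
      Commute (Matrix.diagonal fun _ => ζ) K := fun K =>
    Matrix.scalar_commute _ (fun f => powerSeries_commute_of_coeff fun r s => hζ _ _) K
  have cξ : ∀ K : Matrix (ty.Idx n) (ty.Idx n) (PowerSeries B),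
      Commute (Matrix.diagonal fun _ => ξ) K := fun K =>
    Matrix.scalar_commute _ (fun f => powerSeries_commute_of_coeff fun r s => hξ _ _) K
  refine ⟨ζ * ξ, fun r b => ?_, ?_, ?_⟩
  · rw [PowerSeries.coeff_mul]
    exact Commute.sum_left _ _ _ fun p _ => (hζ _ _).mul_left (hξ _ _)
  · rw [crossTr_mul h, mul_assoc, ← mul_assoc (crossTr M), h1, (cζ N).eq, ← mul_assoc, h3,
      (cξ _).eq, Matrix.diagonal_mul_diagonal]
  · rw [crossTr_mul h, mul_assoc, ← mul_assoc N, h4, (cξ (crossTr M)).eq, ← mul_assoc, h2,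
      Matrix.diagonal_mul_diagonal]

theorem isCross_diagonal {f : PowerSeries B} (hf : ∀ r b, Commute (PowerSeries.coeff r f) b) :
    IsCross (Matrix.diagonal fun _ => f : Matrix (ty.Idx n) (ty.Idx n) (PowerSeries B)) := by
  have hs : ∀ r b, Commute (PowerSeries.coeff r (shift (ty.kappa n) f)) b := fun r b =>
    commute_coeff_shift _ (fun r => hf r b) r
  have e : crossTr (Matrix.diagonal fun _ => f : Matrix (ty.Idx n) (ty.Idx n) (PowerSeries B)) =
      Matrix.diagonal fun _ => shift (ty.kappa n) f := by
    ext1 k l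
    rw [crossTr_apply]
    by_cases h : k = l
    · subst h
      rw [Matrix.diagonal_apply_eq, Matrix.diagonal_apply_eq, theta_self, one_smul]
    · rw [Matrix.diagonal_apply_ne _ h, Matrix.diagonal_apply_ne _ fun h' => h (neg_inj.1 h').symm,
        ← shiftHom_apply, map_zero, smul_zero]
  refine ⟨shift (ty.kappa n) f * f, fun r b => ?_, ?_, ?_⟩
  · rw [PowerSeries.coeff_mul]
    exact Commute.sum_left _ _ _ fun p _ => (hs _ _).mul_left (hf _ _)
  · rw [e, Matrix.diagonal_mul_diagonal]
  · rw [e, Matrix.diagonal_mul_diagonal,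
      (powerSeries_commute_of_coeff fun r s => hf r (PowerSeries.coeff s _) :
        Commute f (shift (ty.kappa n) f)).eq]

/-- The hypothesis `hφ` is needed because a homomorphism that is not surjective may send a central
element to one that is not central. -/
theorem IsCross.map {B' : Type*} [Ring B'] [Algebra ℂ B'] (φ : B →ₐ[ℂ] B')
    (hφ : ∀ a : B, (∀ b, Commute a b) → ∀ b, Commute (φ a) b)
    {M : Matrix (ty.Idx n) (ty.Idx n) (PowerSeries B)} (h : IsCross M) :
    IsCross ((PowerSeries.map φ.toRingHom).mapMatrix M) := by
  obtain ⟨ζ, hζ, h1, h2⟩ := h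
  have e : (PowerSeries.map φ.toRingHom).mapMatrix
      (Matrix.diagonal fun _ => ζ : Matrix (ty.Idx n) (ty.Idx n) (PowerSeries B)) =
      Matrix.diagonal fun _ => PowerSeries.map φ.toRingHom ζ := by
    rw [RingHom.mapMatrix_apply, Matrix.diagonal_map (map_zero _)]
  refine ⟨PowerSeries.map φ.toRingHom ζ, fun r => ?_, ?_, ?_⟩
  · rw [PowerSeries.coeff_map]
    exact hφ _ (hζ r)
  · rw [crossTr_map, ← map_mul, h1, e]
  · rw [crossTr_map, ← map_mul, h2, e]

end ExtYangian

/-! ### The vector representation -/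

namespace ExtYangian

open OSType

set_option linter.unusedSectionVars false

/-- The relations between the permutation operators `P` and the contraction operators `Q` acting
in three tensor factors. -/
structure BrauerRel {S : Type*} [Ring S] [Algebra ℂ S] (ε N : ℂ) (Pa Pb Pc Qa Qb Qc : S) :
    Prop where
  pab_pbc : Pa * Pb = Pb * Pc
  pab_pca : Pa * Pb = Pc * Pa
  pba_pcb : Pb * Pa = Pc * Pb
  pba_pac : Pb * Pa = Pa * Pc
  pbb : Pb * Pb = 1
  pcc : Pc * Pc = 1
  paa : Pa * Pa = 1
  pqa : Pa * Qa = ε • Qa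
  qpa : Qa * Pa = ε • Qa
  pqc : Pc * Qc = ε • Qc
  qpc : Qc * Pc = ε • Qc
  qqa : Qa * Qa = N • Qa
  pqb : Pb * Qb = ε • Qb
  qpb : Qb * Pb = ε • Qb
  qqb : Qb * Qb = N • Qb
  qab1 : Qa * Pc = Qa * Qb
  qab2 : Pc * Qb = Qa * Qb
  qba1 : Qb * Pc = Qb * Qa
  qba2 : Pc * Qa = Qb * Qa
  qac1 : Qa * Pb = Qa * Qc
  qac2 : Pb * Qc = Qa * Qc
  qca1 : Qc * Pb = Qc * Qa
  qca2 : Pb * Qa = Qc * Qa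
  qbc1 : Qb * Pa = Qb * Qc
  qbc2 : Pa * Qc = Qb * Qc
  qcb1 : Qc * Pa = Qc * Qb
  qcb2 : Pa * Qb = Qc * Qb

section YangBaxter

variable {K S : Type*} [CommRing K] [Algebra ℂ K] [Ring S] [Algebra ℂ S] [Algebra K S]
  [IsScalarTower ℂ K S]

/-- This is the scalar coefficient of Qa Qc - Qc Qa in the Yang-Baxter equation once N is written as
2κ + 2ε. In the application p, q are the expansions of 1/(u-a), 1/(v-a), and p', q' those of
1/(u-a-κ), 1/(v-a-κ); the hypotheses are partial fraction identities. -/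
theorem yangBaxter_coeff {d dk xy p p' q q' κ ε : K}
    (hdk : dk = d - κ * xy)
    (e1 : d * p * q = xy * (q - p))
    (e4 : (d + κ * xy) * p * q' = xy * (q' - p)) (e5 : p' - p = κ * p * p')
    (e6 : q' - q = κ * q * q') :
    -(d * dk) * p * q' - xy * d * p + xy * d * q' + ε * (xy * dk) * (p * q' - p' * q)
      + ε * (xy * d) * (p * q + p' * q') - (2 * κ + 2 * ε) * (xy * d) * (p * q') = 0 := by
  -- The part proportional to ε vanishes separately: after substituting for dk it says that d (p' -
  -- p)(q' - q) = κ xy (p q' - p' q).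
  have hY : -2 * d * (p * q') + dk * (p * q' - p' * q) + d * (p * q + p' * q') = 0 := by
    have h1 : d * (p' - p) * (q' - q) = κ * xy * (p * q' - p' * q) := by
      rw [e5, e6]
      have h2 : κ * (p' * q') * (q - p) = p * q' - p' * q := by
        linear_combination -p' * e6 + q' * e5
      linear_combination κ ^ 2 * (p' * q') * e1 + κ * xy * h2
    rw [hdk]
    linear_combination h1
  linear_combination ε * xy * hY + (-d) * p * q' * hdk - d * e4

/-- The Yang-Baxter equation with cleared denominators. -/
theorem yangBaxter {κ ε N : ℂ} {Pa Pb Pc Qa Qb Qc : S} (R : BrauerRel ε N Pa Pb Pc Qa Qb Qc)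
    (hN : N = 2 * κ + 2 * ε) {d dk xy p p' q q' : K}
    (hdk : dk = d - algebraMap ℂ K κ * xy)
    (e1 : d * p * q = xy * (q - p)) (e2 : dk * p' * q = xy * (q - p'))
    (e3 : d * p' * q' = xy * (q' - p'))
    (e4 : (d + algebraMap ℂ K κ * xy) * p * q' = xy * (q' - p))
    (e5 : p' - p = algebraMap ℂ K κ * p * p') (e6 : q' - q = algebraMap ℂ K κ * q * q') :
    ((d * dk) • (1 : S) - (xy * dk) • Pa + (xy * d) • Qa) * (1 - p • Pb + p' • Qb) *
        (1 - q • Pc + q' • Qc) =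
      (1 - q • Pc + q' • Qc) * (1 - p • Pb + p' • Qb) *
        ((d * dk) • (1 : S) - (xy * dk) • Pa + (xy * d) • Qa) := by
  have hs : ∀ (a : ℂ) (s : S), a • s = algebraMap ℂ K a • s := fun a s =>
    (algebraMap_smul K a s).symm
  -- Apart from the braid relation `c1`, every cubic product involving a Q reduces to a multiple of
  -- a quadratic product or of a single Q.
  have c1 : Pa * Pb * Pc = Pc * Pb * Pa := by
    rw [R.pab_pbc, mul_assoc, R.pcc, mul_one, mul_assoc, R.pba_pac, ← mul_assoc,
      ← R.pab_pca, R.pab_pbc, mul_assoc, R.pcc, mul_one]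
  have c2 : Pa * Pb * Qc = algebraMap ℂ K ε • (Qa * Qc) := by
    rw [mul_assoc, R.qac2, ← mul_assoc, R.pqa, smul_mul_assoc, hs]
  have c2' : Qc * Pb * Pa = algebraMap ℂ K ε • (Qc * Qa) := by
    rw [R.qca1, mul_assoc, R.qpa, mul_smul_comm, hs]
  have c3 : Pa * Qb * Pc = algebraMap ℂ K ε • (Qc * Qa) := by
    rw [mul_assoc, R.qba1, ← mul_assoc, R.qcb2, mul_assoc, ← R.qba2, ← mul_assoc, R.qpc,
      smul_mul_assoc, hs]
  have c3' : Pc * Qb * Pa = algebraMap ℂ K ε • (Qa * Qc) := by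
    rw [R.qab2, mul_assoc, R.qbc1, ← R.qbc2, ← mul_assoc, R.qpa, smul_mul_assoc, hs]
  have c4 : Qa * Pb * Pc = algebraMap ℂ K ε • (Qa * Qc) := by
    rw [mul_assoc, ← R.pab_pbc, ← mul_assoc, R.qpa, smul_mul_assoc, R.qac1, hs]
  have c4' : Pc * Pb * Qa = algebraMap ℂ K ε • (Qc * Qa) := by
    rw [mul_assoc, R.qca2, ← mul_assoc, R.pqc, smul_mul_assoc, hs]
  have c5 : Pa * Qb * Qc = Qc := by
    rw [mul_assoc, ← R.qbc2, ← mul_assoc, R.paa, one_mul]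
  have c5' : Qc * Qb * Pa = Qc := by
    rw [← R.qcb1, mul_assoc, R.paa, mul_one]
  have c6 : Qa * Qb * Pc = Qa := by
    rw [← R.qab1, mul_assoc, R.pcc, mul_one]
  have c6' : Pc * Qb * Qa = Qa := by
    rw [mul_assoc, ← R.qba2, ← mul_assoc, R.pcc, one_mul]
  have c7 : Qa * Pb * Qc = algebraMap ℂ K N • (Qa * Qc) := by
    rw [mul_assoc, R.qac2, ← mul_assoc, R.qqa, smul_mul_assoc, hs]
  have c7' : Qc * Pb * Qa = algebraMap ℂ K N • (Qc * Qa) := by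
    rw [R.qca1, mul_assoc, R.qqa, mul_smul_comm, hs]
  have c8 : Qa * Qb * Qc = algebraMap ℂ K ε • (Qa * Qc) := by
    rw [mul_assoc, ← R.qbc2, ← mul_assoc, R.qpa, smul_mul_assoc, hs]
  have c8' : Qc * Qb * Qa = algebraMap ℂ K ε • (Qc * Qa) := by
    rw [mul_assoc, ← R.qba2, ← mul_assoc, R.qpc, smul_mul_assoc, hs]
  have hNK : algebraMap ℂ K N = 2 * algebraMap ℂ K κ + 2 * algebraMap ℂ K ε := by
    rw [hN, map_add, map_mul, map_mul, map_ofNat]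
  have kac := yangBaxter_coeff (ε := algebraMap ℂ K ε) hdk e1 e4 e5 e6
  rw [← hNK] at kac
  have kp : d * dk * p * q + xy * dk * p - xy * dk * q = 0 := by
    linear_combination dk * e1
  have kab : d * dk * p' * q - xy * d * q + xy * d * p' = 0 := by
    linear_combination d * e2
  have kbc : d * dk * p' * q' + xy * dk * p' - xy * dk * q' = 0 := by
    linear_combination dk * e3
  simp only [mul_add, add_mul, mul_sub, sub_mul, mul_one, one_mul, smul_mul_assoc, mul_smul_comm,
    smul_smul, c1, c2, c2', c3, c3', c4, c4', c5, c5', c6, c6', c7, c7', c8, c8']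
  simp only [R.qab1, R.qab2, R.qba1, R.qba2, R.qac1, R.qac2, R.qca1, R.qca2, R.qbc1, R.qbc2, R.qcb1,
    R.qcb2, ← R.pab_pbc, ← R.pab_pca, ← R.pba_pcb, ← R.pba_pac]
  rw [← sub_eq_zero]
  -- After the reductions the two sides differ by a combination of the four commutators of Pa with
  -- Pb, Qa with Qb, Qb with Qc, and Qa with Qc; each scalar coefficient vanishes.
  have key : ∀ A B C D : S, (d * dk * p * q + xy * dk * p - xy * dk * q) • A
      + (d * dk * p' * q - xy * d * q + xy * d * p') • B
      + (d * dk * p' * q' + xy * dk * p' - xy * dk * q') • C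
      + (-(d * dk) * p * q' - xy * d * p + xy * d * q'
        + algebraMap ℂ K ε * (xy * dk) * (p * q' - p' * q)
        + algebraMap ℂ K ε * (xy * d) * (p * q + p' * q')
        - algebraMap ℂ K N * (xy * d) * (p * q')) • D = 0 := by
    intro A B C D
    rw [kp, kab, kbc, kac]
    simp
  rw [← key (Pa * Pb - Pb * Pa) (Qa * Qb - Qb * Qa) (Qb * Qc - Qc * Qb) (Qa * Qc - Qc * Qa)]
  module

/-- Crossing symmetry of the vector representation. -/
theorem crossing_relation {ε N κ : ℂ} {p q : S} (hpp : p * p = 1) (hpq : p * q = ε • q)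
    (hqp : q * p = ε • q) (hqq : q * q = N • q) (hN : N = 2 * κ + 2 * ε) {h0 hp hm : K}
    (e1 : hp - h0 = algebraMap ℂ K κ * h0 * hp) (e2 : h0 - hm = algebraMap ℂ K κ * hm * h0)
    (e3 : hp - hm = algebraMap ℂ K (2 * κ) * hm * hp) :
    (1 - hm • q + h0 • p) * (1 - h0 • p + hp • q) = (1 - h0 * h0) • (1 : S) ∧
      (1 - h0 • p + hp • q) * (1 - hm • q + h0 • p) = (1 - h0 * h0) • (1 : S) := by
  have hs : ∀ (a : ℂ) (s : S), a • s = algebraMap ℂ K a • s := fun a s =>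
    (algebraMap_smul K a s).symm
  have hNK : algebraMap ℂ K N = 2 * algebraMap ℂ K κ + 2 * algebraMap ℂ K ε := by
    rw [hN, map_add, map_mul, map_mul, map_ofNat]
  -- This is the total coefficient of q in either product. It vanishes because N = 2κ + 2ε.
  have key : hp - hm + algebraMap ℂ K ε * (hm * h0) - algebraMap ℂ K N * (hm * hp)
      + algebraMap ℂ K ε * (h0 * hp) = 0 := by
    rw [map_mul] at e3
    simp only [map_ofNat] at e3
    rw [hNK]
    linear_combination e3 + algebraMap ℂ K ε * (hp * e2 - hm * e1)
  have key' : ∀ s : S, (hp - hm + algebraMap ℂ K ε * (hm * h0) - algebraMap ℂ K N * (hm * hp)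
      + algebraMap ℂ K ε * (h0 * hp)) • s = 0 := fun s => by rw [key, zero_smul]
  constructor
  · simp only [mul_add, add_mul, mul_sub, sub_mul, mul_one, one_mul, smul_mul_assoc,
      mul_smul_comm, smul_smul, hpp, hpq, hqp, hqq, hs]
    rw [← sub_eq_zero, ← key' q]
    module
  · simp only [mul_add, add_mul, mul_sub, sub_mul, mul_one, one_mul, smul_mul_assoc,
      mul_smul_comm, smul_smul, hpp, hpq, hqp, hqq, hs]
    rw [← sub_eq_zero, ← key' q]
    module

end YangBaxter

end ExtYangian

/-! ### The Brauer relations on three copies of the vector space -/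

namespace ExtYangian

open OSType

set_option linter.unusedSectionVars false

variable {ty : OSType} {n : ℕ}

theorem card_idx : Fintype.card (ty.Idx n) = ty.size n := by
  have h : Fintype.card (ty.Idx n) =
      ((Finset.Icc (-(n : ℤ)) n).filter fun i => ty.isOdd = true ∨ i ≠ 0).card :=
    Fintype.card_coe _
  rw [h, size]
  by_cases ho : ty.isOdd = true
  · simp only [ho, true_or, Finset.filter_true, if_true, Int.card_Icc]
    omega
  · have e : (Finset.Icc (-(n : ℤ)) n).filter (fun i => ty.isOdd = true ∨ i ≠ 0) =
        (Finset.Icc (-(n : ℤ)) n).erase 0 := by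
      ext i
      simp [ho, and_comm]
    rw [e, Finset.card_erase_of_mem (by simp), Int.card_Icc, if_neg ho]
    omega

/-- The sign `1` in the orthogonal case and `-1` in the symplectic case. -/
noncomputable def sgn (ty : OSType) : ℂ := if ty.isSymplectic then -1 else 1

/-- This relation between κ, N and the sign ε with P Q = ε Q is exactly what the Yang-Baxter and
crossing computations require. -/
theorem size_eq : (ty.size n : ℂ) = 2 * ty.kappa n + 2 * sgn ty := by
  rw [kappa, sgn]
  split_ifs <;> ring

/-- The sign attached to an index: `sgn i` in the symplectic case and `1` otherwise. -/
noncomputable def eps (i : ty.Idx n) : ℂ := if ty.isSymplectic then ((i.1.sign : ℤ) : ℂ) else 1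

theorem theta_eq (i j : ty.Idx n) : theta i j = eps i * eps j := by
  rw [theta, eps, eps]
  split_ifs <;> simp

theorem eps_mul_eps (i : ty.Idx n) : eps i * eps i = 1 := by
  rw [← theta_eq, theta_self]

theorem eps_neg (i : ty.Idx n) : eps (neg i) = sgn ty * eps i := by
  rw [eps, eps, sgn]
  split_ifs
  · simp [neg_val]
  · simp

theorem eps_neg_mul_eps (i : ty.Idx n) : eps (neg i) * eps i = sgn ty := by
  rw [eps_neg, mul_assoc, eps_mul_eps, mul_one]

section Action

/-- The action of a matrix with matrix entries on functions of three indices. -/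
noncomputable def act (M : Matrix (ty.Idx n × ty.Idx n) (ty.Idx n × ty.Idx n)
    (Matrix (ty.Idx n) (ty.Idx n) ℂ)) (v : ty.Idx n → ty.Idx n → ty.Idx n → ℂ)
    (a b c : ty.Idx n) : ℂ :=
  ∑ i, ∑ j, ∑ k, M (a, b) (i, j) c k * v i j k

theorem act_mul (M N : Matrix (ty.Idx n × ty.Idx n) (ty.Idx n × ty.Idx n)
    (Matrix (ty.Idx n) (ty.Idx n) ℂ)) (v : ty.Idx n → ty.Idx n → ty.Idx n → ℂ) :
    act (M * N) v = act M (act N v) := by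
  have aux : ∀ (K : Matrix (ty.Idx n × ty.Idx n) (ty.Idx n × ty.Idx n)
      (Matrix (ty.Idx n) (ty.Idx n) ℂ)) (w : ty.Idx n → ty.Idx n → ty.Idx n → ℂ)
      (a b c : ty.Idx n), act K w a b c =
        ∑ p : (ty.Idx n × ty.Idx n) × ty.Idx n, K (a, b) p.1 c p.2 * w p.1.1 p.1.2 p.2 := by
    intro K w a b c
    rw [act, Fintype.sum_prod_type, Fintype.sum_prod_type]
  funext a b c
  rw [aux, aux]
  have h : ∀ p : (ty.Idx n × ty.Idx n) × ty.Idx n, (M * N) (a, b) p.1 c p.2 =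
      ∑ q : (ty.Idx n × ty.Idx n) × ty.Idx n, M (a, b) q.1 c q.2 * N q.1 p.1 q.2 p.2 := by
    intro p
    rw [Matrix.mul_apply, Matrix.sum_apply, Fintype.sum_prod_type (f := fun q :
      (ty.Idx n × ty.Idx n) × ty.Idx n => M (a, b) q.1 c q.2 * N q.1 p.1 q.2 p.2)]
    exact Finset.sum_congr rfl fun q _ => Matrix.mul_apply
  simp only [h, Finset.sum_mul]
  rw [Finset.sum_comm]
  refine Finset.sum_congr rfl fun q _ => ?_
  have h' := aux N v q.1.1 q.1.2 q.2
  rw [h', Finset.mul_sum]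
  exact Finset.sum_congr rfl fun p _ => mul_assoc _ _ _

theorem act_smul (x : ℂ) (M : Matrix (ty.Idx n × ty.Idx n) (ty.Idx n × ty.Idx n)
    (Matrix (ty.Idx n) (ty.Idx n) ℂ)) (v : ty.Idx n → ty.Idx n → ty.Idx n → ℂ)
    (a b c : ty.Idx n) : act (x • M) v a b c = x * act M v a b c := by
  simp only [act, Finset.mul_sum, Matrix.smul_apply, smul_eq_mul, mul_assoc]

theorem act_one (v : ty.Idx n → ty.Idx n → ty.Idx n → ℂ) : act 1 v = v := by
  funext a b c
  rw [act, Finset.sum_eq_single a, Finset.sum_eq_single b, Finset.sum_eq_single c]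
  · simp
  · intro k _ hk; simp [hk.symm]
  · simp
  · intro k _ hk; simp [hk.symm]
  · simp
  · intro k _ hk; simp [hk.symm]
  · simp

theorem act_injective {M N : Matrix (ty.Idx n × ty.Idx n) (ty.Idx n × ty.Idx n)
    (Matrix (ty.Idx n) (ty.Idx n) ℂ)} (h : ∀ v a b c, act M v a b c = act N v a b c) :
    M = N := by
  have key : ∀ (K : Matrix (ty.Idx n × ty.Idx n) (ty.Idx n × ty.Idx n)
      (Matrix (ty.Idx n) (ty.Idx n) ℂ)) (a b c i j k : ty.Idx n),
      act K (fun i' j' k' => if i' = i ∧ j' = j ∧ k' = k then 1 else 0) a b c =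
        K (a, b) (i, j) c k := by
    intro K a b c i j k
    rw [act, Finset.sum_eq_single i, Finset.sum_eq_single j, Finset.sum_eq_single k]
    · simp
    · intro k' _ hk; simp [hk]
    · simp
    · intro k' _ hk; simp [hk]
    · simp
    · intro k' _ hk; simp [hk]
    · simp
  ext ⟨a, b⟩ ⟨i, j⟩ c k
  rw [← key M, ← key N]
  exact h _ _ _ _

/-- The matrix with entries `e_ji`. -/
noncomputable def pMat (ty : OSType) (n : ℕ) (K : Type*) [CommRing K] :
    Matrix (ty.Idx n) (ty.Idx n) (Matrix (ty.Idx n) (ty.Idx n) K) :=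
  Matrix.of fun i j => Matrix.single j i 1

/-- The matrix with entries `θ_ij e_(-i,-j)`. -/
noncomputable def qMat (ty : OSType) (n : ℕ) (K : Type*) [CommRing K] [Algebra ℂ K] :
    Matrix (ty.Idx n) (ty.Idx n) (Matrix (ty.Idx n) (ty.Idx n) K) :=
  Matrix.of fun i j => theta i j • Matrix.single (neg i) (neg j) 1

variable (v : ty.Idx n → ty.Idx n → ty.Idx n → ℂ) (a b c : ty.Idx n)

theorem act_P : act ((P ty n).map (algebraMap ℂ _)) v a b c = v b a c := by
  rw [act, Finset.sum_eq_single b, Finset.sum_eq_single a, Finset.sum_eq_single c]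
  · simp [P_apply, Matrix.algebraMap_matrix_apply]
  · intro k _ hk; simp [Matrix.algebraMap_matrix_apply, hk.symm]
  · simp
  · intro k _ hk; simp [P_apply, hk.symm]
  · simp
  · intro k _ hk; simp [P_apply, hk.symm]
  · simp

theorem act_slotOne_p : act (slotOne (pMat ty n ℂ)) v a b c = v c b a := by
  rw [act, Finset.sum_eq_single c, Finset.sum_eq_single b, Finset.sum_eq_single a]
  · simp [slotOne_apply, pMat]
  · intro k _ hk; simp [slotOne_apply, pMat, hk.symm]
  · simp
  · intro k _ hk; simp [slotOne_apply, hk.symm]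
  · simp
  · intro k _ hk
    refine Finset.sum_eq_zero fun j _ => Finset.sum_eq_zero fun l _ => ?_
    rw [slotOne_apply]
    split_ifs <;> simp [pMat, hk]
  · simp

theorem act_slotTwo_p : act (slotTwo (pMat ty n ℂ)) v a b c = v a c b := by
  rw [act, Finset.sum_eq_single a, Finset.sum_eq_single c, Finset.sum_eq_single b]
  · simp [slotTwo_apply, pMat]
  · intro k _ hk; simp [slotTwo_apply, pMat, hk.symm]
  · simp
  · intro k _ hk; simp [slotTwo_apply, pMat, hk]
  · simp
  · intro k _ hk; simp [slotTwo_apply, hk.symm]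
  · simp

theorem act_Q : act ((Q ty n).map (algebraMap ℂ _)) v a b c =
    if b = neg a then eps a * ∑ k, eps k * v k (neg k) c else 0 := by
  by_cases h : b = neg a
  · rw [if_pos h, act, Finset.mul_sum]
    refine Finset.sum_congr rfl fun i _ => ?_
    rw [Finset.sum_eq_single (neg i), Finset.sum_eq_single c]
    · simp [Q_apply, h, Matrix.algebraMap_matrix_apply, theta_eq, mul_assoc]
    · intro k _ hk; simp [Matrix.algebraMap_matrix_apply, hk.symm]
    · simp
    · intro k _ hk; simp [Q_apply, hk]
    · simp
  · rw [if_neg h, act]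
    simp [Q_apply, h]

theorem act_slotOne_q : act (slotOne (qMat ty n ℂ)) v a b c =
    if c = neg a then eps a * ∑ k, eps k * v k b (neg k) else 0 := by
  have e : ∀ i j k, slotOne (qMat ty n ℂ) (a, b) (i, j) c k =
      if j = b ∧ k = neg i ∧ c = neg a then eps a * eps i else 0 := by
    intro i j k
    rw [slotOne_apply]
    by_cases h1 : j = b
    · subst h1
      by_cases h2 : k = neg i <;> by_cases h3 : c = neg a <;>
        simp [qMat, h2, h3, theta_eq, eq_comm (a := neg a),
          eq_comm (a := neg i)]
    · simp [h1, Ne.symm h1]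
  by_cases h : c = neg a
  · rw [if_pos h, act, Finset.mul_sum]
    refine Finset.sum_congr rfl fun i _ => ?_
    rw [Finset.sum_eq_single b, Finset.sum_eq_single (neg i)]
    · rw [e, if_pos ⟨rfl, rfl, h⟩, mul_assoc]
    · intro k _ hk; simp [e, hk]
    · simp
    · intro k _ hk; simp [e, hk]
    · simp
  · rw [if_neg h, act]
    simp [e, h]

theorem act_slotTwo_q : act (slotTwo (qMat ty n ℂ)) v a b c =
    if c = neg b then eps b * ∑ k, eps k * v a k (neg k) else 0 := by
  have e : ∀ i j k, slotTwo (qMat ty n ℂ) (a, b) (i, j) c k =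
      if i = a ∧ k = neg j ∧ c = neg b then eps b * eps j else 0 := by
    intro i j k
    rw [slotTwo_apply]
    by_cases h1 : i = a
    · subst h1
      by_cases h2 : k = neg j <;> by_cases h3 : c = neg b <;>
        simp [qMat, h2, h3, theta_eq, eq_comm (a := neg b),
          eq_comm (a := neg j)]
    · simp [h1, Ne.symm h1]
  by_cases h : c = neg b
  · rw [if_pos h, act, Finset.sum_eq_single a, Finset.mul_sum]
    · refine Finset.sum_congr rfl fun j _ => ?_
      rw [Finset.sum_eq_single (neg j)]
      · rw [e, if_pos ⟨rfl, rfl, h⟩, mul_assoc]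
      · intro k _ hk; simp [e, hk]
      · simp
    · intro k _ hk; simp [e, hk]
    · simp
  · rw [if_neg h, act]
    simp [e, h]

end Action

theorem eq_neg_comm {i j : ty.Idx n} : i = neg j ↔ j = neg i :=
  ⟨fun h => by rw [h, OSType.neg_neg], fun h => by rw [h, OSType.neg_neg]⟩

theorem sum_eps_ite (a : ty.Idx n) (f : ty.Idx n → ℂ) :
    ∑ k, eps k * (if k = neg a then f k else 0) = eps (neg a) * f (neg a) := by
  simp

theorem sum_eps_ite' (a : ty.Idx n) (f : ty.Idx n → ℂ) :
    ∑ k, eps k * (if a = neg k then f k else 0) = eps (neg a) * f (neg a) := by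
  simp [eq_neg_comm (i := a)]

theorem sum_eps_ite'' (a : ty.Idx n) (f : ty.Idx n → ℂ) :
    ∑ k, eps k * (if neg k = neg a then f k else 0) = eps a * f a := by
  simp [neg_inj]

theorem sum_eps_neg (f : ty.Idx n → ty.Idx n → ℂ) :
    ∑ k, eps k * f (neg k) k = sgn ty * ∑ k, eps k * f k (neg k) := by
  rw [← sum_neg, Finset.mul_sum]
  refine Finset.sum_congr rfl fun k _ => ?_
  rw [eps_neg, OSType.neg_neg, mul_assoc]

theorem eps_mul_eps_mul (i : ty.Idx n) (x : ℂ) : eps i * (eps i * x) = x := by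
  rw [← mul_assoc, eps_mul_eps, one_mul]

theorem eps_neg_mul_eps_mul (i : ty.Idx n) (x : ℂ) : eps (neg i) * (eps i * x) = sgn ty * x := by
  rw [← mul_assoc, eps_neg_mul_eps]

theorem sum_eps_ite_eq (a : ty.Idx n) (f : ty.Idx n → ℂ) :
    ∑ k, eps k * (if a = k then f k else 0) = eps a * f a := by
  simp

/-- The letters a, b, c stand for the pairs of tensor factors (1,2), (1,3), (2,3): P exchanges two
indices of a function of three indices, and Q contracts them against the invariant form. -/
theorem brauerRel_base : BrauerRel (sgn ty) (ty.size n)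
    ((P ty n).map (algebraMap ℂ (Matrix (ty.Idx n) (ty.Idx n) ℂ))) (slotOne (pMat ty n ℂ))
    (slotTwo (pMat ty n ℂ)) ((Q ty n).map (algebraMap ℂ (Matrix (ty.Idx n) (ty.Idx n) ℂ)))
    (slotOne (qMat ty n ℂ)) (slotTwo (qMat ty n ℂ)) := by
  -- Each relation is evaluated on an arbitrary function of three indices. The cases left over
  -- concern the sign in eps(-i) = ε eps(i) when a contracted pair is interchanged, or the sum of N
  -- ones in Q Q = N Q.
  constructor <;> refine act_injective fun v a b c => ?_ <;>
    simp only [act_mul, act_smul, act_one, act_P, act_slotOne_p, act_slotTwo_p, act_Q,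
      act_slotOne_q, act_slotTwo_q, sum_eps_ite, sum_eps_ite', sum_eps_ite'', sum_eps_ite_eq,
      OSType.neg_neg, eps_mul_eps_mul, eps_neg_mul_eps_mul, if_true]
  case pqa =>
    by_cases h : b = neg a
    · rw [if_pos h, if_pos (eq_neg_comm.1 h), h, eps_neg]; ring
    · rw [if_neg h, if_neg (fun h' => h (eq_neg_comm.1 h')), mul_zero]
  case qpa =>
    rw [sum_eps_neg fun x y => v x y c]
    split_ifs <;> ring
  case pqc =>
    by_cases h : c = neg b
    · rw [if_pos h, if_pos (eq_neg_comm.1 h), h, eps_neg]; ring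
    · rw [if_neg h, if_neg (fun h' => h (eq_neg_comm.1 h')), mul_zero]
  case qpc =>
    rw [sum_eps_neg fun x y => v a x y]
    split_ifs <;> ring
  case qqa =>
    rw [Finset.sum_const, Finset.card_univ, card_idx, nsmul_eq_mul]
    split_ifs <;> ring
  case pqb =>
    by_cases h : c = neg a
    · rw [if_pos h, if_pos (eq_neg_comm.1 h), h, eps_neg]; ring
    · rw [if_neg h, if_neg (fun h' => h (eq_neg_comm.1 h')), mul_zero]
  case qpb =>
    rw [sum_eps_neg fun x y => v x b y]
    split_ifs <;> ring
  case qqb =>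
    rw [Finset.sum_const, Finset.card_univ, card_idx, nsmul_eq_mul]
    split_ifs <;> ring
  case qac1 =>
    rw [sum_eps_neg fun x y => v c x y, ← mul_assoc (eps c), mul_comm (eps c), eps_neg_mul_eps]
  case qac2 =>
    rw [← mul_assoc (eps c), mul_comm (eps c), eps_neg_mul_eps]
    by_cases h : b = neg a
    · rw [if_pos h, if_pos (eq_neg_comm.1 h), h, eps_neg]; ring
    · rw [if_neg h, if_neg (fun h' => h (eq_neg_comm.1 h'))]
  case qca1 => rw [sum_eps_neg fun x y => v x y a]
  case qca2 =>
    by_cases h : c = neg b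
    · rw [if_pos h, if_pos (eq_neg_comm.1 h), h]
      rw [eps_neg]; ring
    · rw [if_neg h, if_neg (fun h' => h (eq_neg_comm.1 h'))]

/-! ### Geometric series -/

section Geometric

variable {K : Type*} [CommRing K] [Algebra ℂ K]

/-- The expansion of `(u - a)⁻¹` in powers of `u⁻¹`. -/
noncomputable def geo (a : K) : PowerSeries K :=
  PowerSeries.X * PowerSeries.mk fun r => a ^ r

theorem coeff_zero_geo (a : K) : PowerSeries.coeff 0 (geo a) = 0 :=
  PowerSeries.coeff_zero_X_mul _

theorem coeff_succ_geo (a : K) (r : ℕ) : PowerSeries.coeff (r + 1) (geo a) = a ^ r := by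
  rw [geo, PowerSeries.coeff_succ_X_mul, PowerSeries.coeff_mk]

theorem geo_mul (a : K) : geo a * (1 - PowerSeries.C a * PowerSeries.X) = PowerSeries.X := by
  have h : (PowerSeries.mk fun r => a ^ r) * (1 - PowerSeries.C a * PowerSeries.X) = 1 := by
    ext r
    cases r with
    | zero => simp
    | succ r =>
      rw [mul_sub, mul_one, map_sub, ← mul_assoc, PowerSeries.coeff_succ_mul_X,
        PowerSeries.coeff_mul_C, PowerSeries.coeff_mk, PowerSeries.coeff_mk,
        PowerSeries.coeff_one, if_neg (Nat.succ_ne_zero r), pow_succ, sub_self]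
  rw [geo, mul_assoc, h, mul_one]

theorem isUnit_one_sub (a : K) : IsUnit (1 - PowerSeries.C a * PowerSeries.X) := by
  rw [PowerSeries.isUnit_iff_constantCoeff]
  simp

/-- The resolvent identity for 1/(u-a) and 1/(u-b), checked after multiplication by the units 1 - a
u⁻¹ and 1 - b u⁻¹. -/
theorem geo_sub_geo (a b : K) : geo b - geo a = PowerSeries.C (b - a) * geo a * geo b := by
  refine ((isUnit_one_sub a).mul (isUnit_one_sub b)).mul_right_cancel ?_
  rw [map_sub]
  linear_combination (1 - PowerSeries.C a * PowerSeries.X) * geo_mul b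
    - (1 - PowerSeries.C b * PowerSeries.X) * geo_mul a
    - (PowerSeries.C b - PowerSeries.C a) * PowerSeries.X * geo_mul a
    - (PowerSeries.C b - PowerSeries.C a) * geo a * (1 - PowerSeries.C a * PowerSeries.X) *
      geo_mul b

theorem shift_smul_X (κ : ℂ) : shift κ (PowerSeries.X : PowerSeries K) *
    (1 + PowerSeries.C (algebraMap ℂ K κ) * PowerSeries.X) = PowerSeries.X := by
  have e : shift κ (PowerSeries.X : PowerSeries K) =
      PowerSeries.map (algebraMap ℂ K) (shiftVar κ) := by
    ext s
    rw [coeff_shift κ _ (show s < s + 2 by omega), Finset.sum_eq_single 1]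
    · rw [PowerSeries.coeff_map, pow_one, PowerSeries.coeff_one_X, Algebra.algebraMap_eq_smul_one]
    · intro r _ hr
      rw [PowerSeries.coeff_X, if_neg hr, smul_zero]
    · simp
  have h := congrArg (PowerSeries.map (algebraMap ℂ K)) (shiftVar_mul κ)
  rw [map_mul, ← e] at h
  simpa using h

theorem shift_C (κ : ℂ) (a : K) : shift κ (PowerSeries.C a) = PowerSeries.C a := by
  ext s
  rw [coeff_shift κ _ (Nat.lt_succ_self s), Finset.sum_eq_single 0]
  · rw [pow_zero]
    simp [PowerSeries.coeff_one, PowerSeries.coeff_C]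
  · intro r _ hr
    rw [PowerSeries.coeff_C, if_neg hr, smul_zero]
  · simp

/-- Substituting u + κ in 1/(u - a) moves the pole from a to a - κ. -/
theorem shift_geo (κ : ℂ) (a : K) : shift κ (geo a) = geo (a - algebraMap ℂ K κ) := by
  have h := congrArg (shiftHom K κ) (geo_mul a)
  rw [map_mul, map_sub, map_one, map_mul] at h
  simp only [shiftHom_apply, shift_C] at h
  refine (isUnit_one_sub (a - algebraMap ℂ K κ)).mul_right_cancel ?_
  rw [geo_mul, map_sub]
  have hX := shift_smul_X (K := K) κ
  linear_combination (1 + PowerSeries.C (algebraMap ℂ K κ) * PowerSeries.X) * h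
    + (1 + PowerSeries.C a * shift κ (geo a)) * hX

end Geometric

end ExtYangian

/-! ### The RTT and crossing relations for the vector representation -/

namespace ExtYangian

open OSType

set_option linter.unusedSectionVars false

variable {ty : OSType} {n : ℕ}

theorem BrauerRel.map {S S' : Type*} [Ring S] [Algebra ℂ S] [Ring S'] [Algebra ℂ S'] {ε N : ℂ}
    {Pa Pb Pc Qa Qb Qc : S} (R : BrauerRel ε N Pa Pb Pc Qa Qb Qc) (Φ : S →+* S')
    (hΦ : ∀ (a : ℂ) (s : S), Φ (a • s) = a • Φ s) :
    BrauerRel ε N (Φ Pa) (Φ Pb) (Φ Pc) (Φ Qa) (Φ Qb) (Φ Qc) := by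
  constructor <;> simp only [← map_mul, ← hΦ, ← map_one Φ]
  exacts [congrArg Φ R.pab_pbc, congrArg Φ R.pab_pca, congrArg Φ R.pba_pcb, congrArg Φ R.pba_pac,
    congrArg Φ R.pbb, congrArg Φ R.pcc, congrArg Φ R.paa, congrArg Φ R.pqa, congrArg Φ R.qpa,
    congrArg Φ R.pqc, congrArg Φ R.qpc, congrArg Φ R.qqa, congrArg Φ R.pqb, congrArg Φ R.qpb, congrArg Φ R.qqb, congrArg Φ R.qab1, congrArg Φ R.qab2,
    congrArg Φ R.qba1, congrArg Φ R.qba2, congrArg Φ R.qac1, congrArg Φ R.qac2,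
    congrArg Φ R.qca1, congrArg Φ R.qca2, congrArg Φ R.qbc1, congrArg Φ R.qbc2,
    congrArg Φ R.qcb1, congrArg Φ R.qcb2]

section Vector

variable {K : Type*} [CommRing K] [Algebra ℂ K]

/-- Power series with scalar coefficients as central matrices. -/
noncomputable def scalarOne (ty : OSType) (n : ℕ) (K : Type*) [CommRing K] :
    PowerSeries K →+*
      Matrix (ty.Idx n) (ty.Idx n) (PowerSeries (Matrix (ty.Idx n) (ty.Idx n) K)) :=
  (Matrix.scalar _).comp (PowerSeries.map (algebraMap K (Matrix (ty.Idx n) (ty.Idx n) K)))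

/-- Series in two variables with scalar coefficients as central matrices. -/
noncomputable def scalarTwo (ty : OSType) (n : ℕ) (K : Type*) [CommRing K] :
    MvPowerSeries (Fin 2) K →+* Matrix (ty.Idx n × ty.Idx n) (ty.Idx n × ty.Idx n)
      (MvPowerSeries (Fin 2) (Matrix (ty.Idx n) (ty.Idx n) K)) :=
  (Matrix.scalar _).comp (MvPowerSeries.map (algebraMap K (Matrix (ty.Idx n) (ty.Idx n) K)))

/-- Constant matrices as matrices of power series. -/
noncomputable def constOne (ty : OSType) (n : ℕ) (K : Type*) [CommRing K] [Algebra ℂ K] :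
    Matrix (ty.Idx n) (ty.Idx n) (Matrix (ty.Idx n) (ty.Idx n) ℂ) →+*
      Matrix (ty.Idx n) (ty.Idx n) (PowerSeries (Matrix (ty.Idx n) (ty.Idx n) K)) :=
  ((PowerSeries.C).comp (algebraMap ℂ K).mapMatrix).mapMatrix

/-- Constant matrices as matrices of power series in two variables. -/
noncomputable def constTwo (ty : OSType) (n : ℕ) (K : Type*) [CommRing K] [Algebra ℂ K] :
    Matrix (ty.Idx n × ty.Idx n) (ty.Idx n × ty.Idx n) (Matrix (ty.Idx n) (ty.Idx n) ℂ) →+*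
      Matrix (ty.Idx n × ty.Idx n) (ty.Idx n × ty.Idx n)
        (MvPowerSeries (Fin 2) (Matrix (ty.Idx n) (ty.Idx n) K)) :=
  ((MvPowerSeries.C).comp (algebraMap ℂ K).mapMatrix).mapMatrix

/-- The matrix `1 - P / (u - a) + Q / (u - a - κ)` of the vector representation. -/
noncomputable def vecL (ty : OSType) (n : ℕ) (a : K) :
    Matrix (ty.Idx n) (ty.Idx n) (PowerSeries (Matrix (ty.Idx n) (ty.Idx n) K)) :=
  1 - scalarOne ty n K (geo a) * constOne ty n K (pMat ty n ℂ)
    + scalarOne ty n K (geo (a + algebraMap ℂ K (ty.kappa n))) * constOne ty n K (qMat ty n ℂ)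

theorem scalarOne_commute (f : PowerSeries K) (M : Matrix (ty.Idx n) (ty.Idx n)
    (PowerSeries (Matrix (ty.Idx n) (ty.Idx n) K))) :
    scalarOne ty n K f * M = M * scalarOne ty n K f :=
  Matrix.scalar_commute _ (fun g => powerSeries_commute_of_coeff (A := Matrix (ty.Idx n) (ty.Idx n) K)
    fun r s => by
      rw [PowerSeries.coeff_map]
      exact Algebra.commutes _ _) M

theorem scalarTwo_commute (f : MvPowerSeries (Fin 2) K)
    (M : Matrix (ty.Idx n × ty.Idx n) (ty.Idx n × ty.Idx n)
      (MvPowerSeries (Fin 2) (Matrix (ty.Idx n) (ty.Idx n) K))) :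
    scalarTwo ty n K f * M = M * scalarTwo ty n K f :=
  Matrix.scalar_commute _ (fun g => commute_of_coeff fun r s => by
      rw [MvPowerSeries.coeff_map]
      exact Algebra.commutes _ _) M

theorem leftMat_scalarOne (f : PowerSeries K) :
    leftMat ty n _ (scalarOne ty n K f) = scalarTwo ty n K (embed K 0 f) := by
  ext1 a b
  rw [leftMat_apply]
  simp only [scalarOne, scalarTwo, RingHom.comp_apply, Matrix.scalar_apply, map_embed]
  by_cases h1 : a.1 = b.1 <;> by_cases h2 : a.2 = b.2 <;>
    simp [Matrix.diagonal_apply, Prod.ext_iff, h1, h2]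

theorem rightMat_scalarOne (f : PowerSeries K) :
    rightMat ty n _ (scalarOne ty n K f) = scalarTwo ty n K (embed K 1 f) := by
  ext1 a b
  rw [rightMat_apply]
  simp only [scalarOne, scalarTwo, RingHom.comp_apply, Matrix.scalar_apply, map_embed]
  by_cases h1 : a.1 = b.1 <;> by_cases h2 : a.2 = b.2 <;>
    simp [Matrix.diagonal_apply, Prod.ext_iff, h1, h2]

theorem embed_C {B : Type*} [Ring B] (c : Fin 2) (b : B) :
    embed B c (PowerSeries.C b) = MvPowerSeries.C b := by
  classical
  ext m
  rw [coeff_embed, MvPowerSeries.coeff_C, PowerSeries.coeff_C]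
  by_cases h : m = 0
  · subst h; simp
  · rw [if_neg h]
    split_ifs with h1 h2
    · rw [h2, Finsupp.single_zero] at h1; exact absurd h1 h
    · rfl
    · rfl

theorem embed_X {B : Type*} [Ring B] (c : Fin 2) :
    embed B c PowerSeries.X = MvPowerSeries.X c := by
  classical
  ext m
  rw [coeff_embed, MvPowerSeries.coeff_X, PowerSeries.coeff_X]
  by_cases h : m = Finsupp.single c 1
  · subst h; simp
  · rw [if_neg h]
    split_ifs with h1 h2
    · rw [h2] at h1; exact absurd h1 h
    · rfl
    · rfl

theorem leftMat_constOne (M : Matrix (ty.Idx n) (ty.Idx n) (Matrix (ty.Idx n) (ty.Idx n) ℂ)) :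
    leftMat ty n _ (constOne ty n K M) = constTwo ty n K (slotOne M) := by
  ext1 a b
  rw [leftMat_apply, constTwo, RingHom.mapMatrix_apply, Matrix.map_apply, slotOne_apply]
  split_ifs
  · exact embed_C _ _
  · exact (map_zero _).symm

theorem rightMat_constOne (M : Matrix (ty.Idx n) (ty.Idx n) (Matrix (ty.Idx n) (ty.Idx n) ℂ)) :
    rightMat ty n _ (constOne ty n K M) = constTwo ty n K (slotTwo M) := by
  ext1 a b
  rw [rightMat_apply, constTwo, RingHom.mapMatrix_apply, Matrix.map_apply, slotTwo_apply]
  split_ifs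
  · exact embed_C _ _
  · exact (map_zero _).symm

theorem C_mapMatrix_algebraMap (x : ℂ) :
    (MvPowerSeries.C (σ := Fin 2)) ((algebraMap ℂ K).mapMatrix
      (algebraMap ℂ (Matrix (ty.Idx n) (ty.Idx n) ℂ) x)) = algebraMap ℂ _ x := by
  rw [MvPowerSeries.algebraMap_apply]
  congr 1
  ext i j
  rw [RingHom.mapMatrix_apply, Matrix.map_apply, Matrix.algebraMap_matrix_apply,
    Matrix.algebraMap_matrix_apply]
  split_ifs <;> simp

theorem constTwo_map (M : Matrix (ty.Idx n × ty.Idx n) (ty.Idx n × ty.Idx n) ℂ) :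
    constTwo ty n K (M.map (algebraMap ℂ _)) = M.map (algebraMap ℂ _) := by
  ext1 a b
  exact C_mapMatrix_algebraMap _

theorem constTwo_smul (x : ℂ) (M : Matrix (ty.Idx n × ty.Idx n) (ty.Idx n × ty.Idx n)
    (Matrix (ty.Idx n) (ty.Idx n) ℂ)) : constTwo ty n K (x • M) = x • constTwo ty n K M := by
  ext1 a b
  rw [constTwo, RingHom.mapMatrix_apply, Matrix.map_apply, Matrix.smul_apply, Matrix.smul_apply,
    RingHom.mapMatrix_apply, Matrix.map_apply, Algebra.smul_def, map_mul, RingHom.comp_apply,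
    C_mapMatrix_algebraMap, ← Algebra.smul_def]

theorem constOne_smul (x : ℂ) (M : Matrix (ty.Idx n) (ty.Idx n)
    (Matrix (ty.Idx n) (ty.Idx n) ℂ)) : constOne ty n K (x • M) = x • constOne ty n K M := by
  ext1 a b
  rw [constOne, RingHom.mapMatrix_apply, Matrix.map_apply, Matrix.smul_apply, Matrix.smul_apply,
    RingHom.mapMatrix_apply, Matrix.map_apply, Algebra.smul_def, map_mul, Algebra.smul_def]
  congr 1
  rw [PowerSeries.algebraMap_apply, RingHom.comp_apply]
  congr 1
  ext i j
  rw [RingHom.mapMatrix_apply, Matrix.map_apply, Matrix.algebraMap_matrix_apply,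
    Matrix.algebraMap_matrix_apply]
  split_ifs <;> simp

theorem scalarTwo_algebraMap (x : ℂ) :
    scalarTwo ty n K (algebraMap ℂ _ x) = algebraMap ℂ _ x := by
  ext1 a b
  rw [Matrix.algebraMap_matrix_apply, scalarTwo, RingHom.comp_apply, Matrix.scalar_apply,
    Matrix.diagonal_apply]
  congr 1

theorem scalarOne_algebraMap (x : ℂ) :
    scalarOne ty n K (algebraMap ℂ _ x) = algebraMap ℂ _ x := by
  ext1 a b
  rw [Matrix.algebraMap_matrix_apply, scalarOne, RingHom.comp_apply, Matrix.scalar_apply,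
    Matrix.diagonal_apply]
  congr 1

/-- Partial fractions: u - v - (a - b) is the difference of u - a and v - b. Both sides carry the
factor 1/(uv). -/
theorem embed_geo_mul (a b : K) :
    (MvPowerSeries.X 1 - MvPowerSeries.X 0
      - MvPowerSeries.C (a - b) * (MvPowerSeries.X 0 * MvPowerSeries.X 1)) *
        embed K 0 (geo a) * embed K 1 (geo b) =
      MvPowerSeries.X 0 * MvPowerSeries.X 1 * (embed K 1 (geo b) - embed K 0 (geo a)) := by
  have h0 := congrArg (embed K 0) (geo_mul a)
  have h1 := congrArg (embed K 1) (geo_mul b)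
  rw [map_mul, map_sub, map_one, map_mul, embed_C, embed_X] at h0 h1
  rw [map_sub]
  linear_combination MvPowerSeries.X 1 * embed K 1 (geo b) * h0
    - MvPowerSeries.X 0 * embed K 0 (geo a) * h1

theorem rMat_eq_scalarTwo : rMat ty n (Matrix (ty.Idx n) (ty.Idx n) K) =
    scalarTwo ty n K (dB K * dkB ty n K)
      - scalarTwo ty n K (MvPowerSeries.X 0 * MvPowerSeries.X 1 * dkB ty n K) *
        (P ty n).map (algebraMap ℂ _)
      + scalarTwo ty n K (MvPowerSeries.X 0 * MvPowerSeries.X 1 * dB K) *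
        (Q ty n).map (algebraMap ℂ _) := by
  have hd : MvPowerSeries.map (algebraMap K (Matrix (ty.Idx n) (ty.Idx n) K)) (dB K) = dB _ := by
    simp [dB]
  have hdk : MvPowerSeries.map (algebraMap K (Matrix (ty.Idx n) (ty.Idx n) K)) (dkB ty n K) =
      dkB ty n _ :=
    map_dkB (IsScalarTower.toAlgHom ℂ K (Matrix (ty.Idx n) (ty.Idx n) K))
  have hs : ∀ (f : MvPowerSeries (Fin 2) K) (M : Matrix (ty.Idx n × ty.Idx n)
      (ty.Idx n × ty.Idx n) (MvPowerSeries (Fin 2) (Matrix (ty.Idx n) (ty.Idx n) K))),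
      scalarTwo ty n K f * M = MvPowerSeries.map (algebraMap K (Matrix (ty.Idx n) (ty.Idx n) K)) f • M := by
    intro f M
    rw [scalarTwo, RingHom.comp_apply, Matrix.scalar_apply, ← Matrix.smul_eq_diagonal_mul]
  rw [rMat, hs, hs, ← mul_one (scalarTwo ty n K (dB K * dkB ty n K)), hs]
  simp only [map_mul, hd, hdk, MvPowerSeries.map_X]

theorem isRTT_vecL (a : K) : IsRTT (vecL ty n a) := by
  -- Scalar series act through central matrices, so that `yangBaxter` applies with K the ring of
  -- scalar series in two variables.
  let : Algebra (MvPowerSeries (Fin 2) K) (Matrix (ty.Idx n × ty.Idx n) (ty.Idx n × ty.Idx n)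
      (MvPowerSeries (Fin 2) (Matrix (ty.Idx n) (ty.Idx n) K))) :=
    (scalarTwo ty n K).toAlgebra' scalarTwo_commute
  have : IsScalarTower ℂ (MvPowerSeries (Fin 2) K) (Matrix (ty.Idx n × ty.Idx n)
      (ty.Idx n × ty.Idx n) (MvPowerSeries (Fin 2) (Matrix (ty.Idx n) (ty.Idx n) K))) :=
    IsScalarTower.of_algebraMap_eq fun x => (scalarTwo_algebraMap x).symm
  have hsm : ∀ (f : MvPowerSeries (Fin 2) K) (M : Matrix (ty.Idx n × ty.Idx n)
      (ty.Idx n × ty.Idx n) (MvPowerSeries (Fin 2) (Matrix (ty.Idx n) (ty.Idx n) K))),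
      f • M = scalarTwo ty n K f * M := fun f M => Algebra.smul_def f M
  have R := (brauerRel_base (ty := ty) (n := n)).map (constTwo ty n K) constTwo_smul
  rw [constTwo_map, constTwo_map] at R
  set κ := ty.kappa n with hκ
  have hal : ∀ x : ℂ, algebraMap ℂ (MvPowerSeries (Fin 2) K) x =
      MvPowerSeries.C (algebraMap ℂ K x) := fun x => MvPowerSeries.algebraMap_apply
  have hdk : dkB ty n K = dB K - algebraMap ℂ (MvPowerSeries (Fin 2) K) κ *
      (MvPowerSeries.X 0 * MvPowerSeries.X 1) := by
    rw [dkB, dB, Algebra.smul_def]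
  have e1 := embed_geo_mul a a
  have e2 := embed_geo_mul (a + algebraMap ℂ K κ) a
  have e3 := embed_geo_mul (a + algebraMap ℂ K κ) (a + algebraMap ℂ K κ)
  have e4 := embed_geo_mul a (a + algebraMap ℂ K κ)
  have e5 := congrArg (embed K 0) (geo_sub_geo a (a + algebraMap ℂ K κ))
  have e6 := congrArg (embed K 1) (geo_sub_geo a (a + algebraMap ℂ K κ))
  rw [sub_self, map_zero, zero_mul, sub_zero] at e1 e3
  rw [add_sub_cancel_left] at e2 e5 e6
  rw [show a - (a + algebraMap ℂ K κ) = -algebraMap ℂ K κ by ring, map_neg, neg_mul,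
    sub_neg_eq_add] at e4
  rw [map_sub, map_mul, map_mul, embed_C, ← hal] at e5 e6
  rw [← hal] at e2 e4
  have := yangBaxter R size_eq hdk e1 (by rw [hdk]; exact e2) e3 e4 e5 e6
  simp only [hsm, mul_one] at this
  unfold IsRTT
  rw [rMat_eq_scalarTwo, vecL]
  simp only [map_add, map_sub, map_one, map_mul, leftMat_scalarOne, rightMat_scalarOne,
    leftMat_constOne, rightMat_constOne] at this ⊢
  exact this

theorem vecL_apply (a : K) (i j : ty.Idx n) : vecL ty n a i j =
    (if i = j then 1 else 0)
      - PowerSeries.map (algebraMap K _) (geo a) * PowerSeries.C (pMat ty n K i j)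
      + PowerSeries.map (algebraMap K _) (geo (a + algebraMap ℂ K (ty.kappa n))) *
        PowerSeries.C (qMat ty n K i j) := by
  have hs : ∀ (f : PowerSeries K) (M : Matrix (ty.Idx n) (ty.Idx n)
      (PowerSeries (Matrix (ty.Idx n) (ty.Idx n) K))),
      scalarOne ty n K f * M = PowerSeries.map (algebraMap K (Matrix (ty.Idx n) (ty.Idx n) K)) f • M := by
    intro f M
    rw [scalarOne, RingHom.comp_apply, Matrix.scalar_apply, ← Matrix.smul_eq_diagonal_mul]
  have hp : constOne ty n K (pMat ty n ℂ) i j = PowerSeries.C (pMat ty n K i j) := by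
    rw [constOne, RingHom.mapMatrix_apply, Matrix.map_apply, RingHom.comp_apply]
    congr 1
    simp [pMat]
  have hq : constOne ty n K (qMat ty n ℂ) i j = PowerSeries.C (qMat ty n K i j) := by
    rw [constOne, RingHom.mapMatrix_apply, Matrix.map_apply, RingHom.comp_apply]
    congr 1
    rw [qMat, qMat, Matrix.of_apply, Matrix.of_apply, RingHom.mapMatrix_apply]
    ext k l
    rw [Matrix.map_apply, Matrix.smul_apply, Matrix.smul_apply, smul_eq_mul, map_mul,
      Algebra.smul_def, Matrix.single_apply, Matrix.single_apply]
    split_ifs <;> simp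
  rw [vecL, Matrix.add_apply, Matrix.sub_apply, hs, hs, Matrix.smul_apply, Matrix.smul_apply,
    smul_eq_mul, smul_eq_mul, hp, hq, Matrix.one_apply]

theorem shift_map_mul_C {B : Type*} [Ring B] [Algebra ℂ B] (κ : ℂ) (f : PowerSeries B) (b : B) :
    shift κ (f * PowerSeries.C b) = shift κ f * PowerSeries.C b := by
  ext s
  rw [PowerSeries.coeff_mul_C, coeff_shift κ _ (Nat.lt_succ_self s),
    coeff_shift κ _ (Nat.lt_succ_self s), Finset.sum_mul]
  refine Finset.sum_congr rfl fun r _ => ?_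
  rw [PowerSeries.coeff_mul_C, smul_mul_assoc]

/-- Transposition in the first factor interchanges P and Q, while the shift by κ moves the poles a
and a + κ to a - κ and a. -/
theorem crossTr_vecL (a : K) : crossTr (vecL ty n a) =
    1 - scalarOne ty n K (geo (a - algebraMap ℂ K (ty.kappa n))) * constOne ty n K (qMat ty n ℂ)
      + scalarOne ty n K (geo a) * constOne ty n K (pMat ty n ℂ) := by
  have hs : ∀ (f : PowerSeries K) (M : Matrix (ty.Idx n) (ty.Idx n)
      (PowerSeries (Matrix (ty.Idx n) (ty.Idx n) K))),
      scalarOne ty n K f * M = PowerSeries.map (algebraMap K (Matrix (ty.Idx n) (ty.Idx n) K)) f • M := by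
    intro f M
    rw [scalarOne, RingHom.comp_apply, Matrix.scalar_apply, ← Matrix.smul_eq_diagonal_mul]
  have hp : ∀ i j, constOne ty n K (pMat ty n ℂ) i j = PowerSeries.C (pMat ty n K i j) := by
    intro i j
    rw [constOne, RingHom.mapMatrix_apply, Matrix.map_apply, RingHom.comp_apply]
    congr 1
    simp [pMat]
  have hq : ∀ i j, constOne ty n K (qMat ty n ℂ) i j = PowerSeries.C (qMat ty n K i j) := by
    intro i j
    rw [constOne, RingHom.mapMatrix_apply, Matrix.map_apply, RingHom.comp_apply]
    congr 1
    rw [qMat, qMat, Matrix.of_apply, Matrix.of_apply, RingHom.mapMatrix_apply]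
    ext k l
    rw [Matrix.map_apply, Matrix.smul_apply, Matrix.smul_apply, smul_eq_mul, map_mul,
      Algebra.smul_def, Matrix.single_apply, Matrix.single_apply]
    split_ifs <;> simp
  have hm : ∀ b : K, shift (ty.kappa n) (PowerSeries.map (algebraMap K
      (Matrix (ty.Idx n) (ty.Idx n) K)) (geo b)) =
      PowerSeries.map (algebraMap K _) (geo (b - algebraMap ℂ K (ty.kappa n))) := fun b => by
    rw [← shift_geo]
    exact (map_shift (IsScalarTower.toAlgHom ℂ K (Matrix (ty.Idx n) (ty.Idx n) K)) _ _).symm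
  ext1 k l
  have hC : ∀ (b : Matrix (ty.Idx n) (ty.Idx n) K) (x : ℂ) (f : PowerSeries _),
      x • (f * PowerSeries.C b) = f * PowerSeries.C (x • b) := by
    intro b x f
    ext1 s
    change x • PowerSeries.coeff s (f * PowerSeries.C b) = _
    rw [PowerSeries.coeff_mul_C, PowerSeries.coeff_mul_C, mul_smul_comm]
  have h1 : theta k l • pMat ty n K (neg l) (neg k) = qMat ty n K k l := by
    simp [pMat, qMat]
  have h2 : theta k l • qMat ty n K (neg l) (neg k) = pMat ty n K k l := by
    simp [pMat, qMat, OSType.neg_neg, theta_neg_neg, smul_smul, theta_mul_theta]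
  rw [crossTr_apply, vecL_apply, ← shiftHom_apply, map_add, map_sub, shiftHom_apply,
    shiftHom_apply, shiftHom_apply, shift_map_mul_C, shift_map_mul_C, hm, hm,
    Matrix.add_apply, Matrix.sub_apply, hs, hs, Matrix.smul_apply, Matrix.smul_apply,
    smul_eq_mul, smul_eq_mul, hp, hq, Matrix.one_apply, smul_add, smul_sub, hC, hC, h1, h2,
    add_sub_cancel_right]
  congr 2
  by_cases h : k = l
  · subst h
    rw [if_pos rfl, if_pos rfl, theta_self, one_smul, ← shiftHom_apply, map_one]
  · rw [if_neg h, if_neg fun h' => h (neg_inj.1 h').symm, ← shiftHom_apply, map_zero, smul_zero]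

theorem slotOne_injective : Function.Injective
    (slotOne : Matrix (ty.Idx n) (ty.Idx n) (Matrix (ty.Idx n) (ty.Idx n) ℂ) →+* _) := by
  intro M N h
  ext1 i j
  have h' := congrFun (congrFun h (i, i)) (j, i)
  rwa [slotOne_apply, slotOne_apply, if_pos rfl, if_pos rfl] at h'

theorem slotOne_smul (x : ℂ)
    (M : Matrix (ty.Idx n) (ty.Idx n) (Matrix (ty.Idx n) (ty.Idx n) ℂ)) :
    slotOne (x • M) = x • slotOne M := by
  ext1 a b
  rw [Matrix.smul_apply, slotOne_apply, slotOne_apply]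
  split_ifs
  · rfl
  · rw [smul_zero]

/-- `crossing_relation` gives the scalar 1 - 1/(u-a)^2, central because its coefficients come from
K. -/
theorem isCross_vecL (a : K) : IsCross (vecL ty n a) := by
  let : Algebra (PowerSeries K) (Matrix (ty.Idx n) (ty.Idx n)
      (PowerSeries (Matrix (ty.Idx n) (ty.Idx n) K))) :=
    (scalarOne ty n K).toAlgebra' scalarOne_commute
  have : IsScalarTower ℂ (PowerSeries K) (Matrix (ty.Idx n) (ty.Idx n)
      (PowerSeries (Matrix (ty.Idx n) (ty.Idx n) K))) :=
    IsScalarTower.of_algebraMap_eq fun x => (scalarOne_algebraMap x).symm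
  have hsm : ∀ (f : PowerSeries K) (M : Matrix (ty.Idx n) (ty.Idx n)
      (PowerSeries (Matrix (ty.Idx n) (ty.Idx n) K))),
      f • M = scalarOne ty n K f * M := fun f M => Algebra.smul_def f M
  have R := brauerRel_base (ty := ty) (n := n)
  have hpp : pMat ty n ℂ * pMat ty n ℂ = 1 := slotOne_injective (by
    rw [map_mul, map_one]; exact R.pbb)
  have hpq : pMat ty n ℂ * qMat ty n ℂ = sgn ty • qMat ty n ℂ := slotOne_injective (by
    rw [map_mul, slotOne_smul]; exact R.pqb)
  have hqp : qMat ty n ℂ * pMat ty n ℂ = sgn ty • qMat ty n ℂ := slotOne_injective (by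
    rw [map_mul, slotOne_smul]; exact R.qpb)
  have hqq : qMat ty n ℂ * qMat ty n ℂ = (ty.size n : ℂ) • qMat ty n ℂ :=
    slotOne_injective (by rw [map_mul, slotOne_smul]; exact R.qqb)
  have hal : ∀ x : ℂ, algebraMap ℂ (PowerSeries K) x = PowerSeries.C (algebraMap ℂ K x) :=
    fun x => PowerSeries.algebraMap_apply
  set κ := ty.kappa n with hκ
  have e1 := geo_sub_geo a (a + algebraMap ℂ K κ)
  have e2 := geo_sub_geo (a - algebraMap ℂ K κ) a
  have e3 := geo_sub_geo (a - algebraMap ℂ K κ) (a + algebraMap ℂ K κ)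
  rw [add_sub_cancel_left, ← hal] at e1
  rw [sub_sub_cancel, ← hal] at e2
  rw [show a + algebraMap ℂ K κ - (a - algebraMap ℂ K κ) = algebraMap ℂ K (2 * κ) by
    rw [map_mul, map_ofNat]; ring, ← hal] at e3
  have H := crossing_relation (p := constOne ty n K (pMat ty n ℂ))
    (q := constOne ty n K (qMat ty n ℂ))
    (by rw [← map_mul, hpp, map_one]) (by rw [← map_mul, hpq, constOne_smul])
    (by rw [← map_mul, hqp, constOne_smul]) (by rw [← map_mul, hqq, constOne_smul])
    size_eq e1 e2 e3
  simp only [hsm, mul_one] at H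
  rw [← crossTr_vecL] at H
  refine ⟨PowerSeries.map (algebraMap K _) (1 - geo a * geo a), fun r b => ?_, H.1, H.2⟩
  rw [PowerSeries.coeff_map]
  exact Algebra.commutes _ _

end Vector

end ExtYangian

/-! ### Representations on tensor products of evaluation modules -/

namespace ExtYangian

open OSType

set_option linter.unusedSectionVars false

variable {ty : OSType} {n : ℕ}

/-! #### Leading coefficients -/

section Top

variable {B : Type*} [Ring B]

/-- The coefficient of `u^(-r-1)` in each entry of `M(u)` is a polynomial of degree at most `r`,
with the given coefficient of degree `r`; the constant term of `M(u)` is the identity matrix. -/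
structure HasTop (M : Matrix (ty.Idx n) (ty.Idx n) (PowerSeries B[X]))
    (top : ty.Idx n → ty.Idx n → ℕ → B) : Prop where
  zero : ∀ i j, PowerSeries.coeff 0 (M i j) = if i = j then 1 else 0
  natDegree_le : ∀ i j r, (PowerSeries.coeff (r + 1) (M i j)).natDegree ≤ r
  top : ∀ i j r, (PowerSeries.coeff (r + 1) (M i j)).coeff r = top i j r

theorem coeff_succ_mul {C : Type*} [Ring C] (f g : PowerSeries C) (r : ℕ) :
    PowerSeries.coeff (r + 1) (f * g) = PowerSeries.coeff 0 f * PowerSeries.coeff (r + 1) g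
      + PowerSeries.coeff (r + 1) f * PowerSeries.coeff 0 g
      + ∑ p ∈ (Finset.range r).attach, PowerSeries.coeff (p.1 + 1) f *
        PowerSeries.coeff (r - 1 - p.1 + 1) g := by
  rw [PowerSeries.coeff_mul, Finset.Nat.sum_antidiagonal_eq_sum_range_succ
    (fun p q => PowerSeries.coeff p f * PowerSeries.coeff q g), Finset.sum_range_succ,
    Finset.sum_range_succ', Nat.sub_self, Nat.sub_zero,
    Finset.sum_attach (Finset.range r) fun p => PowerSeries.coeff (p + 1) f *
        PowerSeries.coeff (r - 1 - p + 1) g]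
  rw [add_comm (Finset.sum _ _), add_right_comm]
  congr 1
  refine Finset.sum_congr rfl fun p hp => ?_
  rw [Finset.mem_range] at hp
  rw [show r + 1 - (p + 1) = r - 1 - p + 1 by omega]

/-- Apart from the two extreme terms, the coefficient of u^(-r-1) of a product involves polynomials
of degrees p and r-1-p, hence of total degree r-1. So the coefficients of degree r simply add. -/
theorem HasTop.mul {M N : Matrix (ty.Idx n) (ty.Idx n) (PowerSeries B[X])}
    {a b : ty.Idx n → ty.Idx n → ℕ → B} (hM : HasTop M a) (hN : HasTop N b) :
    HasTop (M * N) fun i j r => a i j r + b i j r := by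
  have key : ∀ i j r, ∃ R : B[X], (R.natDegree ≤ r ∧ R.coeff r = 0) ∧
      PowerSeries.coeff (r + 1) ((M * N) i j) =
        PowerSeries.coeff (r + 1) (M i j) + PowerSeries.coeff (r + 1) (N i j) + R := by
    intro i j r
    refine ⟨∑ l, ∑ p ∈ (Finset.range r).attach, PowerSeries.coeff (p.1 + 1) (M i l) *
        PowerSeries.coeff (r - 1 - p.1 + 1) (N l j), ?_, ?_⟩
    · have h : ∀ l, ∀ p ∈ (Finset.range r).attach, (PowerSeries.coeff (p.1 + 1) (M i l) *
          PowerSeries.coeff (r - 1 - p.1 + 1) (N l j)).natDegree ≤ r - 1 := fun l p _ =>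
        Polynomial.natDegree_mul_le.trans (by
          have h1 := hM.natDegree_le i l p.1
          have h2 := hN.natDegree_le l j (r - 1 - p.1)
          have := Finset.mem_range.1 p.2
          omega)
      have h' := Polynomial.natDegree_sum_le_of_forall_le Finset.univ _ fun l _ =>
        Polynomial.natDegree_sum_le_of_forall_le _ _ (h l)
      refine ⟨h'.trans (Nat.sub_le _ _), ?_⟩
      cases r with
      | zero => simp
      | succ r => exact Polynomial.coeff_eq_zero_of_natDegree_lt (by omega)
    · rw [Matrix.mul_apply, map_sum]
      simp only [coeff_succ_mul, Finset.sum_add_distrib, hM.zero, hN.zero]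
      congr 1
      simp [add_comm]
  refine ⟨fun i j => ?_, fun i j r => ?_, fun i j r => ?_⟩
  · rw [Matrix.mul_apply, map_sum]
    simp only [PowerSeries.coeff_zero_eq_constantCoeff_apply, map_mul]
    simp only [← PowerSeries.coeff_zero_eq_constantCoeff_apply, hM.zero, hN.zero]
    simp
  · obtain ⟨R, ⟨h1, -⟩, h⟩ := key i j r
    rw [h]
    exact Polynomial.natDegree_add_le_of_degree_le (Polynomial.natDegree_add_le_of_degree_le
      (hM.natDegree_le i j r) (hN.natDegree_le i j r)) h1
  · obtain ⟨R, ⟨-, h1⟩, h⟩ := key i j r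
    rw [h, Polynomial.coeff_add, Polynomial.coeff_add, h1, add_zero, hM.top, hN.top]

theorem HasTop.map {B' : Type*} [Ring B'] (φ : B →+* B')
    {M : Matrix (ty.Idx n) (ty.Idx n) (PowerSeries B[X])} {a : ty.Idx n → ty.Idx n → ℕ → B}
    (h : HasTop M a) :
    HasTop ((PowerSeries.map (Polynomial.mapRingHom φ)).mapMatrix M)
      fun i j r => φ (a i j r) := by
  refine ⟨fun i j => ?_, fun i j r => ?_, fun i j r => ?_⟩ <;>
    rw [RingHom.mapMatrix_apply, Matrix.map_apply, PowerSeries.coeff_map]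
  · rw [h.zero]
    split_ifs <;> simp
  · exact Polynomial.natDegree_map_le.trans (h.natDegree_le i j r)
  · rw [Polynomial.coe_mapRingHom, Polynomial.coeff_map, h.top]

end Top

/-! #### The evaluation module -/

/-- The coefficient algebra of the evaluation module. -/
abbrev EvalMat (ty : OSType) (n : ℕ) : Type := Matrix (ty.Idx n) (ty.Idx n) ℂ[X]

/-- Matrices of polynomials as polynomials with matrix coefficients. -/
noncomputable def matPoly (ty : OSType) (n : ℕ) :
    Matrix (ty.Idx n) (ty.Idx n) ℂ[X][X] →ₐ[ℂ] (EvalMat ty n)[X] :=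
  (matPolyEquiv : Matrix (ty.Idx n) (ty.Idx n) ℂ[X][X] ≃ₐ[ℂ[X]] _).toAlgHom.restrictScalars ℂ

/-- The evaluation module: the vector module with spectral parameter `c X`. -/
noncomputable def evalL (ty : OSType) (n : ℕ) :
    Matrix (ty.Idx n) (ty.Idx n) (PowerSeries (EvalMat ty n)[X]) :=
  (PowerSeries.map (matPoly ty n).toRingHom).mapMatrix
    (vecL ty n (Polynomial.C Polynomial.X * Polynomial.X))

theorem isRTT_evalL : IsRTT (evalL ty n) := (isRTT_vecL _).map _

theorem isCross_evalL : IsCross (evalL ty n) :=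
  (isCross_vecL _).map _ fun a ha b => by
    obtain ⟨b, rfl⟩ := (matPolyEquiv (R := ℂ[X]) (n := ty.Idx n)).surjective b
    exact (ha b).map (matPoly ty n)

/-- The element by which the leading part of `t_ij^(r+1)` acts. -/
noncomputable def evalTop (i j : ty.Idx n) (r : ℕ) : EvalMat ty n :=
  theta i j • Matrix.single (neg i) (neg j) (Polynomial.X ^ r)
    - Matrix.single j i (Polynomial.X ^ r)

theorem coeff_vecL {K : Type*} [CommRing K] [Algebra ℂ K] (a : K) (i j : ty.Idx n) (r : ℕ) :
    PowerSeries.coeff (r + 1) (vecL ty n a i j) =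
      theta i j • Matrix.single (neg i) (neg j) ((a + algebraMap ℂ K (ty.kappa n)) ^ r)
        - Matrix.single j i (a ^ r) := by
  have h1 : PowerSeries.coeff (r + 1) (if i = j then (1 : PowerSeries (Matrix (ty.Idx n)
      (ty.Idx n) K)) else 0) = 0 := by
    split_ifs <;> simp [PowerSeries.coeff_one]
  rw [vecL_apply, map_add, map_sub, h1, PowerSeries.coeff_mul_C, PowerSeries.coeff_mul_C,
    PowerSeries.coeff_map, PowerSeries.coeff_map, coeff_succ_geo, coeff_succ_geo, pMat, qMat,
    Matrix.of_apply, Matrix.of_apply, ← Algebra.smul_def, ← Algebra.smul_def, smul_comm,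
    Matrix.smul_single, Matrix.smul_single]
  simp [add_comm, sub_eq_add_neg]

theorem coeff_coeff_evalL (i j p q : ty.Idx n) (r s : ℕ) :
    (PowerSeries.coeff (r + 1) (evalL ty n i j)).coeff s p q =
      (theta i j • Matrix.single (neg i) (neg j) (((Polynomial.C Polynomial.X * Polynomial.X
          + Polynomial.C (Polynomial.C (ty.kappa n))) ^ r : ℂ[X][X]).coeff s)
        - Matrix.single j i (((Polynomial.C Polynomial.X * Polynomial.X) ^ r : ℂ[X][X]).coeff s) :
          EvalMat ty n) p q := by
  rw [evalL, RingHom.mapMatrix_apply, Matrix.map_apply, PowerSeries.coeff_map, coeff_vecL]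
  refine (matPolyEquiv_coeff_apply _ _ _ _).trans ?_
  simp only [Matrix.sub_apply, Matrix.smul_apply, Matrix.single_apply, Polynomial.coeff_sub,
    Polynomial.coeff_smul]
  split_ifs <;> simp

/-- The outer polynomial variable records filtration degree and the inner one, c, is the evaluation
parameter. The top coefficient of (c X + κ)^r is c^r, so κ disappears, and t_ij^(r+1) acts in top
degree by minus the transpose of F_ij times c^r. -/
theorem hasTop_evalL : HasTop (evalL ty n) evalTop := by
  have hd : (Polynomial.C Polynomial.X * Polynomial.X : ℂ[X][X]).natDegree ≤ 1 :=
    (Polynomial.natDegree_C_mul_le _ _).trans Polynomial.natDegree_X_le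
  have hd' : (Polynomial.C Polynomial.X * Polynomial.X
      + Polynomial.C (Polynomial.C (ty.kappa n)) : ℂ[X][X]).natDegree ≤ 1 :=
    Polynomial.natDegree_add_le_of_degree_le hd (by simp)
  refine ⟨fun i j => ?_, fun i j r => ?_, fun i j r => ?_⟩
  · rw [evalL, RingHom.mapMatrix_apply, Matrix.map_apply, PowerSeries.coeff_map, vecL_apply,
      map_add, map_sub, PowerSeries.coeff_mul_C, PowerSeries.coeff_mul_C,
      PowerSeries.coeff_map, PowerSeries.coeff_map, coeff_zero_geo, coeff_zero_geo]
    split_ifs <;> simp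
  · rw [Polynomial.natDegree_le_iff_coeff_eq_zero]
    intro s hs
    ext1 p q
    rw [coeff_coeff_evalL, Polynomial.coeff_eq_zero_of_natDegree_lt,
      Polynomial.coeff_eq_zero_of_natDegree_lt]
    · simp
    · exact (Polynomial.natDegree_pow_le_of_le r hd).trans_lt (by omega)
    · exact (Polynomial.natDegree_pow_le_of_le r hd').trans_lt (by omega)
  · ext1 p q
    have h1 := Polynomial.coeff_pow_of_natDegree_le (m := r) hd
    have h2 := Polynomial.coeff_pow_of_natDegree_le (m := r) hd'
    rw [mul_one] at h1 h2
    rw [coeff_coeff_evalL, h1, h2, evalTop]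
    simp

/-! #### Tensor products -/

section TensorPow

/-- The `k`-th tensor power of an algebra. -/
def TensorPow (E : Type*) [Ring E] [Algebra ℂ E] (k : ℕ) : Type _ := ⨂[ℂ] (_ : Fin k), E

variable {E : Type*} [Ring E] [Algebra ℂ E] {k : ℕ}

noncomputable instance : Ring (TensorPow E k) := inferInstanceAs (Ring (⨂[ℂ] (_ : Fin k), E))

noncomputable instance : Algebra ℂ (TensorPow E k) :=
  inferInstanceAs (Algebra ℂ (⨂[ℂ] (_ : Fin k), E))

/-- Pure tensors. -/
def pureTensor (x : Fin k → E) : TensorPow E k := PiTensorProduct.tprod ℂ x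

theorem pureTensor_mul (x y : Fin k → E) :
    pureTensor x * pureTensor y = pureTensor (x * y) := PiTensorProduct.tprod_mul_tprod x y

theorem pureTensor_one : pureTensor (1 : Fin k → E) = 1 := rfl

theorem TensorPow.induction {p : TensorPow E k → Prop}
    (h1 : ∀ (c : ℂ) (x : Fin k → E), p (c • pureTensor x)) (h2 : ∀ x y, p x → p y → p (x + y))
    (w : TensorPow E k) : p w := by
  induction w using PiTensorProduct.induction_on with
  | smul_tprod c y => exact h1 c y
  | add x y hx hy => exact h2 x y hx hy

/-- The functional on a tensor power given by a family of functionals on the factors. -/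
noncomputable def pairing (φ : Fin k → E →ₗ[ℂ] ℂ) : TensorPow E k →ₗ[ℂ] ℂ :=
  PiTensorProduct.lift ((MultilinearMap.mkPiAlgebra ℂ (Fin k) ℂ).compLinearMap φ)

theorem pairing_pureTensor (φ : Fin k → E →ₗ[ℂ] ℂ) (x : Fin k → E) :
    pairing φ (pureTensor x) = ∏ a, φ a (x a) :=
  (PiTensorProduct.lift.tprod _).trans (by simp)

/-- The embedding of the `a`-th tensor factor. -/
noncomputable def slot (a : Fin k) : E →ₐ[ℂ] TensorPow E k :=
  PiTensorProduct.singleAlgHom (R := ℂ) (A := fun _ : Fin k => E) a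

theorem slot_apply (a : Fin k) (x : E) : slot a x = pureTensor (Pi.mulSingle a x) := rfl

theorem pureTensor_commute {x y : Fin k → E} (h : Commute x y) :
    Commute (pureTensor x) (pureTensor y) := by
  change _ * _ = _ * _
  rw [pureTensor_mul, pureTensor_mul, h.eq]

theorem slot_commute {a b : Fin k} (h : a ≠ b) (x y : E) : Commute (slot a x) (slot b y) :=
  pureTensor_commute (Pi.mulSingle_commute (f := fun _ => E) h x y)

theorem slot_central (a : Fin k) {x : E} (hx : ∀ y, Commute x y) (w : TensorPow E k) :
    Commute (slot a x) w := by
  induction w using TensorPow.induction with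
  | h1 c y =>
    refine Commute.smul_right (pureTensor_commute (Pi.commute_iff.2 fun b => ?_)) c
    by_cases h : b = a
    · subst h
      simpa using hx _
    · simp [Pi.mulSingle_eq_of_ne h]
  | h2 _ _ h1 h2 => exact h1.add_right h2

end TensorPow

/-- Tensor powers of the coefficient algebra of the evaluation module. -/
abbrev TensorAlg (ty : OSType) (n k : ℕ) : Type := TensorPow (EvalMat ty n) k

variable {k : ℕ}

/-- The evaluation module in the `a`-th tensor factor. -/
noncomputable def slotL (ty : OSType) (n : ℕ) (a : Fin k) :
    Matrix (ty.Idx n) (ty.Idx n) (PowerSeries (TensorAlg ty n k)[X]) :=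
  (PowerSeries.map (Polynomial.mapAlgHom (slot a)).toRingHom).mapMatrix (evalL ty n)

theorem polynomial_commute {B : Type*} [Ring B] {p q : B[X]}
    (h : ∀ r s, Commute (p.coeff r) (q.coeff s)) : Commute p q := by
  ext m
  rw [Polynomial.coeff_mul, Polynomial.coeff_mul]
  exact Finset.sum_equiv (Equiv.prodComm _ _) (fun p => by simp [add_comm]) fun p _ => h _ _

theorem isRTT_slotL (a : Fin k) : IsRTT (slotL ty n a) := isRTT_evalL.map _

theorem isCross_slotL (a : Fin k) : IsCross (slotL ty n a) :=
  isCross_evalL.map _ fun p hp q => polynomial_commute fun r s => by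
    change Commute ((Polynomial.map _ p).coeff r) _
    rw [Polynomial.coeff_map]
    refine slot_central a (fun y => ?_) _
    have := congrArg (Polynomial.coeff · r) (hp (Polynomial.C y)).eq
    simpa [Commute, SemiconjBy] using this

theorem hasTop_slotL (a : Fin k) :
    HasTop (slotL ty n a) fun i j r => slot a (evalTop i j r) :=
  hasTop_evalL.map (slot a).toRingHom

theorem entriesCommute_slotL {a b : Fin k} (h : a ≠ b) :
    EntriesCommute (slotL ty n a) (slotL ty n b) := fun i j p q r s => by
  rw [slotL, slotL, RingHom.mapMatrix_apply, RingHom.mapMatrix_apply, Matrix.map_apply,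
    Matrix.map_apply, PowerSeries.coeff_map, PowerSeries.coeff_map]
  refine polynomial_commute fun x y => ?_
  change Commute ((Polynomial.map _ _).coeff x) ((Polynomial.map _ _).coeff y)
  rw [Polynomial.coeff_map, Polynomial.coeff_map]
  exact slot_commute h _ _

theorem EntriesCommute.mul_right {B : Type*} [Ring B] [Algebra ℂ B]
    {M N K : Matrix (ty.Idx n) (ty.Idx n) (PowerSeries B)} (h : EntriesCommute M N)
    (h' : EntriesCommute M K) : EntriesCommute M (N * K) := fun i j p q r s => by
  rw [Matrix.mul_apply, map_sum]
  refine Commute.sum_right _ _ _ fun l _ => ?_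
  rw [PowerSeries.coeff_mul]
  exact Commute.sum_right _ _ _ fun m _ => (h _ _ _ _ _ _).mul_right (h' _ _ _ _ _ _)

theorem entriesCommute_diagonal {B : Type*} [Ring B] [Algebra ℂ B] {f : PowerSeries B}
    (hf : ∀ r b, Commute (PowerSeries.coeff r f) b)
    (M : Matrix (ty.Idx n) (ty.Idx n) (PowerSeries B)) :
    EntriesCommute (Matrix.diagonal fun _ => f) M := fun i j p q r s => by
  rw [Matrix.diagonal_apply]
  split_ifs
  · exact hf _ _
  · rw [map_zero]
    exact Commute.zero_left _

/-- The scalar series by which the tensor products are twisted. -/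
noncomputable def twist (ty : OSType) (n k : ℕ) (f : ℕ → ℂ) :
    PowerSeries (TensorAlg ty n k)[X] :=
  PowerSeries.mk fun
    | 0 => 1
    | s + 1 => algebraMap ℂ _ (f s) * Polynomial.X ^ s

theorem twist_central (f : ℕ → ℂ) (r : ℕ) (b : (TensorAlg ty n k)[X]) :
    Commute (PowerSeries.coeff r (twist ty n k f)) b := by
  rw [twist, PowerSeries.coeff_mk]
  cases r with
  | zero => exact Commute.one_left _
  | succ s =>
    exact (Algebra.commute_algebraMap_left _ b).mul_left ((Polynomial.commute_X b).pow_left s)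

theorem hasTop_twist (f : ℕ → ℂ) :
    HasTop (Matrix.diagonal fun _ => twist ty n k f :
      Matrix (ty.Idx n) (ty.Idx n) (PowerSeries (TensorAlg ty n k)[X]))
      fun i j r => if i = j then algebraMap ℂ _ (f r) else 0 := by
  have e : algebraMap ℂ (TensorAlg ty n k)[X] = Polynomial.C.comp (algebraMap ℂ _) := rfl
  refine ⟨fun i j => ?_, fun i j r => ?_, fun i j r => ?_⟩ <;> by_cases h : i = j
  · simp [h, twist]
  · simp [h, twist]
  · simp only [h, Matrix.diagonal_apply_eq, twist, PowerSeries.coeff_mk, e, RingHom.comp_apply]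
    exact Polynomial.natDegree_C_mul_X_pow_le _ _
  · simp [h]
  · simp [h, twist, e]
  · simp [h]

/-- The twisted tensor product of the evaluation modules in the listed factors. -/
noncomputable def prodL (ty : OSType) (n : ℕ) (f : ℕ → ℂ) (l : List (Fin k)) :
    Matrix (ty.Idx n) (ty.Idx n) (PowerSeries (TensorAlg ty n k)[X]) :=
  l.foldr (fun a M => slotL ty n a * M) (Matrix.diagonal fun _ => twist ty n k f)

/-- The four properties are proved together: RTT and crossing for a product need the entries of the
new factor to commute with the others, which is why each slot may occur only once. The top
coefficients add, as for a tensor product of Lie algebra modules. -/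
theorem prodL_spec (f : ℕ → ℂ) (l : List (Fin k)) (hl : l.Nodup) :
    IsRTT (prodL ty n f l) ∧ IsCross (prodL ty n f l) ∧
      HasTop (prodL ty n f l) (fun i j r => (l.map fun a => slot a (evalTop i j r)).sum
        + if i = j then algebraMap ℂ _ (f r) else 0) ∧
      ∀ a ∉ l, EntriesCommute (slotL ty n a) (prodL ty n f l) := by
  induction l with
  | nil =>
    refine ⟨isRTT_diagonal (twist_central f), isCross_diagonal (twist_central f), ?_,
      fun a _ => (entriesCommute_diagonal (twist_central f) _).symm⟩
    simpa [prodL] using hasTop_twist f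
  | cons a l ih =>
    obtain ⟨ha, hl⟩ := List.nodup_cons.1 hl
    obtain ⟨h1, h2, h3, h4⟩ := ih hl
    refine ⟨(isRTT_slotL a).mul h1 (h4 a ha), (isCross_slotL a).mul h2 (h4 a ha), ?_,
      fun b hb => ?_⟩
    · simpa [add_assoc, prodL] using (hasTop_slotL a).mul h3
    · rw [List.mem_cons, not_or] at hb
      exact (entriesCommute_slotL hb.1).mul_right (h4 b hb.2)

/-- The action of the extended Yangian on the twisted tensor product of `k` evaluation modules. -/
noncomputable def rho (ty : OSType) (n k : ℕ) (f : ℕ → ℂ) :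
    XAlg ty n →ₐ[ℂ] (TensorAlg ty n k)[X] :=
  liftRTT (prodL ty n f (List.finRange k))
    (prodL_spec f _ (List.nodup_finRange k)).2.2.1.zero
    (prodL_spec f _ (List.nodup_finRange k)).1

/-- The leading part of the action of `t_ij^(r+1)`. -/
noncomputable def rhoTop (ty : OSType) (n k : ℕ) (f : ℕ → ℂ) (i j : ty.Idx n) (r : ℕ) :
    TensorAlg ty n k :=
  ∑ a, slot a (evalTop i j r) + if i = j then algebraMap ℂ _ (f r) else 0

theorem rho_T (f : ℕ → ℂ) :
    (PowerSeries.map (rho ty n k f).toRingHom).mapMatrix (T ty n) =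
      prodL ty n f (List.finRange k) := liftRTT_T _ _

theorem natDegree_rho_t (f : ℕ → ℂ) (i j : ty.Idx n) (r : ℕ) :
    (rho ty n k f (t i j (r + 1))).natDegree ≤ r := by
  rw [rho, liftRTT_t]
  exact (prodL_spec f _ (List.nodup_finRange k)).2.2.1.natDegree_le i j r

theorem coeff_rho_t (f : ℕ → ℂ) (i j : ty.Idx n) (r : ℕ) :
    (rho ty n k f (t i j (r + 1))).coeff r = rhoTop ty n k f i j r := by
  rw [rho, liftRTT_t, (prodL_spec f _ (List.nodup_finRange k)).2.2.1.top i j r, rhoTop,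
    Fin.sum_univ_def]

/-- The polynomial degree of the action is bounded by the filtration degree, so taking the
coefficient of degree p factors through the p-th graded component. -/
theorem natDegree_rho (f : ℕ → ℂ) {p : ℕ} {x : XAlg ty n} (hx : x ∈ (filtration ty n).comp p) :
    (rho ty n k f x).natDegree ≤ p := by
  refine Submodule.span_induction (p := fun x _ => (rho ty n k f x).natDegree ≤ p)
    ?_ ?_ ?_ ?_ hx
  · rintro _ ⟨l, hl, rfl⟩
    refine le_trans ?_ hl
    clear hl
    induction l with
    | nil => simp
    | cons g l ih =>
      rw [List.map_cons, List.prod_cons, map_mul, List.map_cons, List.sum_cons]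
      exact Polynomial.natDegree_mul_le.trans (add_le_add (natDegree_rho_t _ _ _ _) ih)
  · simp
  · intro x y _ _ hx hy
    rw [map_add]
    exact Polynomial.natDegree_add_le_of_degree_le hx hy
  · intro c x _ hx
    rw [map_smul]
    exact (Polynomial.natDegree_smul_le _ _).trans hx

theorem isCross_rho_T (f : ℕ → ℂ) :
    IsCross ((PowerSeries.map (rho ty n k f).toRingHom).mapMatrix (T ty n)) := by
  rw [rho_T]
  exact (prodL_spec f _ (List.nodup_finRange k)).2.1

end ExtYangian

/-! ### Leading terms of the series `z(u)` -/

namespace AscFiltration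

variable {A : Type*} [Ring A] [Algebra ℂ A] (F : AscFiltration ℂ A)

theorem comp_le_below {p q : ℕ} (h : p < q) : F.comp p ≤ F.below q := by
  obtain ⟨q, rfl⟩ := Nat.exists_eq_add_of_lt h
  exact F.mono (Nat.le_add_right _ _)

theorem below_le_comp (p : ℕ) : F.below p ≤ F.comp p := by
  cases p with
  | zero => exact bot_le
  | succ p => exact F.mono (Nat.le_succ p)

-- The substitution u ↦ u + c is unitriangular on coefficients, so it alters each coefficient only
-- by lower terms.
open ExtYangian in
theorem coeff_succ_shift_sub_mem {f : PowerSeries A}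
    (hf : ∀ r, PowerSeries.coeff (r + 1) f ∈ F.comp r) (c : ℂ) (r : ℕ) :
    PowerSeries.coeff (r + 1) (shift c f) - PowerSeries.coeff (r + 1) f ∈ F.below r := by
  rw [coeff_shift c f (Nat.lt_succ_self (r + 1)), Finset.sum_range_succ, Finset.sum_range_succ']
  have h1 := coeff_shiftVar_pow c (r + 1) 0
  rw [add_zero, Ring.choose_zero_right, pow_zero, mul_one, Int.cast_one] at h1
  rw [h1, one_smul, add_sub_cancel_right, pow_zero, PowerSeries.coeff_one,
    if_neg (Nat.succ_ne_zero r), zero_smul, add_zero]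
  exact Submodule.sum_mem _ fun p hp => Submodule.smul_mem _ _
    (F.comp_le_below (Finset.mem_range.1 hp) (hf p))

open ExtYangian in
theorem coeff_succ_mul_sub_mem {f g : PowerSeries A}
    (hf : ∀ r, PowerSeries.coeff (r + 1) f ∈ F.comp r)
    (hg : ∀ r, PowerSeries.coeff (r + 1) g ∈ F.comp r) (r : ℕ) :
    PowerSeries.coeff (r + 1) (f * g) - (PowerSeries.coeff 0 f * PowerSeries.coeff (r + 1) g
      + PowerSeries.coeff (r + 1) f * PowerSeries.coeff 0 g) ∈ F.below r := by
  rw [coeff_succ_mul, add_sub_cancel_left]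
  refine Submodule.sum_mem _ fun p _ => ?_
  have h := F.mul_mem (hf p.1) (hg (r - 1 - p.1))
  have := Finset.mem_range.1 p.2
  exact F.comp_le_below (by omega) h

end AscFiltration

namespace ExtYangian

open OSType

set_option linter.unusedSectionVars false

variable {ty : OSType} {n : ℕ}

theorem coeff_zero_shift {A : Type*} [Ring A] [Algebra ℂ A] (c : ℂ) (f : PowerSeries A) :
    PowerSeries.coeff 0 (shift c f) = PowerSeries.coeff 0 f := by
  rw [coeff_shift c f Nat.zero_lt_one]
  simp

theorem coeff_succ_Tt_sub_mem (i j : ty.Idx n) (r : ℕ) :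
    PowerSeries.coeff (r + 1) (Tt ty n i j) - theta i j • t (neg j) (neg i) (r + 1)
      ∈ (filtration ty n).below r := by
  have h := (filtration ty n).coeff_succ_shift_sub_mem (f := T ty n (neg j) (neg i))
    (fun r => by rw [coeff_T]; exact t_mem _ _ _) (ty.kappa n) r
  have h' := Submodule.smul_mem _ (theta i j) h
  rw [smul_sub, coeff_T] at h'
  exact h'

theorem coeff_succ_Tt_mem (i j : ty.Idx n) (r : ℕ) :
    PowerSeries.coeff (r + 1) (Tt ty n i j) ∈ (filtration ty n).comp r := by
  have h := (filtration ty n).below_le_comp r (coeff_succ_Tt_sub_mem i j r)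
  exact (Submodule.sub_mem_iff_left _ (Submodule.smul_mem _ _ (t_mem _ _ _))).1 h

theorem coeff_zero_Tt (i j : ty.Idx n) :
    PowerSeries.coeff 0 (Tt ty n i j) = if i = j then 1 else 0 := by
  change theta i j • PowerSeries.coeff 0 (shift (ty.kappa n) (T ty n (neg j) (neg i))) = _
  rw [coeff_zero_shift, coeff_T, t_zero]
  by_cases h : i = j
  · subst h; simp [theta_self]
  · rw [if_neg h, if_neg fun h' => h (neg_inj.1 h').symm, smul_zero]

/-- Only the terms containing a constant coefficient δ survive to leading order, and the shift by κ
is invisible there. Scalarity of the matrix product is not yet available. -/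
theorem coeff_succ_Tt_mul_T_sub_mem (i j : ty.Idx n) (r : ℕ) :
    PowerSeries.coeff (r + 1) ((Tt ty n * T ty n) i j)
      - (t i j (r + 1) + theta i j • t (neg j) (neg i) (r + 1)) ∈ (filtration ty n).below r := by
  have h : ∀ l, _ := fun l => (filtration ty n).coeff_succ_mul_sub_mem (coeff_succ_Tt_mem i l)
    (g := T ty n l j) (fun r => by rw [coeff_T]; exact t_mem _ _ _) r
  have h1 := Submodule.sum_mem _ fun l (_ : l ∈ Finset.univ) => h l
  rw [Finset.sum_sub_distrib, Finset.sum_add_distrib, ← map_sum, ← Matrix.mul_apply] at h1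
  simp only [coeff_zero_Tt, coeff_T, t_zero, ite_mul, mul_ite, one_mul, mul_one, zero_mul,
    mul_zero, Finset.sum_ite_eq, Finset.sum_ite_eq', Finset.mem_univ, if_true] at h1
  have h2 := Submodule.add_mem _ h1 (coeff_succ_Tt_sub_mem i j r)
  convert h2 using 1
  abel

theorem size_ne_zero (hn : 1 ≤ n) : (ty.size n : ℂ) ≠ 0 := by
  rw [Nat.cast_ne_zero, size]
  split_ifs <;> omega

/-- `z_(r+1)` modulo lower terms. -/
theorem z_sub_mem (r : ℕ) :
    z ty n (r + 1) - (2 * (ty.size n : ℂ)⁻¹) • ∑ i : ty.Idx n, t i i (r + 1)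
      ∈ (filtration ty n).below r := by
  have h := Submodule.sum_mem _ fun i (_ : i ∈ Finset.univ) =>
    coeff_succ_Tt_mul_T_sub_mem (ty := ty) (n := n) i i r
  rw [Finset.sum_sub_distrib, Finset.sum_add_distrib, ← map_sum] at h
  simp only [theta_self, one_smul] at h
  rw [sum_neg fun i : ty.Idx n => t i i (r + 1), ← two_smul ℂ] at h
  have h' := Submodule.smul_mem _ ((ty.size n : ℂ)⁻¹) h
  rw [smul_sub, smul_smul, mul_comm] at h'
  exact h'

theorem z_mem (r : ℕ) : z ty n (r + 1) ∈ (filtration ty n).comp r := by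
  have h := (filtration ty n).below_le_comp r (z_sub_mem (ty := ty) (n := n) r)
  exact (Submodule.sub_mem_iff_left _ (Submodule.smul_mem _ _
    (Submodule.sum_mem _ fun i _ => t_mem _ _ _))).1 h

variable {k : ℕ}

theorem coeff_rho_of_mem_below (f : ℕ → ℂ) {r : ℕ} {x : XAlg ty n}
    (hx : x ∈ (filtration ty n).below r) : (rho ty n k f x).coeff r = 0 := by
  cases r with
  | zero =>
    have h : x = 0 := hx
    rw [h, map_zero, Polynomial.coeff_zero]
  | succ r =>
    have h := natDegree_rho (k := k) f (p := r) hx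
    exact Polynomial.coeff_eq_zero_of_natDegree_lt (by omega)

theorem sum_evalTop (r : ℕ) : ∑ i : ty.Idx n, evalTop i i r = 0 := by
  simp only [evalTop, theta_self, one_smul, Finset.sum_sub_distrib]
  rw [sum_neg fun i : ty.Idx n => Matrix.single i i (Polynomial.X ^ r : ℂ[X]), sub_self]

/-- The trace part of the evaluation modules vanishes since i ↦ -i exchanges the two terms of ∑
F_ii. Only the twist remains: (2/N) times N copies of f(r). -/
theorem coeff_rho_z (hn : 1 ≤ n) (f : ℕ → ℂ) (r : ℕ) :
    (rho ty n k f (z ty n (r + 1))).coeff r = algebraMap ℂ _ (2 * f r) := by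
  have h := coeff_rho_of_mem_below (k := k) f (z_sub_mem (ty := ty) (n := n) r)
  rw [map_sub, Polynomial.coeff_sub, sub_eq_zero] at h
  rw [h, map_smul, map_sum, Polynomial.coeff_smul, Polynomial.finsetSum_coeff]
  simp only [coeff_rho_t, rhoTop, if_true]
  rw [Finset.sum_add_distrib, Finset.sum_comm]
  simp only [← map_sum, sum_evalTop, map_zero, Finset.sum_const_zero, zero_add]
  rw [Finset.sum_const, Finset.card_univ, card_idx, Algebra.smul_def, ← map_mul, nsmul_eq_mul]
  congr 1
  field_simp [size_ne_zero (ty := ty) hn]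

/-! ### Functionals on tensor powers -/

section Functional

variable {E ι : Type*} [Ring E] [Algebra ℂ E] (x : ι → E) (s : ι → ℂ) (lam : ι → E →ₗ[ℂ] ℂ)
  (p : ι → Prop) [DecidablePred p]

/-- The element acting as `x g` on the tensor power, shifted by a scalar. -/
noncomputable def tensorLetter (k : ℕ) (g : ι) : TensorPow E k :=
  ∑ a, slot a (x g) + algebraMap ℂ _ (s g)

theorem pureTensor_mul_slot (y : Fin k → E) (a : Fin k) (e : E) :
    pureTensor y * slot a e = pureTensor (Function.update y a (y a * e)) := by
  rw [slot_apply, pureTensor_mul]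
  congr 1
  ext b
  by_cases h : b = a
  · subst h; simp
  · simp [h]

/-- A letter acts as a sum over the slots plus a scalar. Absorbing the first letter into the pure
tensor gives one term for each slot and one scalar term. -/
theorem pairing_mul_tensorLetter (β : Fin k → ι) (y : Fin k → E) (g : ι) (w : TensorPow E k) :
    pairing (fun a => lam (β a)) (pureTensor y * (tensorLetter x s k g * w)) =
      ∑ a, pairing (fun a => lam (β a))
        (pureTensor (Function.update y a (y a * x g)) * w)
      + s g * pairing (fun a => lam (β a)) (pureTensor y * w) := by
  rw [tensorLetter, ← mul_assoc, mul_add, Finset.mul_sum, add_mul, Finset.sum_mul, map_add,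
    map_sum, ← Algebra.commutes, ← Algebra.smul_def, smul_mul_assoc, map_smul, smul_eq_mul]
  simp only [pureTensor_mul_slot]

variable {x s lam p} {β : Fin k → ι}

theorem tensorLetter_of_eq_zero {g : ι} (hg : x g = 0) :
    tensorLetter x s k g = algebraMap ℂ _ (s g) := by
  simp [tensorLetter, hg]

/-- A pigeonhole argument: the slots in S still contain 1, each letter satisfying p fills at most
one of them and the other letters none. Some slot keeps its 1, which its functional kills. -/
theorem pairing_eq_zero (hx : ∀ g, ¬ p g → x g = 0) (h1 : ∀ a, lam (β a) 1 = 0) (l : List ι)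
    (y : Fin k → E) (S : Finset (Fin k)) (hS : ∀ a ∈ S, y a = 1)
    (hl : (l.filter p).length < S.card) :
    pairing (fun a => lam (β a)) (pureTensor y * (l.map (tensorLetter x s k)).prod) = 0 := by
  induction l generalizing y S with
  | nil =>
    rw [List.map_nil, List.prod_nil, mul_one, pairing_pureTensor]
    obtain ⟨a, ha⟩ := Finset.card_pos.1 ((Nat.zero_le _).trans_lt hl)
    exact Finset.prod_eq_zero (Finset.mem_univ a) (by rw [hS a ha, h1])
  | cons g l ih =>
    rw [List.map_cons, List.prod_cons]
    by_cases hg : p g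
    · rw [List.filter_cons_of_pos (by simpa using hg), List.length_cons] at hl
      rw [pairing_mul_tensorLetter, ih y S hS (by omega), mul_zero, add_zero]
      refine Finset.sum_eq_zero fun a _ => ih _ (S.erase a) (fun b hb => ?_) ?_
      · rw [Finset.mem_erase] at hb
        rw [Function.update_of_ne hb.1, hS b hb.2]
      · have := Finset.pred_card_le_card_erase (s := S) (a := a)
        omega
    · rw [List.filter_cons_of_neg (by simpa using hg)] at hl
      rw [tensorLetter_of_eq_zero (hx g hg), ← Algebra.smul_def, mul_smul_comm, map_smul,
        ih y S hS hl, smul_zero]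

/-- With exactly as many effective letters as empty slots, a term survives only if each slot of S
receives one letter. The constant c counts the bijections from letters to slots under which each
slot receives its own letter. It is chosen before s because the scalars are varied later. -/
theorem exists_pairing_eq [DecidableEq ι] (hx : ∀ g, ¬ p g → x g = 0)
    (h1 : ∀ a, lam (β a) 1 = 0) (hlam : ∀ a g, lam (β a) (x g) = if g = β a then 1 else 0)
    (l : List ι) (S : Finset (Fin k)) (hl : (l.filter p).length = S.card) :
    ∃ c : ℕ, (c ≠ 0 ↔ ((l.filter p : List ι) : Multiset ι) = S.val.map β) ∧
      ∀ (s : ι → ℂ) (y : Fin k → E), (∀ a ∈ S, y a = 1) →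
      pairing (fun a => lam (β a)) (pureTensor y * (l.map (tensorLetter x s k)).prod) =
        c * (∏ a ∈ Sᶜ, lam (β a) (y a)) * ((l.filter fun g => ¬ p g).map s).prod := by
  induction l generalizing S with
  | nil =>
    obtain rfl := Finset.card_eq_zero.1 hl.symm
    exact ⟨1, by simp, fun s y _ => by simp [pairing_pureTensor]⟩
  | cons g l ih =>
    by_cases hg : p g
    · rw [List.filter_cons_of_pos (by simpa using hg), List.length_cons] at hl
      rw [List.filter_cons_of_pos (by simpa using hg), List.filter_cons_of_neg (by simpa using hg)]
      have ih' : ∀ a : Fin k, ∃ c : ℕ, a ∈ S → ((c ≠ 0 ↔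
          ((l.filter p : List ι) : Multiset ι) = (S.erase a).val.map β) ∧
          ∀ (s : ι → ℂ) (y : Fin k → E), (∀ b ∈ S.erase a, y b = 1) →
          pairing (fun a => lam (β a)) (pureTensor y * (l.map (tensorLetter x s k)).prod) =
          c * (∏ b ∈ (S.erase a)ᶜ, lam (β b) (y b)) * ((l.filter fun g => ¬ p g).map s).prod) := by
        intro a
        by_cases ha : a ∈ S
        · obtain ⟨c, hc⟩ := ih (S.erase a) (by
            rw [Finset.card_erase_of_mem ha]; omega)
          exact ⟨c, fun _ => hc⟩
        · exact ⟨0, fun h => absurd h ha⟩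
      choose c hc using ih'
      -- The letter g may go to any slot of S labelled g. As a sum of natural numbers, the count is
      -- nonzero as soon as one summand is.
      refine ⟨∑ a ∈ S, if g = β a then c a else 0, ?_, ?_⟩
      · rw [Ne, Finset.sum_eq_zero_iff]
        push Not
        constructor
        · rintro ⟨a, ha, h⟩
          rw [ite_ne_right_iff] at h
          rw [← Multiset.cons_coe, ((hc a ha).1.1 h.2), h.1, ← Multiset.map_cons,
            Finset.erase_val, Multiset.cons_erase ha]
        · intro h
          have hgm : g ∈ S.val.map β := by rw [← h]; simp
          obtain ⟨a, ha, rfl⟩ := Multiset.mem_map.1 hgm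
          refine ⟨a, ha, ?_⟩
          rw [if_pos rfl]
          refine (hc a ha).1.2 ?_
          rw [← Multiset.cons_coe, ← Multiset.cons_erase ha, Multiset.map_cons,
            Multiset.cons_inj_right] at h
          rw [h, Finset.erase_val]
      · intro s y hS
        -- If g acts by its scalar or on a slot outside S, the remaining letters are too few to fill
        -- S.
        rw [List.map_cons, List.prod_cons, pairing_mul_tensorLetter, pairing_eq_zero hx h1 l y S hS (by omega), mul_zero, add_zero,
          ← Finset.sum_subset (Finset.subset_univ S) fun a _ ha =>
            pairing_eq_zero hx h1 l _ S (fun b hb => by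
              rw [Function.update_of_ne (ne_of_mem_of_not_mem hb ha), hS b hb]) (by omega),
          Nat.cast_sum, Finset.sum_mul, Finset.sum_mul]
        refine Finset.sum_congr rfl fun a ha => ?_
        have hcompl : (S.erase a)ᶜ = insert a Sᶜ := by
          ext b; simp only [Finset.mem_compl, Finset.mem_erase, Finset.mem_insert]; tauto
        have hS' : ∀ b ∈ S.erase a, Function.update y a (y a * x g) b = 1 := fun b hb => by
          rw [Finset.mem_erase] at hb
          rw [Function.update_of_ne hb.1, hS b hb.2]
        have hprod : ∏ b ∈ Sᶜ, lam (β b) (Function.update y a (y a * x g) b) =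
            ∏ b ∈ Sᶜ, lam (β b) (y b) := Finset.prod_congr rfl fun b hb => by
          rw [Function.update_of_ne (ne_of_mem_of_not_mem ha (Finset.mem_compl.1 hb)).symm]
        rw [(hc a ha).2 s _ hS', hcompl, Finset.prod_insert (by simpa using ha), Function.update_self,
          hprod, hS a ha, one_mul, hlam]
        split_ifs <;> simp
    · rw [List.filter_cons_of_neg (by simpa using hg)] at hl
      rw [List.filter_cons_of_neg (by simpa using hg), List.filter_cons_of_pos (by simpa using hg)]
      obtain ⟨c, h, hc⟩ := ih S hl
      refine ⟨c, h, fun s y hS => ?_⟩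
      rw [List.map_cons, List.prod_cons, tensorLetter_of_eq_zero (hx g hg), ← Algebra.smul_def, mul_smul_comm, map_smul, hc s y hS,
        smul_eq_mul, List.map_cons, List.prod_cons]
      ring

end Functional

end ExtYangian

/-! ### Linear independence of the ordered monomials -/

namespace ExtYangian

open OSType

set_option linter.unusedSectionVars false

variable {ty : OSType} {n : ℕ}

namespace PBWIndex

/-- The degree of the generator with a given label. -/
def weight : PBWIndex ty n → ℕ
  | t _ _ _ r => r
  | z r => r

/-- Whether a label is that of one of the elements `t_ij^(r)`. -/
def IsT : PBWIndex ty n → Prop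
  | t _ _ _ _ => True
  | z _ => False

/-- The operator on the evaluation module by which the leading part of a generator acts. -/
noncomputable def top : PBWIndex ty n → EvalMat ty n
  | t i j _ r => evalTop i j r
  | z _ => 0

/-- The scalar by which the leading part of the action of a generator is twisted. -/
noncomputable def scalar (f : ℕ → ℂ) : PBWIndex ty n → ℂ
  | t i j _ r => if i = j then f r else 0
  | z r => 2 * f r

/-- The functional dual to the leading part of a generator `t_ij^(r)`. -/
noncomputable def dual : PBWIndex ty n → EvalMat ty n →ₗ[ℂ] ℂ
  -- On the top part of t_ij the unnormalized functional takes the value -1 - θ_ji θ_ij = -2. If i =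
  -- -j, which forces the symplectic case, the two matrix units coincide, the entry is -2 and is
  -- counted twice, giving -4.
  | t i j _ r => (if i = neg j then -1 / 4 else -1 / 2 : ℂ) •
      ((Polynomial.lcoeff ℂ r) ∘ₗ (Matrix.entryLinearMap ℂ ℂ[X] j i
        - theta j i • Matrix.entryLinearMap ℂ ℂ[X] (neg i) (neg j)))
  | z _ => 0

theorem dual_t_apply (i j : ty.Idx n) (h) (r : ℕ) (M : EvalMat ty n) :
    dual (t i j h r) M = (if i = neg j then -1 / 4 else -1 / 2) *
      ((M j i).coeff r - theta j i * (M (neg i) (neg j)).coeff r) := by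
  rw [dual, LinearMap.smul_apply, smul_eq_mul]
  simp

/-- The functional is skew under the transposition defining 𝔞, which fixes the identity; hence a
slot that no letter touches contributes 0. -/
theorem dual_one (g : PBWIndex ty n) : g.dual 1 = 0 := by
  cases g with
  | z r => rfl
  | t i j h r =>
    rw [dual_t_apply]
    by_cases hij : i = j
    · subst hij; simp [theta_self]
    · rw [Matrix.one_apply_ne' hij, Matrix.one_apply_ne fun h => hij (neg_inj.1 h)]
      simp

theorem top_of_not_isT {g : PBWIndex ty n} (hg : ¬ g.IsT) : g.top = 0 := by
  cases g with
  | z r => rfl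
  | t i j h r => exact absurd trivial hg

theorem dual_top [DecidableEq (PBWIndex ty n)] {b : PBWIndex ty n} (hb : b.IsT)
    (g : PBWIndex ty n) : b.dual g.top = if g = b then 1 else 0 := by
  cases b with
  | z r => exact absurd hb id
  | t i j h r =>
    cases g with
    | z r' => simp [top]
    | t p q h' r' =>
      -- The reflection (p, q) ↦ (-q, -p) reverses the sign of p + q. Two admissible labels can be
      -- reflections of each other only when the sum is 0, and then they are equal.
      have hB : (neg p = j ∧ neg q = i) → (p = i ∧ q = j) ∧ i = neg j := by
        rintro ⟨rfl, rfl⟩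
        have e : p.1 + q.1 = 0 := by
          simp only [neg_val] at h
          split_ifs at h h' <;> omega
        have e' : neg q = p := Subtype.ext (by rw [neg_val]; omega)
        have e'' : neg p = q := Subtype.ext (by rw [neg_val]; omega)
        rw [e', e'']
        exact ⟨⟨rfl, rfl⟩, e'.symm⟩
      have hs : i = neg j → theta i j = -1 := by
        rintro rfl
        have hsym : ty.isSymplectic = true := by
          by_contra hn
          rw [if_neg hn, neg_val] at h
          omega
        rw [theta, if_pos hsym, neg_val, Int.sign_neg, neg_mul, sign_mul_sign hsym]
        simp
      have hm : theta j i * theta i j = 1 := by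
        rw [theta_comm, theta_mul_theta]
      have e1 : (neg p = neg i ∧ neg q = neg j) ↔ (p = i ∧ q = j) := by
        rw [neg_inj, neg_inj]
      have e2 : (q = j ∧ p = i) ↔ (p = i ∧ q = j) := and_comm
      have e3 : (q = neg i ∧ p = neg j) ↔ (neg p = j ∧ neg q = i) := by
        rw [neg_eq_iff, neg_eq_iff, and_comm]
      have e4 : (t p q h' r' = t i j h r) ↔ (p = i ∧ q = j) ∧ r = r' := by
        constructor
        · intro h; cases h; exact ⟨⟨rfl, rfl⟩, rfl⟩
        · rintro ⟨⟨rfl, rfl⟩, rfl⟩; rfl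
      rw [dual_t_apply, top, evalTop]
      simp only [Matrix.sub_apply, Matrix.smul_apply, Matrix.single_apply, Polynomial.coeff_sub,
        Polynomial.coeff_smul, e1, e2, e3, e4]
      by_cases hr : r = r'
      · subst hr
        by_cases hA : p = i ∧ q = j
        · obtain ⟨rfl, rfl⟩ := hA
          by_cases hc : p = neg q
          · have hc' : neg p = q ∧ neg q = p := ⟨by rw [neg_eq_iff]; exact hc, hc.symm⟩
            have := hs hc
            rw [this] at hm
            have hm' : theta q p = -1 := by linear_combination -hm
            simp [hc', hs hc, hm']
            norm_num
          · have hc' : ¬ (neg p = q ∧ neg q = p) := fun h => hc (hB h).2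
            simp [hc', hc, hm]
            norm_num
        · have hB' : ¬ (neg p = j ∧ neg q = i) := fun h => hA (hB h).1
          simp [hA, hB']
      · have hr' : ∀ a : Prop, [Decidable a] → (if a then (Polynomial.X ^ r' : ℂ[X]) else 0).coeff r
            = 0 := by
          intro a _
          split_ifs <;> simp [Polynomial.coeff_X_pow, hr]
        simp only [hr', hr]
        simp

end PBWIndex

theorem natDegree_rho_pbwElem {k : ℕ} (f : ℕ → ℂ) (g : PBWIndex ty n) :
    (rho ty n k f (pbwElem g)).natDegree ≤ g.weight := by
  cases g with
  | t i j h r => exact natDegree_rho_t f i j r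
  | z r => exact natDegree_rho f (z_mem r)

theorem coeff_rho_pbwElem (hn : 1 ≤ n) {k : ℕ} (f : ℕ → ℂ) (g : PBWIndex ty n) :
    (rho ty n k f (pbwElem g)).coeff g.weight =
      tensorLetter PBWIndex.top (PBWIndex.scalar f) k g := by
  cases g with
  | t i j h r =>
    refine (coeff_rho_t f i j r).trans ?_
    rw [rhoTop, tensorLetter]
    congr 1
    simp only [PBWIndex.scalar]
    split_ifs <;> simp
  | z r =>
    refine (coeff_rho_z hn f r).trans ?_
    rw [tensorLetter_of_eq_zero (PBWIndex.top_of_not_isT id)]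
    rfl

/-- Coefficients in the extremal degree multiply, so in degree equal to its weight a monomial acts
by the product of the leading parts of its letters. -/
theorem rho_prod_spec (hn : 1 ≤ n) {k : ℕ} (f : ℕ → ℂ) (l : List (PBWIndex ty n)) :
    (rho ty n k f (l.map pbwElem).prod).natDegree ≤ (l.map PBWIndex.weight).sum ∧
      (rho ty n k f (l.map pbwElem).prod).coeff (l.map PBWIndex.weight).sum =
        (l.map (tensorLetter PBWIndex.top (PBWIndex.scalar f) k)).prod := by
  induction l with
  | nil => simp
  | cons g l ih =>
    simp only [List.map_cons, List.prod_cons, List.sum_cons, map_mul]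
    refine ⟨Polynomial.natDegree_mul_le.trans (add_le_add (natDegree_rho_pbwElem f g) ih.1), ?_⟩
    rw [Polynomial.coeff_mul_add_eq_of_natDegree_le (natDegree_rho_pbwElem f g) ih.1,
      coeff_rho_pbwElem hn, ih.2]

/-- The total degree of a multiset of labels. -/
def multiWeight (m : Multiset (PBWIndex ty n)) : ℕ := (m.map PBWIndex.weight).sum

theorem sum_weight_sort (o : LinearOrder (PBWIndex ty n)) (m : Multiset (PBWIndex ty n)) :
    ((m.sort o.le).map PBWIndex.weight).sum = multiWeight m := by
  rw [multiWeight]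
  conv_rhs => rw [← Multiset.sort_eq m o.le]
  rw [Multiset.map_coe, Multiset.sum_coe]

open Classical in
theorem prod_monomial {ι : Type*} (m : Multiset ι) :
    (m.map fun g => (MvPolynomial.X g : MvPolynomial ι ℂ)).prod =
      MvPolynomial.monomial (Multiset.toFinsupp m) 1 := by
  induction m using Multiset.induction_on with
  | empty => simp
  | cons g m ih =>
    rw [Multiset.map_cons, Multiset.prod_cons, ih, ← Multiset.singleton_add, map_add,
      Multiset.toFinsupp_singleton, MvPolynomial.X, MvPolynomial.monomial_mul, one_mul]

theorem eq_zero_of_sum_monomial {ι M : Type*} (S : Finset M) (e : M → Multiset ι) (b : M → ℂ)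
    (h : ∑ m ∈ S, MvPolynomial.C (b m) *
      ((e m).map fun g => (MvPolynomial.X g : MvPolynomial ι ℂ)).prod = 0) {m0 : M} (hm0 : m0 ∈ S)
    (hinj : ∀ m ∈ S, b m ≠ 0 → e m = e m0 → m = m0) : b m0 = 0 := by
  classical
  have hcoeff := congrArg (MvPolynomial.coeff (Multiset.toFinsupp (e m0))) h
  simp only [prod_monomial, MvPolynomial.coeff_sum, MvPolynomial.coeff_C_mul,
    MvPolynomial.coeff_monomial, MvPolynomial.coeff_zero] at hcoeff
  rw [Finset.sum_eq_single m0] at hcoeff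
  · simpa using hcoeff
  · intro m hm hne
    by_cases h0 : b m = 0
    · rw [h0, zero_mul]
    · rw [if_neg, mul_zero]
      exact fun h => hne (hinj m hm h0 (Multiset.toFinsupp.injective h))
  · exact fun h => absurd hm0 h

open Classical in
/-- A linear combination of ordered monomials which acts by zero on all the representations
considered is trivial. -/
theorem eq_zero_of_rho_eq_zero (hn : 1 ≤ n) (o : LinearOrder (PBWIndex ty n))
    (a : Multiset (PBWIndex ty n) →₀ ℂ)
    (ha : ∀ k f, rho ty n k f (Finsupp.linearCombination ℂ (orderedMonomial o) a) = 0) :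
    a = 0 := by
  by_contra hne
  have hs : a.support.Nonempty := Finsupp.support_nonempty_iff.2 hne
  -- Maximal weight lets the top polynomial coefficient ignore lighter monomials. Among those of
  -- maximal weight, a maximal number of t-letters makes the others too short to fill all k slots.
  obtain ⟨m0, hm0, hmax⟩ := a.support.exists_max_image
    (fun m => toLex (multiWeight m, (m.filter PBWIndex.IsT).card)) hs
  obtain ⟨L, hL⟩ := Quotient.exists_rep (m0.filter PBWIndex.IsT)
  have hL' : (L : Multiset (PBWIndex ty n)) = m0.filter PBWIndex.IsT := hL
  set k := L.length with hk
  have hk0 : (m0.filter PBWIndex.IsT).card = k := by rw [← hL', Multiset.coe_card]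
  set β : Fin k → PBWIndex ty n := L.get with hβdef
  have hβ : (Finset.univ : Finset (Fin k)).val.map β = m0.filter PBWIndex.IsT := by
    rw [Fin.univ_val_map, hβdef, List.ofFn_get, hL']
  have hβT : ∀ i, (β i).IsT := fun i => by
    have h : β i ∈ m0.filter PBWIndex.IsT := by
      rw [← hβ]; exact Multiset.mem_map_of_mem _ (Finset.mem_univ i)
    exact (Multiset.mem_filter.1 h).2
  -- the contribution of each monomial
  have hterm : ∀ m ∈ a.support, ∃ c : ℕ, (c ≠ 0 ↔ multiWeight m = multiWeight m0 ∧
      m.filter PBWIndex.IsT = m0.filter PBWIndex.IsT) ∧ ∀ f : ℕ → ℂ,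
      pairing (fun i => (β i).dual) ((rho ty n k f (orderedMonomial o m)).coeff (multiWeight m0)) =
        c * ((m.filter fun g => ¬ g.IsT).map (PBWIndex.scalar f)).prod := by
    intro m hm
    have hle := hmax m hm
    rw [Prod.Lex.toLex_le_toLex, hk0] at hle
    have hsort : (((m.sort o.le).filter fun g => g.IsT : List _) : Multiset (PBWIndex ty n)) =
        m.filter PBWIndex.IsT := by
      conv_rhs => rw [← Multiset.sort_eq m o.le]
      rw [Multiset.filter_coe]
    have hsort' : (((m.sort o.le).filter fun g => ¬ g.IsT : List _) : Multiset (PBWIndex ty n)) =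
        m.filter fun g => ¬ g.IsT := by
      conv_rhs => rw [← Multiset.sort_eq m o.le]
      rw [Multiset.filter_coe]
    by_cases hw : multiWeight m = multiWeight m0
    · have hcard : (m.filter PBWIndex.IsT).card ≤ k := by
        rcases hle with h | h
        · exact absurd hw h.ne
        · exact h.2
      have hcoeff : ∀ f, (rho ty n k f (orderedMonomial o m)).coeff (multiWeight m0) =
          pureTensor 1 *
            ((m.sort o.le).map (tensorLetter PBWIndex.top (PBWIndex.scalar f) k)).prod := by
        intro f
        rw [← hw, ← sum_weight_sort o m, orderedMonomial, (rho_prod_spec hn f _).2,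
          pureTensor_one, one_mul]
      -- With fewer than k t-letters some slot stays empty; with exactly k the functionals count
      -- matchings with the t-letters of m0.
      rcases hcard.lt_or_eq with hlt | heq
      · refine ⟨0, ?_, fun f => ?_⟩
        · refine ⟨fun h => absurd rfl h, fun h => ?_⟩
          rw [h.2, hk0] at hlt
          exact absurd hlt (lt_irrefl _)
        · rw [hcoeff, pairing_eq_zero (p := PBWIndex.IsT) (S := Finset.univ) (lam := PBWIndex.dual)
            (β := β)
            (fun g => PBWIndex.top_of_not_isT) (fun _ => PBWIndex.dual_one _) _ 1
            (fun _ _ => rfl)]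
          · simp
          · rw [Finset.card_univ, Fintype.card_fin, ← Multiset.coe_card, hsort]
            exact hlt
      · have hl : ((m.sort o.le).filter fun g => g.IsT).length = (Finset.univ : Finset (Fin k)).card := by
          rw [Finset.card_univ, Fintype.card_fin, ← Multiset.coe_card, hsort, heq]
        obtain ⟨c, h1, h2⟩ := exists_pairing_eq (p := PBWIndex.IsT)
          (lam := PBWIndex.dual) (β := β) (x := PBWIndex.top)
          (fun g => PBWIndex.top_of_not_isT) (fun _ => PBWIndex.dual_one _)
          (fun i g => PBWIndex.dual_top (hβT i) g) (m.sort o.le) Finset.univ hl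
        refine ⟨c, ?_, fun f => ?_⟩
        · rw [h1, hβ, hsort, and_iff_right hw]
        · rw [hcoeff, h2 _ 1 fun _ _ => rfl, Finset.compl_univ, Finset.prod_empty, mul_one,
            ← Multiset.prod_coe, ← Multiset.map_coe, hsort']
    · refine ⟨0, by simp [hw], fun f => ?_⟩
      rw [Polynomial.coeff_eq_zero_of_natDegree_lt]
      · simp
      · refine (rho_prod_spec hn f _).1.trans_lt ?_
        rw [sum_weight_sort]
        rcases hle with h | h
        · exact h
        · exact absurd h.1 hw
  have hterm' : ∀ m, ∃ c : ℕ, m ∈ a.support → (c ≠ 0 ↔ multiWeight m = multiWeight m0 ∧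
      m.filter PBWIndex.IsT = m0.filter PBWIndex.IsT) ∧ ∀ f : ℕ → ℂ,
      pairing (fun i => (β i).dual) ((rho ty n k f (orderedMonomial o m)).coeff (multiWeight m0)) =
        c * ((m.filter fun g => ¬ g.IsT).map (PBWIndex.scalar f)).prod := fun m => by
    by_cases hm : m ∈ a.support
    · obtain ⟨c, hc⟩ := hterm m hm
      exact ⟨c, fun _ => hc⟩
    · exact ⟨0, fun h => absurd h hm⟩
  choose c hc using hterm'
  -- Now f varies. Since z_(r+1) acts by 2 f(r), the choice f(r) = v(z_r)/2 makes the vanishing an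
  -- identity of polynomial functions of v, hence of polynomials.
  have hpoly : ∑ m ∈ a.support, MvPolynomial.C (a m * c m) *
      ((m.filter fun g => ¬ g.IsT).map fun g =>
        (MvPolynomial.X g : MvPolynomial (PBWIndex ty n) ℂ)).prod = 0 := by
    refine MvPolynomial.funext fun v => ?_
    have h := congrArg (fun p => pairing (fun i => (β i).dual) (p.coeff (multiWeight m0)))
      (ha k fun r => v (.z r) / 2)
    simp only [Finsupp.linearCombination_apply, Finsupp.sum, map_sum, map_smul,
      Polynomial.finsetSum_coeff, Polynomial.coeff_smul, Polynomial.coeff_zero, map_zero] at h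
    rw [map_sum, map_zero, ← h]
    refine Finset.sum_congr rfl fun m hm => ?_
    rw [(hc m hm).2, map_mul, MvPolynomial.eval_C, map_multiset_prod, Multiset.map_map,
      smul_eq_mul, mul_assoc]
    congr 3
    refine Multiset.map_congr rfl fun g hg => ?_
    have hgT := (Multiset.mem_filter.1 hg).2
    cases g with
    | t i j h r => exact absurd trivial hgT
    | z r =>
      simp only [Function.comp_apply, MvPolynomial.eval_X, PBWIndex.scalar]
      ring
  have h0 : c m0 ≠ 0 := (hc m0 hm0).1.2 ⟨rfl, rfl⟩
  -- All surviving monomials have the t-part of m0, so they are distinguished by their z-parts and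
  -- the coefficient of m0 can be read off.
  refine mul_ne_zero (Finsupp.mem_support_iff.1 hm0) (Nat.cast_ne_zero.2 h0)
    (eq_zero_of_sum_monomial _ _ _ hpoly hm0 fun m hm hb h => ?_)
  have hcm : c m ≠ 0 := fun h => hb (by rw [h, Nat.cast_zero, mul_zero])
  rw [← Multiset.filter_add_not PBWIndex.IsT m, ((hc m hm).1.1 hcm).2, h,
    Multiset.filter_add_not]

end ExtYangian

/-! ### Straightening of words -/

namespace ExtYangian

open OSType

set_option linter.unusedSectionVars false

section Straightening

variable {A ι : Type*} [Ring A] [Algebra ℂ A] (e : ι → A) (w : ι → ℕ)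

/-- The span of the words of weight less than `p`, or of weight `p` and of length less than `k`. -/
def lowWords (p k : ℕ) : Submodule ℂ A :=
  Submodule.span ℂ {x | ∃ l : List ι, ((l.map w).sum < p ∨ (l.map w).sum ≤ p ∧ l.length < k) ∧
    x = (l.map e).prod}

/-- The span of the words of weight at most `p`. -/
def words (p : ℕ) : Submodule ℂ A :=
  Submodule.span ℂ {x | ∃ l : List ι, (l.map w).sum ≤ p ∧ x = (l.map e).prod}

/-- The product of the elements with labels in a multiset, in increasing order. -/
noncomputable def sortedProd (o : LinearOrder ι) (m : Multiset ι) : A :=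
  ((m.sort o.le).map e).prod

/-- The span of the ordered monomials of weight at most `p`. -/
noncomputable def ordWords (o : LinearOrder ι) (p : ℕ) : Submodule ℂ A :=
  Submodule.span ℂ (sortedProd e o '' {m | (m.map w).sum ≤ p})

variable {e w}

theorem words_mono {p q : ℕ} (h : p ≤ q) : words e w p ≤ words e w q := by
  refine Submodule.span_mono ?_
  rintro _ ⟨l, hl, rfl⟩
  exact ⟨l, hl.trans h, rfl⟩

theorem mul_mem_words {p q : ℕ} {a b : A} (ha : a ∈ words e w p) (hb : b ∈ words e w q) :
    a * b ∈ words e w (p + q) := by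
  have h := Submodule.mul_mem_mul ha hb
  rw [words, words, Submodule.span_mul_span] at h
  refine Submodule.span_mono ?_ h
  rintro _ ⟨_, ⟨l, hl, rfl⟩, _, ⟨l', hl', rfl⟩, rfl⟩
  refine ⟨l ++ l', ?_, ?_⟩
  · rw [List.map_append, List.sum_append]
    exact add_le_add hl hl'
  · rw [List.map_append, List.prod_append]

theorem words_le_lowWords {p q : ℕ} (h : p < q) (k : ℕ) : words e w p ≤ lowWords e w q k := by
  refine Submodule.span_mono ?_
  rintro _ ⟨l, hl, rfl⟩
  exact ⟨l, Or.inl (by omega), rfl⟩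

theorem letter_mem_lowWords {p : ℕ} {g : ι} (h : w g ≤ p) : e g ∈ lowWords e w p 2 :=
  Submodule.subset_span ⟨[g], Or.inr (by simpa using h), by simp⟩

theorem mul_mem_lowWords {p k : ℕ} {a : A} (ha : a ∈ lowWords e w p k) (l : List ι) :
    a * (l.map e).prod ∈ lowWords e w (p + (l.map w).sum) (k + l.length) := by
  refine Submodule.span_induction (p := fun a _ => a * (l.map e).prod ∈
    lowWords e w (p + (l.map w).sum) (k + l.length)) ?_ ?_ ?_ ?_ ha
  · rintro _ ⟨l', hl', rfl⟩
    refine Submodule.subset_span ⟨l' ++ l, ?_, by simp⟩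
    rw [List.map_append, List.sum_append, List.length_append]
    omega
  · simp
  · intro x y _ _ hx hy
    rw [add_mul]; exact Submodule.add_mem _ hx hy
  · intro c x _ hx
    rw [smul_mul_assoc]; exact Submodule.smul_mem _ _ hx

theorem cons_mul_mem_lowWords {p k : ℕ} {a : A} (ha : a ∈ lowWords e w p k) (g : ι) :
    e g * a ∈ lowWords e w (w g + p) (k + 1) := by
  refine Submodule.span_induction (p := fun a _ => e g * a ∈
    lowWords e w (w g + p) (k + 1)) ?_ ?_ ?_ ?_ ha
  · rintro _ ⟨l, hl, rfl⟩
    refine Submodule.subset_span ⟨g :: l, ?_, by simp⟩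
    rw [List.map_cons, List.sum_cons, List.length_cons]
    omega
  · simp
  · intro x y _ _ hx hy
    rw [mul_add]; exact Submodule.add_mem _ hx hy
  · intro c x _ hx
    rw [mul_smul_comm]; exact Submodule.smul_mem _ _ hx

/-- Interchanging two adjacent letters costs their commutator, which by `H` replaces them by terms
of smaller weight, or of no greater weight with fewer than two letters. -/
theorem prod_sub_prod_mem (H : ∀ g h, e g * e h - e h * e g ∈ lowWords e w (w g + w h) 2)
    {l l' : List ι} (h : l.Perm l') :
    (l.map e).prod - (l'.map e).prod ∈ lowWords e w (l.map w).sum l.length := by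
  induction h with
  | nil => simp
  | cons g h ih =>
    simp only [List.map_cons, List.prod_cons, ← mul_sub, List.sum_cons, List.length_cons]
    exact cons_mul_mem_lowWords ih g
  | swap g h l =>
    have := mul_mem_lowWords (H h g) l
    simp only [List.map_cons, List.prod_cons, List.sum_cons, List.length_cons, ← mul_assoc,
      ← sub_mul, ← add_assoc]
    rwa [add_comm 2 l.length] at this
  | trans h1 h2 ih1 ih2 =>
    rw [← (h1.map w).sum_eq, ← h1.length_eq] at ih2
    have := Submodule.add_mem _ ih1 ih2
    rwa [sub_add_sub_cancel] at this

/-- If the commutators of letters are combinations of shorter words, or of words of smaller weight,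
then words are combinations of ordered monomials. -/
theorem words_le_ordWords (H : ∀ g h, e g * e h - e h * e g ∈ lowWords e w (w g + w h) 2)
    (o : LinearOrder ι) (p : ℕ) : words e w p ≤ ordWords e w o p := by
  have mono : ∀ {p q : ℕ}, p ≤ q → ordWords e w o p ≤ ordWords e w o q := fun h =>
    Submodule.span_mono (Set.image_mono fun m (hm : (m.map w).sum ≤ _) => hm.trans h)
  -- Double induction, on the weight and then on the length: the error made by sorting a word has
  -- smaller weight, or the same weight and smaller length.
  have key : ∀ p k, ∀ l : List ι, (l.map w).sum = p → l.length = k →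
      (l.map e).prod ∈ ordWords e w o p := by
    intro p
    induction p using Nat.strong_induction_on with
    | _ p ihp =>
      intro k
      induction k using Nat.strong_induction_on with
      | _ k ihk =>
        intro l hp hk
        have hperm : l.Perm ((l : Multiset ι).sort o.le) := by
          rw [← Multiset.coe_eq_coe, Multiset.sort_eq]
        have h1 := prod_sub_prod_mem H hperm
        have h2 : lowWords e w p k ≤ ordWords e w o p := by
          refine Submodule.span_le.2 ?_
          rintro _ ⟨l', hl', rfl⟩
          rcases hl' with h | ⟨h, h'⟩
          · exact mono h.le (ihp _ h _ l' rfl rfl)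
          · rcases h.lt_or_eq with h | h
            · exact mono h.le (ihp _ h _ l' rfl rfl)
            · exact ihk _ h' l' h rfl
        have h3 : (((l : Multiset ι).sort o.le).map e).prod ∈ ordWords e w o p :=
          Submodule.subset_span ⟨l, by simp [hp], rfl⟩
        rw [hp, hk] at h1
        have := Submodule.add_mem _ (h2 h1) h3
        rwa [sub_add_cancel] at this
  refine Submodule.span_le.2 ?_
  rintro _ ⟨l, hl, rfl⟩
  exact mono hl (key _ _ l rfl rfl)

end Straightening

variable {ty : OSType} {n : ℕ}

/-! ### Spanning by ordered monomials -/

/-- The span of the generators of degree `r`, modulo lower terms. -/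
noncomputable def linPart (ty : OSType) (n r : ℕ) : Submodule ℂ (XAlg ty n) :=
  Submodule.span ℂ {x | ∃ i j : ty.Idx n, x = t i j (r + 1)} ⊔ (filtration ty n).below r

theorem t_mem_linPart (i j : ty.Idx n) (r : ℕ) : t i j (r + 1) ∈ linPart ty n r :=
  Submodule.mem_sup_left (Submodule.subset_span ⟨i, j, rfl⟩)

theorem below_le_linPart (r : ℕ) : (filtration ty n).below r ≤ linPart ty n r := le_sup_right

theorem linPart_le_comp (r : ℕ) : linPart ty n r ≤ (filtration ty n).comp r := by
  refine sup_le (Submodule.span_le.2 ?_) ((filtration ty n).below_le_comp r)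
  rintro _ ⟨i, j, rfl⟩
  exact t_mem i j r

theorem z_mem_linPart (r : ℕ) : z ty n (r + 1) ∈ linPart ty n r := by
  have h := below_le_linPart r (z_sub_mem (ty := ty) (n := n) r)
  exact (Submodule.sub_mem_iff_left _ (Submodule.smul_mem _ _
    (Submodule.sum_mem _ fun i _ => t_mem_linPart _ _ _))).1 h

theorem pbwElem_mem_linPart (g : PBWIndex ty n) : pbwElem g ∈ linPart ty n g.weight := by
  cases g with
  | t i j h r => exact t_mem_linPart i j r
  | z r => exact z_mem_linPart r

theorem commutator_t_mem_linPart (i j k l : ty.Idx n) (r s : ℕ) :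
    t i j (r + 1) * t k l (s + 1) - t k l (s + 1) * t i j (r + 1) ∈ linPart ty n (r + s) := by
  have h := commutator_sub_mem i j k l r s
  rw [← Nat.cast_add, AscFiltration.intComp_natCast_sub_one] at h
  have hτ : ∀ (a b : ty.Idx n), PowerSeries.coeff (r + s + 1) (tauSer a b) ∈ linPart ty n (r + s) :=
    fun a b => by rw [coeff_succ_tauSer]; exact t_mem_linPart a b _
  refine (Submodule.sub_mem_iff_left _ ?_).1 (below_le_linPart _ h)
  have hite : ∀ (P : Prop) [Decidable P] (f : PowerSeries (XAlg ty n)),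
      PowerSeries.coeff (r + s + 1) f ∈ linPart ty n (r + s) →
      PowerSeries.coeff (r + s + 1) (if P then f else 0) ∈ linPart ty n (r + s) := by
    intro P _ f hf
    split_ifs
    · exact hf
    · rw [map_zero]; exact Submodule.zero_mem _
  rw [leadV, map_sub, map_sub, map_sub]
  exact Submodule.sub_mem _ (Submodule.sub_mem _ (hite _ _ (hτ _ _)) (hite _ _ (hτ _ _)))
    (Submodule.sub_mem _ (hite _ _ (Submodule.smul_mem _ _ (hτ _ _)))
      (hite _ _ (Submodule.smul_mem _ _ (hτ _ _))))

/-- Bilinearity reduces the linear parts to generators; any product involving a lower term already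
lies below degree r + s. -/
theorem commutator_mem_linPart {r s : ℕ} {x y : XAlg ty n} (hx : x ∈ linPart ty n r)
    (hy : y ∈ linPart ty n s) : x * y - y * x ∈ linPart ty n (r + s) := by
  obtain ⟨x1, hx1, x2, hx2, rfl⟩ := Submodule.mem_sup.1 hx
  have hlow : ∀ {r s : ℕ} {x y : XAlg ty n}, x ∈ (filtration ty n).below r →
      y ∈ linPart ty n s → x * y - y * x ∈ linPart ty n (r + s) := by
    intro r s x y hx hy
    refine below_le_linPart _ (Submodule.sub_mem _
      ((filtration ty n).below_mul hx (linPart_le_comp _ hy)) ?_)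
    rw [add_comm]
    exact (filtration ty n).mul_below (linPart_le_comp _ hy) hx
  obtain ⟨y1, hy1, y2, hy2, rfl⟩ := Submodule.mem_sup.1 hy
  have h1 : x1 * y1 - y1 * x1 ∈ linPart ty n (r + s) := by
    refine Submodule.span_induction₂ (p := fun x y _ _ => x * y - y * x ∈ linPart ty n (r + s))
      ?_ ?_ ?_ ?_ ?_ ?_ ?_ hx1 hy1
    · rintro _ _ ⟨i, j, rfl⟩ ⟨k, l, rfl⟩
      exact commutator_t_mem_linPart i j k l r s
    · intro x _; simp
    · intro x _; simp
    · intro x y z _ _ _ h h'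
      have := Submodule.add_mem _ h h'
      rwa [sub_add_sub_comm, ← add_mul, ← mul_add] at this
    · intro x y z _ _ _ h h'
      have := Submodule.add_mem _ h h'
      rwa [sub_add_sub_comm, ← add_mul, ← mul_add] at this
    · intro c x y _ _ h
      rw [smul_mul_assoc, mul_smul_comm, ← smul_sub]; exact Submodule.smul_mem _ _ h
    · intro c x y _ _ h
      rw [smul_mul_assoc, mul_smul_comm, ← smul_sub]; exact Submodule.smul_mem _ _ h
  have h2 := hlow hx2 hy
  have h3 := hlow (s := r) hy2 (Submodule.mem_sup_left hx1)
  rw [add_comm s r] at h3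
  have := Submodule.add_mem _ (Submodule.sub_mem _ h1 h3) h2
  convert this using 1
  noncomm_ring

/-- The relations between the generators modulo lower terms. -/
theorem t_add_t_sub_mem (hn : 1 ≤ n) (i j : ty.Idx n) (r : ℕ) :
    t i j (r + 1) + theta i j • t (neg j) (neg i) (r + 1) - (if i = j then z ty n (r + 1) else 0)
      ∈ (filtration ty n).below r := by
  have hτ : ∀ (P : Prop) [Decidable P] (a b : ty.Idx n), PowerSeries.coeff (r + 1)
      (if P then tauSer a b else 0) = if P then t a b (r + 1) else 0 := by
    intro P _ a b
    split_ifs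
    · exact coeff_succ_tauSer a b r
    · exact map_zero _
  have hτ' : ∀ (P : Prop) [Decidable P] (x : ℂ) (a b : ty.Idx n), PowerSeries.coeff (r + 1)
      (if P then x • tauSer a b else 0) = if P then x • t a b (r + 1) else 0 := by
    intro P _ x a b
    split_ifs
    · rw [← coeff_succ_tauSer]
      rfl
    · exact map_zero _
  have h : ∀ i j k l, _ := fun i j k l => lead_add_mem (ty := ty) (n := n) i j k l r
  simp only [AscFiltration.intComp_natCast_sub_one, leadU, leadV, map_sub, hτ, hτ'] at h
  by_cases hij : i = j
  · subst hij
    rw [if_pos rfl, theta_self, one_smul]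
    -- The cancellation of leading terms for the labels (k, i) and (-k, -i), multiplied by -θ_ki,
    -- shows that t_ii + t_(-i,-i) is independent of i up to lower terms. Averaging over k
    -- identifies it with z.
    have h1 : ∀ k : ty.Idx n, (t i i (r + 1) + t (neg i) (neg i) (r + 1))
        - (t k k (r + 1) + t (neg k) (neg k) (r + 1)) ∈ (filtration ty n).below r := by
      intro k
      have := Submodule.smul_mem _ (-theta k i) (h k i (neg k) (neg i))
      simp only [OSType.neg_neg, if_true] at this
      convert this using 1
      have e := theta_mul_theta k i
      simp only [smul_add, smul_sub, smul_smul, neg_mul, e]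
      module
    have h2 := Submodule.smul_mem _ ((ty.size n : ℂ)⁻¹)
      (Submodule.sum_mem _ fun k (_ : k ∈ Finset.univ) => h1 k)
    have h3 := Submodule.sub_mem _ h2 (z_sub_mem (ty := ty) (n := n) r)
    convert h3 using 1
    rw [Finset.sum_sub_distrib, Finset.sum_const, Finset.card_univ, card_idx,
      ← Nat.cast_smul_eq_nsmul ℂ, smul_sub, smul_smul, inv_mul_cancel₀ (size_ne_zero hn), one_smul,
      Finset.sum_add_distrib, sum_neg fun k : ty.Idx n => t k k (r + 1), ← two_smul ℂ, smul_smul,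
      mul_comm (2 : ℂ)]
    abel
  · rw [if_neg hij, sub_zero]
    -- With k = l = -i and i ≠ j only the pair t_ij, t_(-j,-i) survives.
    have := Submodule.smul_mem _ (-1 : ℂ) (h i j (neg i) (neg i))
    have hij' : ¬ neg i = neg j := fun h => hij (neg_inj.1 h)
    simp only [OSType.neg_neg, if_true, if_neg hij', theta_self] at this
    convert this using 1
    module

/-- The relation between t_ij and t_(-j,-i) reverses the sign of i + j. For i + j = 0 in the
orthogonal case both are the same generator, and the relation, divided by 2, expresses it through z
or lower terms. -/
theorem t_mem_span_pbwElem (hn : 1 ≤ n) (i j : ty.Idx n) (r : ℕ) :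
    t i j (r + 1) ∈ Submodule.span ℂ (pbwElem '' {g : PBWIndex ty n | g.weight = r}) ⊔
      (filtration ty n).below r := by
  have h := t_add_t_sub_mem hn i j r
  set S := Submodule.span ℂ (pbwElem '' {g : PBWIndex ty n | g.weight = r}) ⊔
      (filtration ty n).below r with hS
  have hb : (filtration ty n).below r ≤ S := le_sup_right
  have ht : ∀ (i j : ty.Idx n), (if ty.isSymplectic then 0 ≤ i.1 + j.1 else 0 < i.1 + j.1) →
      t i j (r + 1) ∈ S := fun i j hij => Submodule.mem_sup_left (Submodule.subset_span
    ⟨.t i j hij r, rfl, rfl⟩)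
  have hz : (if i = j then z ty n (r + 1) else 0) ∈ S := by
    split_ifs
    · exact Submodule.mem_sup_left (Submodule.subset_span ⟨.z r, rfl, rfl⟩)
    · exact Submodule.zero_mem _
  have h' := (Submodule.sub_mem_iff_left _ hz).1 (hb h)
  by_cases hpos : if ty.isSymplectic then 0 ≤ i.1 + j.1 else 0 < i.1 + j.1
  · exact ht i j hpos
  by_cases hneg : if ty.isSymplectic then 0 ≤ (neg j).1 + (neg i).1 else 0 < (neg j).1 + (neg i).1
  · exact (Submodule.add_mem_iff_left _ (Submodule.smul_mem _ _ (ht _ _ hneg))).1 h'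
  · have hsym : ¬ ty.isSymplectic = true := by
      intro hs
      simp only [hs, if_true, neg_val] at hpos hneg
      omega
    simp only [hsym, neg_val] at hpos hneg
    have e : neg j = i := Subtype.ext (by rw [neg_val]; simp at hpos hneg; omega)
    have e' : neg i = j := by rw [neg_eq_iff, e]
    rw [e, e', theta, if_neg hsym, one_smul, ← two_smul ℂ] at h'
    have := Submodule.smul_mem _ (2⁻¹ : ℂ) h'
    rwa [smul_smul, inv_mul_cancel₀ two_ne_zero, one_smul] at this

/-- It suffices to rewrite single generators. Each is a combination of basis letters of the same
degree up to lower terms, which are handled by induction on the degree. -/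
theorem comp_le_words (hn : 1 ≤ n) (p : ℕ) :
    (filtration ty n).comp p ≤ words (pbwElem (ty := ty) (n := n)) PBWIndex.weight p := by
  have step : ∀ (p : ℕ), (∀ r ≤ p, ∀ i j : ty.Idx n, t i j (r + 1) ∈
      words (pbwElem (ty := ty) (n := n)) PBWIndex.weight r) →
      (filtration ty n).comp p ≤ words (pbwElem (ty := ty) (n := n)) PBWIndex.weight p := by
    intro p hp
    refine Submodule.span_le.2 ?_
    rintro _ ⟨l, hl, rfl⟩
    refine words_mono hl ?_
    induction l with
    | nil => exact Submodule.subset_span ⟨[], by simp, by simp⟩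
    | cons g l ih =>
      rw [List.map_cons, List.sum_cons] at hl
      simp only [List.map_cons, List.prod_cons, List.sum_cons]
      exact mul_mem_words (hp _ (by omega) _ _) (ih (by omega))
  have key : ∀ (r : ℕ) (i j : ty.Idx n), t i j (r + 1) ∈
      words (pbwElem (ty := ty) (n := n)) PBWIndex.weight r := by
    intro r
    induction r using Nat.strong_induction_on with
    | _ r ih =>
      intro i j
      have hS : Submodule.span ℂ (pbwElem '' {g : PBWIndex ty n | g.weight = r}) ⊔
          (filtration ty n).below r ≤ words pbwElem PBWIndex.weight r := by
        refine sup_le (Submodule.span_le.2 ?_) ?_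
        · rintro _ ⟨g, hg, rfl⟩
          exact Submodule.subset_span ⟨[g], by simpa using le_of_eq hg, by simp⟩
        · cases r with
          | zero => exact bot_le
          | succ r => exact (step r fun s hs => ih s (by omega)).trans (words_mono (Nat.le_succ r))
      exact hS (t_mem_span_pbwElem hn i j r)
  exact step p fun r _ => key r

theorem below_le_lowWords (hn : 1 ≤ n) (p k : ℕ) : (filtration ty n).below p ≤
    lowWords (pbwElem (ty := ty) (n := n)) PBWIndex.weight p k := by
  cases p with
  | zero => exact bot_le
  | succ p => exact (comp_le_words hn p).trans (words_le_lowWords (Nat.lt_succ_self p) k)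

theorem commutator_pbwElem_mem (hn : 1 ≤ n) (g h : PBWIndex ty n) :
    pbwElem g * pbwElem h - pbwElem h * pbwElem g ∈
      lowWords (pbwElem (ty := ty) (n := n)) PBWIndex.weight (g.weight + h.weight) 2 := by
  have hle : linPart ty n (g.weight + h.weight) ≤
      lowWords (pbwElem (ty := ty) (n := n)) PBWIndex.weight (g.weight + h.weight) 2 := by
    refine sup_le (Submodule.span_le.2 ?_) (below_le_lowWords hn _ _)
    rintro _ ⟨i, j, rfl⟩
    have hS : Submodule.span ℂ (pbwElem '' {q : PBWIndex ty n | q.weight = g.weight + h.weight}) ⊔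
        (filtration ty n).below (g.weight + h.weight) ≤
        lowWords pbwElem PBWIndex.weight (g.weight + h.weight) 2 := by
      refine sup_le (Submodule.span_le.2 ?_) (below_le_lowWords hn _ _)
      rintro _ ⟨q, hq, rfl⟩
      exact letter_mem_lowWords (le_of_eq hq)
    exact hS (t_mem_span_pbwElem hn i j _)
  exact hle (commutator_mem_linPart (pbwElem_mem_linPart g) (pbwElem_mem_linPart h))

/-- The components of the filtration are spanned by ordered monomials. -/
theorem comp_eq_span (hn : 1 ≤ n) (o : LinearOrder (PBWIndex ty n)) (p : ℕ) :
    (filtration ty n).comp p =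
      Submodule.span ℂ (orderedMonomial o '' {m | multiWeight m ≤ p}) := by
  refine le_antisymm ((comp_le_words hn p).trans
    (words_le_ordWords (commutator_pbwElem_mem hn) o p)) (Submodule.span_le.2 ?_)
  rintro _ ⟨m, hm, rfl⟩
  refine (filtration ty n).mono (hm : multiWeight m ≤ p) ?_
  rw [← sum_weight_sort o m, orderedMonomial]
  induction m.sort o.le with
  | nil => exact (filtration ty n).one_mem
  | cons g l ih =>
    simp only [List.map_cons, List.prod_cons, List.sum_cons]
    exact (filtration ty n).mul_mem (linPart_le_comp _ (pbwElem_mem_linPart g)) ih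

theorem exists_mem_comp (x : XAlg ty n) : ∃ p, x ∈ (filtration ty n).comp p := by
  obtain ⟨x, rfl⟩ := RingQuot.mkAlgHom_surjective ℂ (RTTRel ty n) x
  induction x using FreeAlgebra.induction with
  | grade0 c =>
    refine ⟨0, ?_⟩
    rw [AlgHom.commutes, Algebra.algebraMap_eq_smul_one]
    exact Submodule.smul_mem _ _ (filtration ty n).one_mem
  | grade1 g => exact ⟨g.2.2, t_mem g.1 g.2.1 g.2.2⟩
  | mul a b ha hb =>
    obtain ⟨p, hp⟩ := ha
    obtain ⟨q, hq⟩ := hb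
    exact ⟨p + q, by rw [map_mul]; exact (filtration ty n).mul_mem hp hq⟩
  | add a b ha hb =>
    obtain ⟨p, hp⟩ := ha
    obtain ⟨q, hq⟩ := hb
    refine ⟨p + q, ?_⟩
    rw [map_add]
    exact Submodule.add_mem _ ((filtration ty n).mono (Nat.le_add_right _ _) hp)
      ((filtration ty n).mono (Nat.le_add_left _ _) hq)

theorem span_orderedMonomial (hn : 1 ≤ n) (o : LinearOrder (PBWIndex ty n)) :
    Submodule.span ℂ (Set.range (orderedMonomial o)) = ⊤ := by
  refine eq_top_iff.2 fun x _ => ?_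
  obtain ⟨p, hp⟩ := exists_mem_comp x
  rw [comp_eq_span hn o] at hp
  exact Submodule.span_mono (Set.image_subset_range _ _) hp

theorem linearIndependent_orderedMonomial (hn : 1 ≤ n) (o : LinearOrder (PBWIndex ty n)) :
    LinearIndependent ℂ (orderedMonomial o) := by
  rw [linearIndependent_iff]
  intro a ha
  exact eq_zero_of_rho_eq_zero hn o a fun k f => by rw [ha, map_zero]

/-- The representations considered are jointly faithful. -/
theorem eq_zero_of_forall_rho (hn : 1 ≤ n) {x : XAlg ty n} (hx : ∀ k f, rho ty n k f x = 0) :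
    x = 0 := by
  classical
  let o : LinearOrder (PBWIndex ty n) := WellOrderingRel.isWellOrder.linearOrder _
  have h : x ∈ Submodule.span ℂ (Set.range (orderedMonomial o)) := by
    rw [span_orderedMonomial hn o]; trivial
  obtain ⟨a, rfl⟩ := (Finsupp.mem_span_range_iff_exists_finsupp).1 h
  have := eq_zero_of_rho_eq_zero hn o a fun k f => by
    rw [Finsupp.linearCombination_apply]; exact hx k f
  rw [this, Finsupp.sum_zero_index]

/-! ### The central series -/

/-- Crossing gives some central scalar matrix in each representation. Its scalar must be the image
of z(u), since z(u) is the normalized trace and N ≠ 0. -/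
theorem isCross_map_T_spec (hn : 1 ≤ n) {k : ℕ} (f : ℕ → ℂ) :
    (PowerSeries.map (rho ty n k f).toRingHom).mapMatrix (Tt ty n * T ty n) =
        Matrix.diagonal (fun _ => PowerSeries.map (rho ty n k f).toRingHom (zSer ty n)) ∧
      (PowerSeries.map (rho ty n k f).toRingHom).mapMatrix (T ty n * Tt ty n) =
        Matrix.diagonal (fun _ => PowerSeries.map (rho ty n k f).toRingHom (zSer ty n)) ∧
      ∀ r b, Commute (rho ty n k f (z ty n r)) b := by
  obtain ⟨ζ, hζ, h1, h2⟩ := isCross_rho_T (ty := ty) (n := n) (k := k) f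
  rw [crossTr_map, crossTr_T, ← map_mul] at h1 h2
  have hz : PowerSeries.map (rho ty n k f).toRingHom (zSer ty n) = ζ := by
    rw [zSer, map_smul_powerSeries, Matrix.trace, map_sum]
    have : ∀ i, PowerSeries.map (rho ty n k f).toRingHom
        (Matrix.diag (Tt ty n * T ty n) i) = ζ := fun i => by
      have := congrFun (congrFun h1 i) i
      rwa [Matrix.diagonal_apply_eq] at this
    simp only [this, Finset.sum_const, Finset.card_univ, card_idx]
    rw [← Nat.cast_smul_eq_nsmul ℂ, smul_smul, inv_mul_cancel₀ (size_ne_zero hn), one_smul]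
  rw [hz]
  refine ⟨h1, h2, fun r b => ?_⟩
  have := hζ r b
  rw [← hz, PowerSeries.coeff_map] at this
  exact this

theorem matrix_eq_of_forall_rho (hn : 1 ≤ n)
    {M N : Matrix (ty.Idx n) (ty.Idx n) (PowerSeries (XAlg ty n))}
    (h : ∀ k f, (PowerSeries.map (rho ty n k f).toRingHom).mapMatrix M =
      (PowerSeries.map (rho ty n k f).toRingHom).mapMatrix N) : M = N := by
  ext i j r
  rw [← sub_eq_zero]
  refine eq_zero_of_forall_rho hn fun k f => ?_
  have := congrArg (PowerSeries.coeff r) (congrFun (congrFun (h k f) i) j)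
  rw [RingHom.mapMatrix_apply, RingHom.mapMatrix_apply, Matrix.map_apply, Matrix.map_apply,
    PowerSeries.coeff_map, PowerSeries.coeff_map] at this
  rw [map_sub, sub_eq_zero]
  exact this

/-- The identity holds in every representation `rho`, and these are jointly faithful. Linear
independence and spanning were obtained without it. -/
theorem Tt_mul_T (hn : 1 ≤ n) : Tt ty n * T ty n = Matrix.diagonal fun _ => zSer ty n :=
  matrix_eq_of_forall_rho hn fun k f => by
    rw [(isCross_map_T_spec hn f).1, RingHom.mapMatrix_apply, Matrix.diagonal_map (map_zero _)]

theorem T_mul_Tt (hn : 1 ≤ n) : T ty n * Tt ty n = Matrix.diagonal fun _ => zSer ty n :=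
  matrix_eq_of_forall_rho hn fun k f => by
    rw [(isCross_map_T_spec hn f).2.1, RingHom.mapMatrix_apply, Matrix.diagonal_map (map_zero _)]

theorem z_commute (hn : 1 ≤ n) (r : ℕ) (x : XAlg ty n) : Commute (z ty n r) x := by
  change _ = _
  rw [← sub_eq_zero]
  refine eq_zero_of_forall_rho hn fun k f => ?_
  rw [map_sub, map_mul, map_mul, sub_eq_zero]
  exact (isCross_map_T_spec hn f).2.2 r _

end ExtYangian

/-! ### The associated graded algebra -/

namespace AscFiltration

variable {R A : Type*} [CommRing R] [Ring A] [Algebra R A] (F : AscFiltration R A)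

/-- The map from a component of the filtration to the associated graded algebra. -/
noncomputable def symbLin (p : ℕ) : F.comp p →ₗ[R] F.Gr :=
  (DirectSum.lof R ℕ F.Piece p).comp (Submodule.mkQ ((F.below p).submoduleOf (F.comp p)))

theorem symb_congr {p q : ℕ} {a b : A} (ha : a ∈ F.comp p) (hb : b ∈ F.comp q) (hpq : p = q)
    (hab : a - b ∈ F.below p) : F.symb ha = F.symb hb := by
  subst hpq
  rw [symb, symb, (F.cls_eq_cls ha hb).2 hab]

theorem symb_mul {p q : ℕ} {a b : A} (ha : a ∈ F.comp p) (hb : b ∈ F.comp q) :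
    F.symb ha * F.symb hb = F.symb (F.mul_mem ha hb) := by
  rw [symb, symb, DirectSum.of_mul_of]
  rfl

theorem symb_add {p : ℕ} {a b : A} (ha : a ∈ F.comp p) (hb : b ∈ F.comp p) :
    F.symb (Submodule.add_mem _ ha hb) = F.symb ha + F.symb hb :=
  map_add (F.symbLin p) ⟨a, ha⟩ ⟨b, hb⟩

theorem symb_sub {p : ℕ} {a b : A} (ha : a ∈ F.comp p) (hb : b ∈ F.comp p) :
    F.symb (Submodule.sub_mem _ ha hb) = F.symb ha - F.symb hb :=
  map_sub (F.symbLin p) ⟨a, ha⟩ ⟨b, hb⟩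

theorem symb_smul {p : ℕ} {a : A} (c : R) (ha : a ∈ F.comp p) :
    F.symb (Submodule.smul_mem _ c ha) = c • F.symb ha :=
  map_smul (F.symbLin p) c ⟨a, ha⟩

theorem symb_eq_zero {p : ℕ} {a : A} (ha : a ∈ F.comp p) (h : a ∈ F.below p) : F.symb ha = 0 := by
  rw [F.symb_congr ha (Submodule.zero_mem _) rfl (by simpa using h)]
  exact map_zero (F.symbLin p)

theorem gr_induction {p : F.Gr → Prop} (h0 : p 0)
    (h1 : ∀ (q : ℕ) (a : A) (ha : a ∈ F.comp q), p (F.symb ha))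
    (h2 : ∀ x y, p x → p y → p (x + y)) (x : F.Gr) : p x := by
  induction x using DirectSum.induction_on with
  | zero => exact h0
  | of q x =>
    obtain ⟨a, ha, rfl⟩ := F.exists_cls x
    exact h1 q a ha
  | add x y hx hy => exact h2 x y hx hy

theorem symb_commute {p : ℕ} {a : A} (ha : a ∈ F.comp p) (h : ∀ b, Commute a b) (x : F.Gr) :
    Commute (F.symb ha) x := by
  induction x using F.gr_induction with
  | h0 => exact Commute.zero_right _
  | h1 q b hb =>
    change _ = _
    rw [symb_mul, symb_mul]
    refine F.symb_congr _ _ (add_comm p q) ?_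
    rw [(h b).eq, sub_self]
    exact Submodule.zero_mem _
  | h2 x y hx hy => exact hx.add_right hy

/-- A family of functionals vanishing on the smaller components defines a functional on the
associated graded algebra. -/
noncomputable def grFunctional (d : ℕ → A →ₗ[R] R) (hd : ∀ p, ∀ a ∈ F.below p, d p a = 0) :
    F.Gr →ₗ[R] R :=
  DirectSum.toModule R ℕ R fun p =>
    Submodule.liftQ ((F.below p).submoduleOf (F.comp p)) ((d p).comp (F.comp p).subtype)
      fun a ha => hd p a.1 ha

theorem grFunctional_symb (d : ℕ → A →ₗ[R] R) (hd : ∀ p, ∀ a ∈ F.below p, d p a = 0) {p : ℕ}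
    {a : A} (ha : a ∈ F.comp p) : F.grFunctional d hd (F.symb ha) = d p a :=
  (DirectSum.toModule_lof R p _).trans rfl

end AscFiltration

/-! ### Relations in the graded algebra and the homomorphism from the current algebra -/

namespace ExtYangian

open OSType

set_option linter.unusedSectionVars false

variable {ty : OSType} {n : ℕ}

/-- The image of `t_ij^(r+1)` in the associated graded algebra. -/
noncomputable def tBar (i j : ty.Idx n) (r : ℕ) : GrX ty n := (filtration ty n).symb (t_mem i j r)

/-- The image of `z_(r+1)` in the associated graded algebra. -/
noncomputable def zBar (ty : OSType) (n r : ℕ) : GrX ty n :=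
  (filtration ty n).symb (z_mem (ty := ty) (n := n) r)

theorem tBar_add_tBar (hn : 1 ≤ n) (i j : ty.Idx n) (r : ℕ) :
    tBar i j r + theta i j • tBar (neg j) (neg i) r = if i = j then zBar ty n r else 0 := by
  have h := t_add_t_sub_mem hn i j r
  rw [tBar, tBar, ← AscFiltration.symb_smul, ← AscFiltration.symb_add]
  split_ifs with hij
  · rw [if_pos hij] at h
    exact AscFiltration.symb_congr _ _ _ rfl h
  · rw [if_neg hij, sub_zero] at h
    exact AscFiltration.symb_eq_zero _ _ h

theorem tBar_commutator (i j k l : ty.Idx n) (r s : ℕ) :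
    tBar i j r * tBar k l s - tBar k l s * tBar i j r =
      (if k = j then tBar i l (r + s) else 0) - (if i = l then tBar k j (r + s) else 0)
        - ((if k = neg i then theta i j • tBar (neg j) l (r + s) else 0)
          - if l = neg j then theta i j • tBar k (neg i) (r + s) else 0) := by
  have h := commutator_sub_mem i j k l r s
  rw [← Nat.cast_add, AscFiltration.intComp_natCast_sub_one] at h
  set G := (filtration ty n) with hG
  have hm : ∀ (P : Prop) [Decidable P] (a b : ty.Idx n),
      (if P then t a b (r + s + 1) else 0) ∈ G.comp (r + s) := by
    intro P _ a b
    split_ifs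
    exacts [t_mem _ _ _, Submodule.zero_mem _]
  have hm' : ∀ (P : Prop) [Decidable P] (x : ℂ) (a b : ty.Idx n),
      (if P then x • t a b (r + s + 1) else 0) ∈ G.comp (r + s) := by
    intro P _ x a b
    split_ifs
    exacts [Submodule.smul_mem _ _ (t_mem _ _ _), Submodule.zero_mem _]
  have e : ∀ (P : Prop) [Decidable P] (a b : ty.Idx n),
      (if P then tBar a b (r + s) else 0) = G.symb (hm P a b) := by
    intro P _ a b
    by_cases hP : P
    · simp only [hP, if_true]; rfl
    · simp only [hP, if_false]
      exact (AscFiltration.symb_eq_zero _ _ (Submodule.zero_mem _)).symm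
  have e' : ∀ (P : Prop) [Decidable P] (x : ℂ) (a b : ty.Idx n),
      (if P then x • tBar a b (r + s) else 0) = G.symb (hm' P x a b) := by
    intro P _ x a b
    by_cases hP : P
    · simp only [hP, if_true]
      exact (AscFiltration.symb_smul _ _ _).symm
    · simp only [hP, if_false]
      exact (AscFiltration.symb_eq_zero _ _ (Submodule.zero_mem _)).symm
  have hτ : ∀ (P : Prop) [Decidable P] (a b : ty.Idx n), PowerSeries.coeff (r + s + 1)
      (if P then tauSer a b else 0) = if P then t a b (r + s + 1) else 0 := by
    intro P _ a b
    split_ifs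
    · exact coeff_succ_tauSer a b _
    · exact map_zero _
  have hτ' : ∀ (P : Prop) [Decidable P] (x : ℂ) (a b : ty.Idx n), PowerSeries.coeff (r + s + 1)
      (if P then x • tauSer a b else 0) = if P then x • t a b (r + s + 1) else 0 := by
    intro P _ x a b
    split_ifs
    · rw [← coeff_succ_tauSer]
      rfl
    · exact map_zero _
  rw [e, e, e', e', ← AscFiltration.symb_sub, ← AscFiltration.symb_sub, ← AscFiltration.symb_sub]
  have e1 : tBar k l s * tBar i j r = G.symb (p := r + s) (a := t k l (s + 1) * t i j (r + 1))
      (by rw [add_comm r s]; exact G.mul_mem (t_mem _ _ _) (t_mem _ _ _)) := by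
    rw [tBar, tBar, AscFiltration.symb_mul]
    exact AscFiltration.symb_congr _ _ _ (add_comm s r) (by rw [sub_self]; exact Submodule.zero_mem _)
  rw [e1, tBar, tBar, AscFiltration.symb_mul, ← AscFiltration.symb_sub]
  refine AscFiltration.symb_congr _ _ _ rfl ?_
  rw [leadV, map_sub, map_sub, map_sub, hτ, hτ, hτ', hτ'] at h
  exact h

attribute [local instance 100] LieRing.ofAssociativeRing

/-- The sum `∑ A_ij t_ij^(r+1)` in the associated graded algebra. -/
noncomputable def tSum (r : ℕ) (M : Matrix (ty.Idx n) (ty.Idx n) ℂ) : GrX ty n :=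
  ∑ i, ∑ j, M i j • tBar i j r

theorem tSum_add (r : ℕ) (M N : Matrix (ty.Idx n) (ty.Idx n) ℂ) :
    tSum r (M + N) = tSum r M + tSum r N := by
  simp only [tSum, Matrix.add_apply, add_smul, Finset.sum_add_distrib]

theorem tSum_smul (r : ℕ) (c : ℂ) (M : Matrix (ty.Idx n) (ty.Idx n) ℂ) :
    tSum r (c • M) = c • tSum r M := by
  simp only [tSum, Matrix.smul_apply, smul_assoc, Finset.smul_sum]

theorem tSum_sub (r : ℕ) (M N : Matrix (ty.Idx n) (ty.Idx n) ℂ) :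
    tSum r (M - N) = tSum r M - tSum r N := by
  simp only [tSum, Matrix.sub_apply, sub_smul, Finset.sum_sub_distrib]

theorem tSum_single (r : ℕ) (a b : ty.Idx n) (x : ℂ) :
    tSum r (Matrix.single a b x) = x • tBar a b r := by
  rw [tSum, Finset.sum_eq_single a, Finset.sum_eq_single b]
  · simp
  · intro l _ hl; simp [hl.symm]
  · simp
  · intro k _ hk; simp [hk.symm]
  · simp

/-- The linear map `A ↦ ½ ∑ A_ij t_ij^(r+1)` to the associated graded algebra. -/
noncomputable def tauBar (ty : OSType) (n r : ℕ) : lieAlg ty n →ₗ[ℂ] GrX ty n where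
  toFun M := (1 / 2 : ℂ) • tSum r M.1
  map_add' M N := by
    rw [← smul_add, ← tSum_add]
    rfl
  map_smul' c M := by
    rw [RingHom.id_apply, smul_comm c]
    exact congrArg _ (tSum_smul r c M.1)

theorem tauBar_apply (r : ℕ) (M : lieAlg ty n) :
    tauBar ty n r M = (1 / 2 : ℂ) • tSum r M.1 := rfl

/-- Half of t_ij - θ_ij t_(-j,-i) equals t_ij minus half of t_ij + θ_ij t_(-j,-i), and the latter
sum is δ_ij z. -/
theorem tauBar_F (hn : 1 ≤ n) (i j : ty.Idx n) (r : ℕ) :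
    tauBar ty n r (F i j) = tBar i j r - (if i = j then (1 / 2 : ℂ) else 0) • zBar ty n r := by
  have h : tSum r (F i j).1 = tBar i j r - theta i j • tBar (neg j) (neg i) r := by
    have e : (F i j).1 = Matrix.single i j 1 - theta i j • Matrix.single (neg j) (neg i) 1 := rfl
    rw [e, tSum_sub, tSum_smul, tSum_single, tSum_single, one_smul, one_smul]
  have h' := tBar_add_tBar hn i j r
  have e : (if i = j then (1 / 2 : ℂ) else 0) • zBar ty n r =
      (1 / 2 : ℂ) • if i = j then zBar ty n r else 0 := by
    split_ifs <;> simp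
  rw [tauBar_apply, h, e, ← h']
  module

/-- By the skew symmetry `hM` and the reindexing (i, j) ↦ (-j, -i), the contraction terms of the
commutator repeat the permutation terms; this doubles the bracket and is compensated by the factor ½
in `tauBar`. -/
theorem tSum_commutator (r s : ℕ) (m k : Matrix (ty.Idx n) (ty.Idx n) ℂ)
    (hM : ∀ i j, m i j * theta i j = -m (neg j) (neg i)) :
    tSum r m * tSum s k - tSum s k * tSum r m =
      (2 : ℂ) • (tSum (r + s) (m * k) - tSum (r + s) (k * m)) := by
  have h1 : ∀ i j, tBar i j r * tSum s k - tSum s k * tBar i j r =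
      ∑ l, k j l • tBar i l (r + s) - ∑ p, k p i • tBar p j (r + s)
        - (theta i j • ∑ l, k (neg i) l • tBar (neg j) l (r + s)
          - theta i j • ∑ p, k p (neg j) • tBar p (neg i) (r + s)) := by
    intro i j
    have h2 : tBar i j r * tSum s k - tSum s k * tBar i j r =
        ∑ p, ∑ l, k p l • (tBar i j r * tBar p l s - tBar p l s * tBar i j r) := by
      simp only [tSum, Finset.mul_sum, Finset.sum_mul, mul_smul_comm, smul_mul_assoc, smul_sub,
        Finset.sum_sub_distrib]
    rw [h2]
    simp only [tBar_commutator, smul_sub, Finset.sum_sub_distrib, smul_ite, smul_zero]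
    refine congrArg₂ (· - ·) (congrArg₂ (· - ·) ?_ ?_) (congrArg₂ (· - ·) ?_ ?_)
    · rw [Finset.sum_eq_single j]
      · simp
      · intro p _ hp; simp [hp]
      · simp
    · simp
    · rw [Finset.sum_eq_single (neg i)]
      · simp [Finset.smul_sum, smul_comm (theta i j)]
      · intro p _ hp; simp [hp]
      · simp
    · simp [Finset.smul_sum, smul_comm (theta i j)]
  have h3 : tSum r m * tSum s k - tSum s k * tSum r m =
      ∑ i, ∑ j, m i j • (tBar i j r * tSum s k - tSum s k * tBar i j r) := by
    rw [tSum.eq_def r m]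
    simp only [Finset.mul_sum, Finset.sum_mul, mul_smul_comm, smul_mul_assoc, smul_sub,
      Finset.sum_sub_distrib]
  have hd1 : ∑ i, ∑ j, m i j • ∑ l, k j l • tBar i l (r + s) = tSum (r + s) (m * k) := by
    refine Finset.sum_congr rfl fun i _ => ?_
    simp only [Finset.smul_sum, Matrix.mul_apply, Finset.sum_smul, smul_smul]
    exact Finset.sum_comm
  have hd2 : ∑ i, ∑ j, m i j • ∑ p, k p i • tBar p j (r + s) = tSum (r + s) (k * m) := by
    simp only [tSum, Finset.smul_sum, Matrix.mul_apply, Finset.sum_smul, smul_smul]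
    refine Finset.sum_comm.trans ((Finset.sum_congr rfl fun j _ => Finset.sum_comm).trans
      (Finset.sum_comm.trans ?_))
    simp only [mul_comm]
  have hd3 : ∑ i, ∑ j, m i j • theta i j • ∑ l, k (neg i) l • tBar (neg j) l (r + s) =
      -tSum (r + s) (m * k) := by
    rw [← hd1, Finset.sum_comm, ← Finset.sum_neg_distrib, ← sum_neg]
    refine Finset.sum_congr rfl fun i _ => ?_
    rw [← Finset.sum_neg_distrib, ← sum_neg]
    refine Finset.sum_congr rfl fun j _ => ?_
    rw [smul_smul, hM, OSType.neg_neg, OSType.neg_neg, neg_smul]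
  have hd4 : ∑ i, ∑ j, m i j • theta i j • ∑ p, k p (neg j) • tBar p (neg i) (r + s) =
      -tSum (r + s) (k * m) := by
    rw [← hd2, Finset.sum_comm, ← Finset.sum_neg_distrib, ← sum_neg]
    refine Finset.sum_congr rfl fun i _ => ?_
    rw [← Finset.sum_neg_distrib, ← sum_neg]
    refine Finset.sum_congr rfl fun j _ => ?_
    rw [smul_smul, hM, OSType.neg_neg, OSType.neg_neg, neg_smul]
  rw [h3]
  simp only [h1, smul_sub, Finset.sum_sub_distrib, hd1, hd2, hd3, hd4]
  module

theorem tauBar_bracket (r s : ℕ) (M N : lieAlg ty n) :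
    tauBar ty n r M * tauBar ty n s N - tauBar ty n s N * tauBar ty n r M =
      tauBar ty n (r + s) ⁅M, N⁆ := by
  have hM : ∀ i j, M.1 i j * theta i j = -M.1 (neg j) (neg i) := fun i j => by
    have h := (mem_lieAlg M.1).1 M.2 (neg j) (neg i)
    rw [theta_neg_neg, OSType.neg_neg, OSType.neg_neg] at h
    linear_combination h
  have h4 : tSum (r + s) (⁅M, N⁆ : lieAlg ty n).1 =
      tSum (r + s) (M.1 * N.1) - tSum (r + s) (N.1 * M.1) := by
    rw [← tSum_sub]
    rfl
  rw [tauBar_apply, tauBar_apply, tauBar_apply, h4, smul_mul_smul_comm, smul_mul_smul_comm,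
    ← smul_sub, tSum_commutator r s _ _ hM, smul_smul]
  norm_num

/-- The Lie algebra homomorphism from the current algebra to the associated graded algebra. -/
noncomputable def currentLin (ty : OSType) (n : ℕ) : Current ty n →ₗ[ℂ] GrX ty n :=
  TensorProduct.lift (Polynomial.lsum fun r => LinearMap.toSpanSingleton ℂ _ (tauBar ty n r))

theorem currentLin_monomial (r : ℕ) (c : ℂ) (M : lieAlg ty n) :
    currentLin ty n (Polynomial.monomial r c ⊗ₜ M) = c • tauBar ty n r M := by
  rw [currentLin, TensorProduct.lift.tmul, Polynomial.lsum_apply, Polynomial.sum_monomial_index]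
  · rfl
  · exact map_zero _

theorem currentLin_lie (x y : Current ty n) :
    currentLin ty n ⁅x, y⁆ =
      currentLin ty n x * currentLin ty n y - currentLin ty n y * currentLin ty n x := by
  have add_l : ∀ a b c : Current ty n, ⁅a + b, c⁆ = ⁅a, c⁆ + ⁅b, c⁆ := fun a b c => add_lie a b c
  have add_r : ∀ a b c : Current ty n, ⁅a, b + c⁆ = ⁅a, b⁆ + ⁅a, c⁆ := fun a b c => lie_add a b c
  have zero_l : ∀ a : Current ty n, ⁅(0 : Current ty n), a⁆ = 0 := fun a => zero_lie a
  have zero_r : ∀ a : Current ty n, ⁅a, (0 : Current ty n)⁆ = 0 := fun a => lie_zero a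
  induction x using TensorProduct.induction_on with
  | zero => rw [zero_l, map_zero, zero_mul, mul_zero, sub_zero]
  | add x1 x2 h1 h2 => rw [add_l, map_add, map_add, h1, h2]; noncomm_ring
  | tmul p M =>
    induction y using TensorProduct.induction_on with
    | zero => rw [zero_r, map_zero, zero_mul, mul_zero, sub_zero]
    | add y1 y2 h1 h2 => rw [add_r, map_add, map_add, h1, h2]; noncomm_ring
    | tmul q N =>
      induction p using Polynomial.induction_on' with
      | add p1 p2 h1 h2 =>
        rw [TensorProduct.add_tmul, add_l, map_add, map_add, h1, h2]; noncomm_ring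
      | monomial r a =>
        induction q using Polynomial.induction_on' with
        | add q1 q2 h1 h2 =>
          rw [TensorProduct.add_tmul, add_r, map_add, map_add, h1, h2]; noncomm_ring
        | monomial s b =>
          have e : ⁅(Polynomial.monomial r a ⊗ₜ[ℂ] M : Current ty n),
              (Polynomial.monomial s b ⊗ₜ[ℂ] N : Current ty n)⁆ =
              (Polynomial.monomial r a * Polynomial.monomial s b) ⊗ₜ[ℂ] ⁅M, N⁆ := rfl
          rw [e, Polynomial.monomial_mul_monomial,
            currentLin_monomial, currentLin_monomial, currentLin_monomial, ← tauBar_bracket,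
            smul_mul_smul_comm, smul_mul_smul_comm, mul_comm b a, smul_sub]

/-- The Lie algebra homomorphism from the current algebra to the associated graded algebra. -/
noncomputable def currentHom (ty : OSType) (n : ℕ) : Current ty n →ₗ⁅ℂ⁆ GrX ty n :=
  { currentLin ty n with map_lie' := fun {x y} => currentLin_lie x y }

theorem zBar_commute (hn : 1 ≤ n) (r : ℕ) (x : GrX ty n) : Commute (zBar ty n r) x :=
  (filtration ty n).symb_commute _ (z_commute hn (r + 1)) x

/-- The homomorphism sending the polynomial variables to the images of the central elements. -/
noncomputable def zetaHom (ty : OSType) (hn : 1 ≤ n) : MvPolynomial ℕ ℂ →ₐ[ℂ] GrX ty n :=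
  -- The polynomials are evaluated in the centre, which is commutative, and then included.
  (Subalgebra.center ℂ (GrX ty n)).val.comp (MvPolynomial.aeval fun r =>
    (⟨zBar ty n r, Subalgebra.mem_center_iff.2 fun b => ((zBar_commute hn r b).eq).symm⟩ :
      Subalgebra.center ℂ (GrX ty n)))

theorem zetaHom_commute (hn : 1 ≤ n) (p : MvPolynomial ℕ ℂ) (x : GrX ty n) :
    Commute (zetaHom ty hn p) x :=
  (Subalgebra.mem_center_iff.1 (MvPolynomial.aeval (fun r =>
    (⟨zBar ty n r, Subalgebra.mem_center_iff.2 fun b => ((zBar_commute hn r b).eq).symm⟩ :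
      Subalgebra.center ℂ (GrX ty n))) p).2 x).symm

theorem zetaHom_X (hn : 1 ≤ n) (r : ℕ) : zetaHom ty hn (MvPolynomial.X r) = zBar ty n r := by
  rw [zetaHom, AlgHom.comp_apply, MvPolynomial.aeval_X]
  rfl

/-- The homomorphism from `U(𝔞[x]) ⊗ ℂ[ζ_1, ζ_2, …]` to the associated graded algebra. -/
noncomputable def grHom (ty : OSType) (hn : 1 ≤ n) :
    UCurrent ty n ⊗[ℂ] MvPolynomial ℕ ℂ →ₐ[ℂ] GrX ty n :=
  Algebra.TensorProduct.lift (UniversalEnvelopingAlgebra.lift ℂ (currentHom ty n)) (zetaHom ty hn)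
    fun _ p => (zetaHom_commute hn p _).symm

theorem grHom_zeta (hn : 1 ≤ n) (r : ℕ) :
    grHom ty hn (1 ⊗ₜ MvPolynomial.X r) = zBar ty n r := by
  rw [grHom, Algebra.TensorProduct.lift_tmul, map_one, one_mul, zetaHom_X]

theorem grHom_Fx (hn : 1 ≤ n) (i j : ty.Idx n) (r : ℕ) :
    grHom ty hn (Fx i j r ⊗ₜ 1) = tauBar ty n r (F i j) := by
  rw [grHom, Algebra.TensorProduct.lift_tmul, map_one, mul_one, Fx,
    UniversalEnvelopingAlgebra.lift_ι_apply, ← Polynomial.monomial_one_right_eq_X_pow]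
  refine (currentLin_monomial r 1 (F i j)).trans (one_smul _ _)

end ExtYangian

/-! ### The isomorphism -/

namespace ExtYangian

open OSType

set_option linter.unusedSectionVars false

variable {ty : OSType} {n : ℕ}

/-- The element of `U(𝔞[x]) ⊗ ℂ[ζ_1, ζ_2, …]` corresponding to `t_ij^(r+1)`. -/
noncomputable def tCur (i j : ty.Idx n) (r : ℕ) : UCurrent ty n ⊗[ℂ] MvPolynomial ℕ ℂ :=
  Fx i j r ⊗ₜ[ℂ] 1 + (if i = j then (1 / 2 : ℂ) else 0) • (1 ⊗ₜ[ℂ] MvPolynomial.X r)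

theorem grHom_tCur (hn : 1 ≤ n) (i j : ty.Idx n) (r : ℕ) :
    grHom ty hn (tCur i j r) = tBar i j r := by
  rw [tCur, map_add, map_smul, grHom_Fx, grHom_zeta, tauBar_F hn, sub_add_cancel]

/-- The elements corresponding to the generators of the Poincaré-Birkhoff-Witt basis. -/
noncomputable def curElem : PBWIndex ty n → UCurrent ty n ⊗[ℂ] MvPolynomial ℕ ℂ
  | .t i j _ r => tCur i j r
  | .z r => 1 ⊗ₜ[ℂ] MvPolynomial.X r

/-- Symbols are multiplicative when degrees are added, so the image is the symbol taken exactly in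
the degree given by the weight. -/
theorem grHom_prod_curElem (hn : 1 ≤ n) (l : List (PBWIndex ty n)) :
    ∃ h : (l.map pbwElem).prod ∈ (filtration ty n).comp (l.map PBWIndex.weight).sum,
      grHom ty hn (l.map curElem).prod = (filtration ty n).symb h := by
  induction l with
  | nil => exact ⟨(filtration ty n).one_mem, map_one _⟩
  | cons g l ih =>
    obtain ⟨h, e⟩ := ih
    have hg : ∃ h : pbwElem g ∈ (filtration ty n).comp g.weight,
        grHom ty hn (curElem g) = (filtration ty n).symb h := by
      cases g with
      | t i j hij r => exact ⟨t_mem i j r, grHom_tCur hn i j r⟩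
      | z r => exact ⟨z_mem r, grHom_zeta hn r⟩
    obtain ⟨hg, eg⟩ := hg
    refine ⟨(filtration ty n).mul_mem hg h, ?_⟩
    rw [List.map_cons, List.prod_cons, map_mul, e, eg, AscFiltration.symb_mul]
    rfl

theorem grHom_sortedProd (hn : 1 ≤ n) (o : LinearOrder (PBWIndex ty n))
    (m : Multiset (PBWIndex ty n)) :
    ∃ h : orderedMonomial o m ∈ (filtration ty n).comp (multiWeight m),
      grHom ty hn (sortedProd curElem o m) = (filtration ty n).symb h := by
  rw [← sum_weight_sort o m]
  exact grHom_prod_curElem hn (m.sort o.le)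

/-- Each component is spanned by words in the generators: those of exact weight p have the product
of the classes of their letters as symbol, and those of smaller weight have symbol 0. -/
theorem grHom_surjective (hn : 1 ≤ n) : Function.Surjective (grHom ty hn) := by
  have hword : ∀ l : List (ty.Idx n × ty.Idx n × ℕ),
      ∃ h : (l.map fun g => t g.1 g.2.1 (g.2.2 + 1)).prod ∈
        (filtration ty n).comp (l.map fun g => g.2.2).sum,
      grHom ty hn (l.map fun g => tCur g.1 g.2.1 g.2.2).prod = (filtration ty n).symb h := by
    intro l
    induction l with
    | nil => exact ⟨(filtration ty n).one_mem, map_one _⟩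
    | cons g l ih =>
      obtain ⟨h, e⟩ := ih
      refine ⟨(filtration ty n).mul_mem (t_mem g.1 g.2.1 g.2.2) h, ?_⟩
      rw [List.map_cons, List.prod_cons, map_mul, e, grHom_tCur, tBar, AscFiltration.symb_mul]
      rfl
  have hsymb : ∀ (p : ℕ) (a : XAlg ty n) (ha : a ∈ (filtration ty n).comp p),
      (filtration ty n).symb ha ∈ (grHom ty hn).range := by
    intro p a ha
    have ha' := ha
    refine Submodule.span_induction (p := fun a _ => ∀ ha : a ∈ (filtration ty n).comp p,
      (filtration ty n).symb ha ∈ (grHom ty hn).range) ?_ ?_ ?_ ?_ ha' ha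
    · rintro _ ⟨l, hl, rfl⟩ ha
      obtain ⟨h, e⟩ := hword l
      rcases hl.lt_or_eq with hlt | heq
      · rw [AscFiltration.symb_eq_zero _ _ ((filtration ty n).comp_le_below hlt h)]
        exact Subalgebra.zero_mem _
      · refine ⟨_, e.trans ?_⟩
        exact AscFiltration.symb_congr _ _ _ heq (by rw [sub_self]; exact Submodule.zero_mem _)
    · intro ha
      rw [AscFiltration.symb_eq_zero _ _ (Submodule.zero_mem _)]
      exact Subalgebra.zero_mem _
    · intro x y hx hy h1 h2 ha
      rw [(filtration ty n).symb_add (show x ∈ (filtration ty n).comp p from hx) hy]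
      exact Subalgebra.add_mem _ (h1 hx) (h2 hy)
    · intro c x hx h ha
      rw [(filtration ty n).symb_smul c (show x ∈ (filtration ty n).comp p from hx)]
      exact Subalgebra.smul_mem _ (h hx) c
  intro x
  change x ∈ (grHom ty hn).range
  induction x using (filtration ty n).gr_induction with
  | h0 => exact Subalgebra.zero_mem _
  | h1 q a ha => exact hsymb q a ha
  | h2 x y hx hy => exact Subalgebra.add_mem _ hx hy

/-- The basis is adapted to the filtration by `comp_eq_span`. The coordinate of a monomial of weight
p therefore vanishes below degree p and descends to a functional on the graded algebra that detects
its symbol. -/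
theorem linearIndependent_symb (hn : 1 ≤ n) (o : LinearOrder (PBWIndex ty n))
    (s : Multiset (PBWIndex ty n) → GrX ty n)
    (hs : ∀ m, ∃ h : orderedMonomial o m ∈ (filtration ty n).comp (multiWeight m),
      s m = (filtration ty n).symb h) : LinearIndependent ℂ s := by
  classical
  let b : Module.Basis (Multiset (PBWIndex ty n)) ℂ (XAlg ty n) :=
    Module.Basis.mk (linearIndependent_orderedMonomial hn o) (span_orderedMonomial hn o).ge
  have hb : ∀ m, b m = orderedMonomial o m := fun m => Module.Basis.mk_apply _ _ m
  have hd : ∀ (m : Multiset (PBWIndex ty n)) (p : ℕ), ∀ a ∈ (filtration ty n).below p,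
      (if multiWeight m = p then b.coord m else 0 : XAlg ty n →ₗ[ℂ] ℂ) a = 0 := by
    intro m p a ha
    split_ifs with hp
    · cases p with
      | zero =>
        have : a = 0 := ha
        rw [this, map_zero]
      | succ p =>
        have ha' : a ∈ (filtration ty n).comp p := ha
        rw [comp_eq_span hn o] at ha'
        refine Submodule.span_induction (p := fun a _ => b.coord m a = 0) ?_ (map_zero _) ?_ ?_ ha'
        · rintro _ ⟨m', hm', rfl⟩
          have hne : m' ≠ m := by
            rintro rfl
            have : multiWeight m' ≤ p := hm'
            omega
          rw [← hb, Module.Basis.coord_apply, Module.Basis.repr_self,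
            Finsupp.single_eq_of_ne hne.symm]
        · intro x y _ _ hx hy
          rw [map_add, hx, hy, add_zero]
        · intro c x _ hx
          rw [map_smul, hx, smul_zero]
    · rfl
  rw [linearIndependent_iff]
  intro a ha
  ext m
  have h := congrArg ((filtration ty n).grFunctional _ (hd m)) ha
  rw [Finsupp.linearCombination_apply, Finsupp.sum, map_sum, map_zero,
    Finset.sum_eq_single m] at h
  · obtain ⟨hm, e⟩ := hs m
    rw [map_smul, e, AscFiltration.grFunctional_symb, if_pos rfl, ← hb, Module.Basis.coord_apply,
      Module.Basis.repr_self, Finsupp.single_eq_same, smul_eq_mul, mul_one] at h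
    exact h
  · intro m' _ hne
    obtain ⟨hm, e⟩ := hs m'
    rw [map_smul, e, AscFiltration.grFunctional_symb]
    split_ifs
    · rw [← hb, Module.Basis.coord_apply, Module.Basis.repr_self,
        Finsupp.single_eq_of_ne hne.symm, smul_zero]
    · rw [LinearMap.zero_apply, smul_zero]
  · intro hm
    rw [Finsupp.notMem_support_iff.1 hm, zero_smul, map_zero]

/-! #### Spanning of the source -/

theorem F_neg (i j : ty.Idx n) : F i j = -theta i j • F (neg j) (neg i) := by
  apply Subtype.ext
  change Fmat i j = -theta i j • Fmat (neg j) (neg i)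
  rw [Fmat, Fmat, theta_neg_neg, OSType.neg_neg, OSType.neg_neg, smul_sub, smul_smul, neg_mul,
    theta_mul_theta]
  module

theorem Fx_neg (i j : ty.Idx n) (r : ℕ) : Fx i j r = -theta i j • Fx (neg j) (neg i) r := by
  rw [Fx, Fx, F_neg i j, TensorProduct.tmul_smul]
  exact map_smul _ _ _

/-- The span of the elements corresponding to the generators. -/
noncomputable def curSpan (ty : OSType) (n : ℕ) :
    Submodule ℂ (UCurrent ty n ⊗[ℂ] MvPolynomial ℕ ℂ) :=
  Submodule.span ℂ (Set.range curElem)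

/-- F_ij = -θ_ij F_(-j,-i) reflects labels to admissible ones; in the orthogonal case F_(i,-i)
equals its own negative and vanishes. -/
theorem Fx_mem_curSpan (i j : ty.Idx n) (r : ℕ) :
    Fx i j r ⊗ₜ[ℂ] (1 : MvPolynomial ℕ ℂ) ∈ curSpan ty n := by
  have ht : ∀ (i j : ty.Idx n), (if ty.isSymplectic then 0 ≤ i.1 + j.1 else 0 < i.1 + j.1) →
      Fx i j r ⊗ₜ[ℂ] (1 : MvPolynomial ℕ ℂ) ∈ curSpan ty n := by
    intro i j hij
    have h1 : tCur i j r ∈ curSpan ty n := Submodule.subset_span ⟨.t i j hij r, rfl⟩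
    have h2 : (1 ⊗ₜ[ℂ] MvPolynomial.X r : UCurrent ty n ⊗[ℂ] MvPolynomial ℕ ℂ) ∈ curSpan ty n :=
      Submodule.subset_span ⟨.z r, rfl⟩
    rw [tCur] at h1
    exact (Submodule.add_mem_iff_left _ (Submodule.smul_mem _ _ h2)).1 h1
  by_cases hpos : if ty.isSymplectic then 0 ≤ i.1 + j.1 else 0 < i.1 + j.1
  · exact ht i j hpos
  by_cases hneg : if ty.isSymplectic then 0 ≤ (neg j).1 + (neg i).1 else 0 < (neg j).1 + (neg i).1
  · rw [Fx_neg, ← TensorProduct.smul_tmul']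
    exact Submodule.smul_mem _ _ (ht _ _ hneg)
  · have hsym : ¬ ty.isSymplectic = true := by
      intro hs
      simp only [hs, if_true, neg_val] at hpos hneg
      omega
    simp only [hsym, neg_val] at hpos hneg
    have e : neg j = i := Subtype.ext (by rw [neg_val]; simp at hpos hneg; omega)
    have e' : neg i = j := by rw [neg_eq_iff, e]
    have h := Fx_neg i j r
    rw [e, e', theta, if_neg hsym, neg_one_smul] at h
    have h0 : (2 : ℂ) • Fx i j r = 0 := by
      rw [two_smul]
      exact add_eq_zero_iff_eq_neg.2 h
    have h1 : Fx i j r = 0 := by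
      rw [← one_smul ℂ (Fx i j r), show (1 : ℂ) = 2⁻¹ * 2 by norm_num, mul_smul, h0, smul_zero]
    rw [h1, TensorProduct.zero_tmul]
    exact Submodule.zero_mem _

attribute [local instance] LieRing.ofAssociativeRing

/-- By skew symmetry the reflected summands of the F_ij rebuild the same matrix a second time, which
accounts for ½. -/
theorem eq_half_sum_F (M : lieAlg ty n) :
    M = ∑ i, ∑ j, ((1 / 2 : ℂ) * M.1 i j) • F i j := by
  apply Subtype.ext
  have e : ((∑ i, ∑ j, ((1 / 2 : ℂ) * M.1 i j) • F i j : lieAlg ty n) :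
      Matrix (ty.Idx n) (ty.Idx n) ℂ) = ∑ i, ∑ j, ((1 / 2 : ℂ) * M.1 i j) • Fmat i j := by
    change (lieAlg ty n).toSubmodule.subtype _ = _
    rw [map_sum]
    refine Finset.sum_congr rfl fun i _ => ?_
    rw [map_sum]
    rfl
  rw [e]
  have e1 : ∀ i j : ty.Idx n, ((1 / 2 : ℂ) * M.1 i j) • Fmat i j =
      (1 / 2 : ℂ) • Matrix.single i j (M.1 i j)
        + (1 / 2 : ℂ) • Matrix.single (neg j) (neg i) (M.1 (neg j) (neg i)) := by
    intro i j
    have h := (mem_lieAlg M.1).1 M.2 i j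
    have h' : M.1 (neg j) (neg i) = -(theta i j * M.1 i j) := by
      linear_combination theta i j * h - M.1 (neg j) (neg i) * theta_mul_theta i j
    have hs : ∀ (a b : ty.Idx n) (x : ℂ), Matrix.single a b x = x • Matrix.single a b 1 :=
      fun a b x => by rw [Matrix.smul_single, smul_eq_mul, mul_one]
    rw [h', hs i j (M.1 i j), hs (neg j) (neg i) (-(theta i j * M.1 i j)), Fmat]
    module
  simp only [e1, Finset.sum_add_distrib, ← Finset.smul_sum]
  have e2 : ∑ i, ∑ j, Matrix.single (neg j) (neg i) (M.1 (neg j) (neg i)) = M.1 := by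
    rw [Finset.sum_comm, sum_neg fun j => ∑ i, Matrix.single j (neg i) (M.1 j (neg i))]
    conv_rhs => rw [Matrix.matrix_eq_sum_single M.1]
    exact Finset.sum_congr rfl fun j _ => sum_neg fun i => Matrix.single j i (M.1 j i)
  rw [e2, ← Matrix.matrix_eq_sum_single, ← add_smul]
  norm_num

theorem iota_mem_curSpan (x : Current ty n) :
    UniversalEnvelopingAlgebra.ι ℂ x ⊗ₜ[ℂ] (1 : MvPolynomial ℕ ℂ) ∈ curSpan ty n := by
  let f : Current ty n →ₗ[ℂ] UCurrent ty n ⊗[ℂ] MvPolynomial ℕ ℂ :=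
    ((TensorProduct.mk ℂ (UCurrent ty n) (MvPolynomial ℕ ℂ)).flip 1).comp
      (UniversalEnvelopingAlgebra.ι ℂ : Current ty n →ₗ⁅ℂ⁆ UCurrent ty n).toLinearMap
  change f x ∈ curSpan ty n
  induction x using TensorProduct.induction_on with
  | zero => rw [map_zero]; exact Submodule.zero_mem _
  | add x y hx hy => rw [map_add]; exact Submodule.add_mem _ hx hy
  | tmul p M =>
    induction p using Polynomial.induction_on' with
    | add p q hp hq => rw [TensorProduct.add_tmul, map_add]; exact Submodule.add_mem _ hp hq
    | monomial r c =>
      rw [eq_half_sum_F M, ← mul_one c, ← smul_eq_mul, ← Polynomial.smul_monomial,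
        ← TensorProduct.smul_tmul', map_smul, TensorProduct.tmul_sum, map_sum,
        Polynomial.monomial_one_right_eq_X_pow]
      refine Submodule.smul_mem _ _ (Submodule.sum_mem _ fun i _ => ?_)
      rw [TensorProduct.tmul_sum, map_sum]
      refine Submodule.sum_mem _ fun j _ => ?_
      rw [TensorProduct.tmul_smul, map_smul]
      exact Submodule.smul_mem _ _ (Fx_mem_curSpan i j r)

theorem one_tmul_commute (p : MvPolynomial ℕ ℂ) (x : UCurrent ty n ⊗[ℂ] MvPolynomial ℕ ℂ) :
    Commute (1 ⊗ₜ[ℂ] p) x := by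
  induction x using TensorProduct.induction_on with
  | zero => exact Commute.zero_right _
  | add x y hx hy => exact hx.add_right hy
  | tmul u q =>
    change _ = _
    rw [Algebra.TensorProduct.tmul_mul_tmul, Algebra.TensorProduct.tmul_mul_tmul, one_mul, mul_one,
      mul_comm p q]

theorem curSpan_le_lowWords : curSpan ty n ≤ lowWords (curElem (ty := ty) (n := n))
    (fun _ => 0) 0 2 := by
  rw [curSpan, Submodule.span_le]
  rintro _ ⟨g, rfl⟩
  exact letter_mem_lowWords le_rfl

theorem commutator_add_central {A : Type*} [Ring A] {a b c d : A} (hb : Commute c b)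
    (ha : Commute d a) (hd : Commute c d) :
    (a + c) * (b + d) - (b + d) * (a + c) = a * b - b * a := by
  rw [add_mul, mul_add, mul_add, add_mul, mul_add, mul_add, hb.eq, ha.eq, hd.eq]
  abel

theorem commutator_tCur_mem (i j k l : ty.Idx n) (r s : ℕ) :
    tCur i j r * tCur k l s - tCur k l s * tCur i j r ∈ curSpan ty n := by
  set a : UCurrent ty n ⊗[ℂ] MvPolynomial ℕ ℂ := Fx i j r ⊗ₜ[ℂ] 1 with ha
  set b : UCurrent ty n ⊗[ℂ] MvPolynomial ℕ ℂ := Fx k l s ⊗ₜ[ℂ] 1 with hb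
  have h1 : ∀ (c : ℂ) (r : ℕ) (x : UCurrent ty n ⊗[ℂ] MvPolynomial ℕ ℂ),
      Commute (c • (1 ⊗ₜ[ℂ] MvPolynomial.X r)) x := fun c r x =>
    (one_tmul_commute (MvPolynomial.X r) x).smul_left c
  have e : tCur i j r * tCur k l s - tCur k l s * tCur i j r = a * b - b * a :=
    commutator_add_central (h1 _ r b) (h1 _ s a) (h1 _ r _)
  have e' : Fx i j r * Fx k l s - Fx k l s * Fx i j r = UniversalEnvelopingAlgebra.ι ℂ
      ⁅((Polynomial.X ^ r : ℂ[X]) ⊗ₜ[ℂ] F i j : Current ty n),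
        ((Polynomial.X ^ s : ℂ[X]) ⊗ₜ[ℂ] F k l : Current ty n)⁆ := by
    rw [LieHom.map_lie]
    rfl
  rw [e, ha, hb, Algebra.TensorProduct.tmul_mul_tmul, Algebra.TensorProduct.tmul_mul_tmul, one_mul,
    ← TensorProduct.sub_tmul, e']
  exact iota_mem_curSpan _

/-- All weights are 0 here, so straightening proceeds by length alone: brackets in the current
algebra are linear in the letters, and the z-letters are central. -/
theorem commutator_curElem_mem (g h : PBWIndex ty n) :
    curElem g * curElem h - curElem h * curElem g ∈ lowWords (curElem (ty := ty) (n := n))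
      (fun _ => 0) 0 2 := by
  cases g with
  | z r =>
    rw [curElem, (one_tmul_commute _ (curElem h)).eq, sub_self]
    exact Submodule.zero_mem _
  | t i j hij r =>
    cases h with
    | z s =>
      rw [curElem.eq_2, (one_tmul_commute _ (curElem _)).eq, sub_self]
      exact Submodule.zero_mem _
    | t k l hkl s => exact curSpan_le_lowWords (commutator_tCur_mem i j k l r s)

/-- The words span a subalgebra. It contains the generators of the polynomial factor and the image
of the current Lie algebra, hence both tensor factors. -/
theorem words_curElem : words (curElem (ty := ty) (n := n)) (fun _ => 0) 0 = ⊤ := by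
  let S : Subalgebra ℂ (UCurrent ty n ⊗[ℂ] MvPolynomial ℕ ℂ) :=
    (words (curElem (ty := ty) (n := n)) (fun _ => 0) 0).toSubalgebra
      (Submodule.subset_span ⟨[], by simp, rfl⟩) fun a b ha hb =>
        mul_mem_words (p := 0) (q := 0) ha hb
  have hc : ∀ x ∈ curSpan ty n, x ∈ S := by
    intro x hx
    refine (Submodule.span_le (p := Subalgebra.toSubmodule S)).2 ?_ hx
    rintro _ ⟨g, rfl⟩
    exact Submodule.subset_span ⟨[g], by simp, by simp⟩
  have hX : ∀ p : MvPolynomial ℕ ℂ, (1 ⊗ₜ[ℂ] p : UCurrent ty n ⊗[ℂ] MvPolynomial ℕ ℂ) ∈ S := by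
    intro p
    change p ∈ S.comap (Algebra.TensorProduct.includeRight (R := ℂ) (A := UCurrent ty n)
      (B := MvPolynomial ℕ ℂ))
    have : Algebra.adjoin ℂ (Set.range MvPolynomial.X) ≤
        S.comap (Algebra.TensorProduct.includeRight (R := ℂ) (A := UCurrent ty n)
          (B := MvPolynomial ℕ ℂ)) := by
      rw [Algebra.adjoin_le_iff]
      rintro _ ⟨r, rfl⟩
      exact hc _ (Submodule.subset_span ⟨.z r, rfl⟩)
    rw [MvPolynomial.adjoin_range_X] at this
    exact this trivial
  have hU : ∀ u : UCurrent ty n, (u ⊗ₜ[ℂ] 1 : UCurrent ty n ⊗[ℂ] MvPolynomial ℕ ℂ) ∈ S := by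
    intro u
    let S' : Subalgebra ℂ (UCurrent ty n) :=
      S.comap (Algebra.TensorProduct.includeLeft (R := ℂ) (S := ℂ) (A := UCurrent ty n)
        (B := MvPolynomial ℕ ℂ))
    let f : Current ty n →ₗ⁅ℂ⁆ S' :=
      { toFun := fun x => ⟨UniversalEnvelopingAlgebra.ι ℂ x, hc _ (iota_mem_curSpan x)⟩
        map_add' := fun x y => Subtype.ext (map_add _ x y)
        map_smul' := fun c x => Subtype.ext (map_smul _ c x)
        map_lie' := fun {x y} => Subtype.ext (LieHom.map_lie _ x y) }
    -- Lifting ι into S' and including back gives an endomorphism of the enveloping algebra that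
    -- fixes ι, hence the identity; so S' is everything.
    have h : S'.val.comp (UniversalEnvelopingAlgebra.lift ℂ f) = AlgHom.id ℂ _ := by
      apply UniversalEnvelopingAlgebra.hom_ext
      ext x
      change ((UniversalEnvelopingAlgebra.lift ℂ f (UniversalEnvelopingAlgebra.ι ℂ x) : S') :
        UCurrent ty n) = UniversalEnvelopingAlgebra.ι ℂ x
      rw [UniversalEnvelopingAlgebra.lift_ι_apply]
      rfl
    have hu := (UniversalEnvelopingAlgebra.lift ℂ f u).2
    rwa [show ((UniversalEnvelopingAlgebra.lift ℂ f u : S') : UCurrent ty n) = u from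
      AlgHom.congr_fun h u] at hu
  rw [eq_top_iff]
  rintro x -
  change x ∈ S
  induction x using TensorProduct.induction_on with
  | zero => exact Subalgebra.zero_mem _
  | add x y hx hy => exact Subalgebra.add_mem _ hx hy
  | tmul u p =>
    rw [show (u ⊗ₜ[ℂ] p : UCurrent ty n ⊗[ℂ] MvPolynomial ℕ ℂ) = (u ⊗ₜ 1) * (1 ⊗ₜ p) by
      rw [Algebra.TensorProduct.tmul_mul_tmul, one_mul, mul_one]]
    exact Subalgebra.mul_mem _ (hU u) (hX p)

/-- A linear map sending a spanning family to a linearly independent one is injective. Only the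
spanning half of the Poincaré-Birkhoff-Witt theorem for 𝔞[x] is used. -/
theorem grHom_injective (hn : 1 ≤ n) : Function.Injective (grHom ty hn) := by
  let o : LinearOrder (PBWIndex ty n) := WellOrderingRel.isWellOrder.linearOrder _
  rw [injective_iff_map_eq_zero]
  intro x hx
  have h : x ∈ Submodule.span ℂ (Set.range (sortedProd (curElem (ty := ty) (n := n)) o)) := by
    have h1 := words_le_ordWords (w := fun _ => 0) commutator_curElem_mem o 0
    rw [words_curElem] at h1
    exact Submodule.span_mono (Set.image_subset_range _ _) (h1 trivial)
  obtain ⟨a, rfl⟩ := (Finsupp.mem_span_range_iff_exists_finsupp).1 h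
  have hli := linearIndependent_symb hn o (fun m => grHom ty hn (sortedProd curElem o m))
    (grHom_sortedProd hn o)
  rw [linearIndependent_iff] at hli
  rw [hli a, Finsupp.sum_zero_index]
  rw [Finsupp.linearCombination_apply, ← hx, Finsupp.sum, Finsupp.sum, map_sum]
  simp only [map_smul]

end ExtYangian

open OSType ExtYangian in
theorem corollary3p10 (ty : OSType) (n : ℕ) (hn : 1 ≤ n)
    (hD : ty = OSType.D → 2 ≤ n) :
    ((Tt ty n * T ty n = Matrix.diagonal fun _ => zSer ty n) ∧
      (T ty n * Tt ty n = Matrix.diagonal fun _ => zSer ty n) ∧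
      (∀ r : ℕ, z ty n r ∈ Subalgebra.center ℂ (XAlg ty n))) ∧
    (∀ o : LinearOrder (PBWIndex ty n),
      LinearIndependent ℂ (orderedMonomial o) ∧
        Submodule.span ℂ (Set.range (orderedMonomial o)) = ⊤) ∧
    (∃ φ : GrX ty n ≃ₐ[ℂ] (UCurrent ty n ⊗[ℂ] MvPolynomial ℕ ℂ),
      (∀ (i j : ty.Idx n) (r : ℕ),
        φ ((filtration ty n).symb (t_mem i j r)) =
          Fx i j r ⊗ₜ[ℂ] 1
            + (if i = j then (1 / 2 : ℂ) else 0) • (1 ⊗ₜ[ℂ] MvPolynomial.X r)) ∧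
      (∀ r : ℕ, ∃ h : z ty n (r + 1) ∈ (filtration ty n).comp r,
        φ ((filtration ty n).symb h) = 1 ⊗ₜ[ℂ] MvPolynomial.X r)) := by
  refine ⟨⟨Tt_mul_T hn, T_mul_Tt hn, fun r => Subalgebra.mem_center_iff.2 fun b =>
      ((z_commute hn r b).eq).symm⟩,
    fun o => ⟨linearIndependent_orderedMonomial hn o, span_orderedMonomial hn o⟩,
    (AlgEquiv.ofBijective (grHom ty hn) ⟨grHom_injective hn, grHom_surjective hn⟩).symm,
    fun i j r => (AlgEquiv.symm_apply_eq _).2 (grHom_tCur hn i j r).symm,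
    fun r => ⟨z_mem r, (AlgEquiv.symm_apply_eq _).2 (grHom_zeta hn r).symm⟩⟩
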